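/- **Setting.** Let $V_n=\mathbb{R}^d$ with the Euclidean norm, let $f_n\colon\Omega_n\to V_{n+1}$ ($0\le n<N$) be maps with $\Omega_n\subset V_n$, and let $\alpha\in(0,1]$. Consider the following conditions. (C1) $\Omega_n$ is open and contains $0$, and $f_n$ is a $C^{1+\alpha}$ diffeomorphism onto its image with $f_n(0)=0$. (C2) $V_n=E_n^u\oplus E_n^s$ for $0\le n\le N$, and $Df_n(0)E_n^{*}=E_{n+1}^{*}$ for $*=u,s$ and $0\le n<N$. (C3) There are $\theta_n>0$ ($0\le n\le N$), $\lambda_n^u,\lambda_n^s\in\mathbb{R}$ and $\beta_n>0$ ($0\le n<N$) such that for all nonzero $v_u\in E_n^u$, $v_s\in E_n^s$: $\|Df_n(0)v_u\|\ge e^{\lambda_n^u}\|v_u\|$, $\|Df_n(0)v_s\|\le e^{\lambda_n^s}\|v_s\|$, $\measuredangle(v_u,v_s)\ge\theta_n$, and $\max(1,|Df_n|_\alpha)\le\beta_n\sin\theta_{n+1}$, where $|Df_n|_\alpha$ is the $\alpha$-Hölder seminorm of $Df_n$ on $\Omega_n$. (C4) $|\lambda_n^u|\le L$, $|\lambda_n^s|\le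 L$, and $\beta_{n+1}\le e^L\beta_n$. Given a threshold $\bar\beta$, let $\Delta_n=\max(0,(\lambda_n^s-\lambda_n^u)/\alpha)$; let $\lambda_n^e=\lambda_n^u-\Delta_n$ if $\beta_n\le\bar\beta$, and $\lambda_n^e=\min\big(\lambda_n^u-\Delta_n,\frac1\alpha\log\frac{\beta_{n-1}}{\beta_n}\big)$ if $\beta_n>\bar\beta$. Given $\hat\chi^u$, let $D_n=\max_{0\le m\le n}\sum_{k=m}^{n-1}(\hat\chi^u-\lambda_k^e)\ge0$ (so $D_n$ is the least constant $M_n^u\ge 0$ satisfying (1) below). Write $B_n^{u}(r)$, $B_n^s(r)$ for the open balls of radius $r$ around $0$ in $E_n^{u}$, $E_n^s$, and write points of $V_n$ as $(v,w)=v+w$ with $v\in E_n^u$, $w\in E_n^s$. Given $\bar r,\bar\tau,\bar\gamma$, put $$U_n=B_n^u(\bar re^{-D_n})\times B_n^s\big(\bar\tau e^{-D_n}+\bar\gamma\,\bar re^{-D_n}\big)\subset V_n .$$ (C5) $\Omega_n\supset U_n$ for $0\le n<N$. Let $F_{m,n}=f_{n-1}\circ\cdots\circ f_m$, and let $\Omega_m^n$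 be the connected component containing $0$ of $\{x\in V_m: F_{m,k}(x)\in U_k\text{ for } m\le k<n\}$ (that is, the maps are restricted to the boxes $U_k$). Let $\mathcal{C}_n(r,\tau,\sigma,\kappa)$ be the set of $C^{1+\alpha}$ functions $\psi\colon B_n^u(r)\to E_n^s$ with $\|\psi(0)\|\le\tau$, $\|D\psi(0)\|\le\sigma$, $|D\psi|_\alpha\le\kappa$. For $\psi_0\colon B_0^u(\bar r)\to E_0^s$, the relation $\psi_n=\mathcal{G}_n\psi_0$, for a function $\psi_n\colon B_n^u(r)\to E_n^s$, means that $\operatorname{graph}\psi_n=F_{0,n}(\operatorname{graph}\psi_0\cap\Omega_0^n)\cap\big(B_n^u(r)\times E_n^s\big)$; there is at most one such $\psi_n$. **Theorem.** Fix $L,\bar\beta>0$, $\alpha\in(0,1]$, $\chi^u>\hat\chi^u>\bar\chi^u>0$ and $\hat\chi^s<\bar\chi^s<0$. Then for all sufficiently small $\bar\gamma,\bar r,\bar\theta>0$, all sufficiently small $\bar\sigma,\bar\tau\ge0$, all sufficiently large $\bar\kappa>0$ (with thresholds depending only on the constants just fixed), and all $\hat\kappa\ge\bar\kappa$ such that $$\bar\tau\le\bar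 r,\qquad \hat\kappa\bar\tau^\alpha\le\bar\sigma,\qquad \bar\sigma+\hat\kappa\bar r^\alpha\le\bar\gamma,$$ every finite sequence $\{f_n\mid 0\le n<N\}$ (in any dimension $d$) satisfying (C1)–(C5) and $\beta_0\le\bar\beta$ has the following properties. Let $M_n^u\ge0$ ($0\le n\le N$) be such that $$\sum_{k=m}^{n-1}\lambda_k^e\ge(n-m)\hat\chi^u-M_n^u\qquad(0\le m<n\le N),\tag{1}$$ and let $M_0^s$ be such that $$\sum_{k=0}^{n-1}\lambda_k^s\le n\hat\chi^s-M_n^u+M_0^s\qquad(0\le n\le N).\tag{2}$$ Write $\mathcal{C}_0=\mathcal{C}_0(\bar r,\bar\tau e^{-M_0^s},\bar\sigma e^{-\alpha M_0^s},\hat\kappa)$. (I) $\theta_n\ge\bar\theta e^{-\alpha M_n^u}$ for $1\le n\le N$. For $0\le n\le N$ and every $\psi_0\in\mathcal{C}_0$ the graph transform $\psi_n=\mathcal{G}_n\psi_0\colon B_n^u(\bar re^{-M_n^u})\to E_n^s$ exists and is $C^{1+\alpha}$; and if $\hat\kappa\le\bar\kappa e^{\alpha n\bar\chi^u}$, then $$\psi_n\in\mathcal{C}_n\big(\bar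 re^{-M_n^u},\ \bar\tau e^{-M_n^u}e^{n\bar\chi^s},\ \bar\sigma e^{\alpha n\bar\chi^s},\ \bar\kappa e^{\alpha M_n^u}\big).$$ (II) If $\psi_0\in\mathcal{C}_0$, $0\le m\le n\le N$ and $x,y\in\operatorname{graph}\psi_m\cap\Omega_m^n$, then $$\|F_{m,n}(x)-F_{m,n}(y)\|\ge e^{-M_n^u}e^{(n-m)\bar\chi^u}\|x-y\|,$$ and the same bound holds between the $E^u$-components of $F_{m,n}(x)-F_{m,n}(y)$ and of $x-y$. (III) If $\psi_0\in\mathcal{C}_0$, $0\le n\le N$, $(v_0,w_0)\in\Omega_0^n$ and $(v_n,w_n)=F_{0,n}(v_0,w_0)$ with $v_n\in B_n^u(\bar re^{-M_n^u})$, then $$\|w_n-\psi_n(v_n)\|\le e^{M_0^s-M_n^u+n\bar\chi^s}\|w_0-\psi_0(v_0)\|.$$ (IV) Let $\psi_0,\varphi_0\in\mathcal{C}_0$, $0\le n\le N$, $\psi_n=\mathcal{G}_n\psi_0$, $\varphi_n=\mathcal{G}_n\varphi_0$, and $\hat r_n=e^{-n\bar\chi^u}e^{M_n^u}\bar r+\bar\tau$.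 If $\psi_0=\varphi_0$ on $B_0^u(\bar r)\cap B_0^u(\hat r_n)$ then $\psi_n=\varphi_n$. In all cases $$\|\psi_n-\varphi_n\|_{C^0}\le e^{n\bar\chi^s}e^{M_0^s}\big(3\bar\tau e^{-M_n^u}+2\bar re^{-n\bar\chi^u}\big).$$ (V) If $\frac1N\sum_{k=0}^{N-1}\lambda_k^e\ge\chi^u$, then there is $\Gamma\subset[1,N]$ with $\#\Gamma\ge\frac{\chi^u-\hat\chi^u}{L-\hat\chi^u}N$ such that $\frac1{n-m}\sum_{k=m}^{n-1}\lambda_k^e\ge\hat\chi^u$ for all $n\in\Gamma$ and $0\le m<n$; hence (I)–(II) hold for all $M_n^u,M_0^s$ such that $M_n^u=0$ for $n\in\Gamma$, $M_n^u\ge0$ satisfies (1) for $n\notin\Gamma$, and (2) holds. -/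

import Mathlib

open scoped Topology

noncomputable section

namespace EffHyp

/-- The space `V_n = ℝ^d`, with its Euclidean norm. -/
abbrev V (d : ℕ) : Type := EuclideanSpace ℝ (Fin d)

/-- `‖g x - g y‖ ≤ C ‖x - y‖^α` on `s`, i.e. the Hölder seminorm `|g|_α` over `s` is at most `C`. -/
def HolderBound {E F : Type*} [NormedAddCommGroup E] [NormedAddCommGroup F]
    (α C : ℝ) (s : Set E) (g : E → F) : Prop :=
  ∀ x ∈ s, ∀ y ∈ s, ‖g x - g y‖ ≤ C * ‖x - y‖ ^ α

/-- The raw data of a sequence of local maps with a splitting and rates. For a sequence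
`f_n : Ω_n → V_{n+1}`, `0 ≤ n < N`, only `Ω n, f n, lamU n, lamS n, β n` with `n < N` and
`Eu n, Es n, θ n` with `n ≤ N` are relevant; values of `f n` off `Ω n` are irrelevant. -/
structure LocalSystem (d : ℕ) where
  /-- the domains -/
  Ω : ℕ → Set (V d)
  /-- the maps -/
  f : ℕ → V d → V d
  /-- the unstable subspaces -/
  Eu : ℕ → Submodule ℝ (V d)
  /-- the stable subspaces -/
  Es : ℕ → Submodule ℝ (V d)
  /-- the rates `λ_n^u` -/
  lamU : ℕ → ℝ
  /-- the rates `λ_n^s` -/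
  lamS : ℕ → ℝ
  /-- the angle bounds -/
  θ : ℕ → ℝ
  /-- the nonlinearity bounds -/
  β : ℕ → ℝ

/-- The product `B^u(r) × B^s(s)` of open balls, in the coordinates of a splitting `Eu ⊕ Es`. -/
def box {d : ℕ} (Eu Es : Submodule ℝ (V d)) (r s : ℝ) : Set (V d) :=
  {x | ∃ (v : Eu) (w : Es), ‖v‖ < r ∧ ‖w‖ < s ∧ x = (v : V d) + (w : V d)}

/-- The cylinder `B^u(r) × Es`. -/
def cylinder {d : ℕ} (Eu Es : Submodule ℝ (V d)) (r : ℝ) : Set (V d) :=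
  {x | ∃ (v : Eu) (w : Es), ‖v‖ < r ∧ x = (v : V d) + (w : V d)}

/-- The graph of `ψ : B^u(r) → Es`. Only the values of `ψ` on the open ball matter. -/
def graphOn {d : ℕ} {Eu Es : Submodule ℝ (V d)} (r : ℝ) (ψ : Eu → Es) : Set (V d) :=
  {x | ∃ v : Eu, ‖v‖ < r ∧ x = (v : V d) + (ψ v : V d)}

/-- `ψ` is of class `C^{1+α}` on the open ball `B^u(r)`. -/
def IsC1Holder {d : ℕ} {Eu Es : Submodule ℝ (V d)} (α r : ℝ) (ψ : Eu → Es) : Prop :=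
  DifferentiableOn ℝ ψ (Metric.ball 0 r) ∧
    ∃ K : ℝ, HolderBound α K (Metric.ball 0 r) (fderiv ℝ ψ)

/-- The class `𝒞(r, τ, σ, κ)` of functions `ψ : B^u(r) → Es` of class `C^{1+α}` with
`‖ψ(0)‖ ≤ τ`, `‖Dψ(0)‖ ≤ σ` and `|Dψ|_α ≤ κ`. -/
def AdmClass {d : ℕ} (Eu Es : Submodule ℝ (V d)) (α r τ σ κ : ℝ) : Set (Eu → Es) :=
  {ψ | DifferentiableOn ℝ ψ (Metric.ball 0 r) ∧ ‖ψ 0‖ ≤ τ ∧ ‖fderiv ℝ ψ 0‖ ≤ σ ∧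
    HolderBound α κ (Metric.ball 0 r) (fderiv ℝ ψ)}

namespace LocalSystem

variable {d : ℕ} (S : LocalSystem d)

/-- Condition (C1): each `f_n` is a diffeomorphism from the open set `Ω_n ∋ 0` onto its image, of
class `C^{1+α}`, and fixes the origin. -/
def C1 (N : ℕ) (α : ℝ) : Prop :=
  ∀ n < N, IsOpen (S.Ω n) ∧ (0 : V d) ∈ S.Ω n ∧ S.f n 0 = 0 ∧
    ContDiffOn ℝ 1 (S.f n) (S.Ω n) ∧
    (∃ K : ℝ, HolderBound α K (S.Ω n) (fderiv ℝ (S.f n))) ∧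
    Set.InjOn (S.f n) (S.Ω n) ∧ ∀ x ∈ S.Ω n, (fderiv ℝ (S.f n) x).IsInvertible

/-- Condition (C2): an invariant splitting. -/
def C2 (N : ℕ) : Prop :=
  (∀ n ≤ N, IsCompl (S.Eu n) (S.Es n)) ∧
  ∀ n < N, (S.Eu n).map (fderiv ℝ (S.f n) 0 : V d →ₗ[ℝ] V d) = S.Eu (n + 1) ∧
    (S.Es n).map (fderiv ℝ (S.f n) 0 : V d →ₗ[ℝ] V d) = S.Es (n + 1)

/-- Condition (C3): rates, angles and nonlinearities. -/
def C3 (N : ℕ) (α : ℝ) : Prop :=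
  (∀ n ≤ N, 0 < S.θ n ∧ ∀ v ∈ S.Eu n, ∀ w ∈ S.Es n, v ≠ 0 → w ≠ 0 →
    S.θ n ≤ InnerProductGeometry.angle v w) ∧
  ∀ n < N, 0 < S.β n ∧
    (∀ v ∈ S.Eu n, Real.exp (S.lamU n) * ‖v‖ ≤ ‖fderiv ℝ (S.f n) 0 v‖) ∧
    (∀ w ∈ S.Es n, ‖fderiv ℝ (S.f n) 0 w‖ ≤ Real.exp (S.lamS n) * ‖w‖) ∧
    1 ≤ S.β n * Real.sin (S.θ (n + 1)) ∧
    HolderBound α (S.β n * Real.sin (S.θ (n + 1))) (S.Ω n) (fderiv ℝ (S.f n))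

/-- Condition (C4). -/
def C4 (N : ℕ) (L : ℝ) : Prop :=
  (∀ n < N, |S.lamU n| ≤ L ∧ |S.lamS n| ≤ L) ∧
  ∀ n, n + 1 < N → S.β (n + 1) ≤ Real.exp L * S.β n

/-- The defect from domination `Δ_n = max(0, (λ_n^s - λ_n^u)/α)`. -/
def defect (α : ℝ) (n : ℕ) : ℝ := max 0 ((S.lamS n - S.lamU n) / α)

/-- The effective rate `λ_n^e` with threshold `βbar`. (For `n = 0` the second branch, which refers
to `β_{n-1}`, does not occur when `β_0 ≤ βbar`.) -/
def lamE (α βbar : ℝ) (n : ℕ) : ℝ :=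
  if S.β n ≤ βbar then S.lamU n - S.defect α n
  else min (S.lamU n - S.defect α n) (1 / α * Real.log (S.β (n - 1) / S.β n))

/-- The least `M ≥ 0` such that `∑_{m ≤ k < n} λ_k^e ≥ (n - m) χ - M` for all `0 ≤ m < n`,
namely the maximum over `0 ≤ m ≤ n` of `∑_{m ≤ k < n} (χ - λ_k^e)`. -/
def deficit (α βbar χ : ℝ) (n : ℕ) : ℝ :=
  (Finset.range (n + 1)).sup' Finset.nonempty_range_add_one
    (fun m => ∑ k ∈ Finset.Ico m n, (χ - S.lamE α βbar k))

/-- The box `B_n^u(r_n) × B_n^s(τ_n + γ r_n)` for the parameters `r_n = r e^{-D_n}` and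
`τ_n = τ e^{-D_n}`, where `D_n` is the deficit. -/
def localBox (α βbar χ r τ γ : ℝ) (n : ℕ) : Set (V d) :=
  box (S.Eu n) (S.Es n) (r * Real.exp (-S.deficit α βbar χ n))
    (τ * Real.exp (-S.deficit α βbar χ n) + γ * (r * Real.exp (-S.deficit α βbar χ n)))

/-- Condition (C5): the domains contain the boxes in which the graphs live. -/
def C5 (N : ℕ) (α βbar χ r τ γ : ℝ) : Prop :=
  ∀ n < N, S.localBox α βbar χ r τ γ n ⊆ S.Ω n

/-- The composition `F_{m,n} = f_{n-1} ∘ ⋯ ∘ f_m` (the identity if `n ≤ m`). -/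
def comp (m : ℕ) : ℕ → V d → V d
  | 0 => id
  | n + 1 => if m ≤ n then S.f n ∘ comp m n else id

/-- For a sequence of domains `U_k`, the connected component containing `0` of the set of points
`x` with `F_{m,k}(x) ∈ U_k` for `m ≤ k < n`. -/
def orbitDomain (U : ℕ → Set (V d)) (m n : ℕ) : Set (V d) :=
  connectedComponentIn {x | ∀ k, m ≤ k → k < n → S.comp m k x ∈ U k} 0

/-- `ψn = 𝒢_n ψ0` : the part of `F_{0,n}(graph ψ0)` over the ball `B_n^u(rn)` is the graph of
`ψn : B_n^u(rn) → E_n^s`, where `ψ0` lives on `B_0^u(r0)` and the maps are restricted to the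
domains `U_k`. This determines `ψn` on the ball `B_n^u(rn)`, and makes its graph relatively open in
`F_{0,n}(graph ψ0)`. -/
def IsGraphTransform (U : ℕ → Set (V d)) (n : ℕ) (r0 rn : ℝ)
    (ψ0 : S.Eu 0 → S.Es 0) (ψn : S.Eu n → S.Es n) : Prop :=
  S.comp 0 n '' (graphOn r0 ψ0 ∩ S.orbitDomain U 0 n) ∩ cylinder (S.Eu n) (S.Es n) rn
    = graphOn rn ψn

/-- `M = M_n^u` is nonnegative and bounds the deficit in effective hyperbolicity at time `n`. -/
def UnstableBound (α βbar χ : ℝ) (n : ℕ) (M : ℝ) : Prop :=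
  0 ≤ M ∧ ∀ m < n, ((n : ℝ) - m) * χ - M ≤ ∑ k ∈ Finset.Ico m n, S.lamE α βbar k

/-- `M0s = M_0^s` bounds the deficit in stable contraction, given the `M_n^u`. -/
def StableBound (N : ℕ) (χ : ℝ) (M : ℕ → ℝ) (M0s : ℝ) : Prop :=
  ∀ n ≤ N, ∑ k ∈ Finset.range n, S.lamS k ≤ n * χ - M n + M0s

/-- The initial class `𝒞_0(r, τ e^{-M_0^s}, σ e^{-α M_0^s}, κh)`. -/
def initClass (α r τ σ κh M0s : ℝ) : Set (S.Eu 0 → S.Es 0) :=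
  AdmClass (S.Eu 0) (S.Es 0) α r (τ * Real.exp (-M0s)) (σ * Real.exp (-α * M0s)) κh

/-- The class `𝒞_n(r e^{-M}, τ e^{-M} e^{n χ}, σ e^{α n χ}, κ e^{α M})`. -/
def finalClass (α χ r τ σ κ : ℝ) (n : ℕ) (M : ℝ) : Set (S.Eu n → S.Es n) :=
  AdmClass (S.Eu n) (S.Es n) α (r * Real.exp (-M)) (τ * Real.exp (-M) * Real.exp (n * χ))
    (σ * Real.exp (α * n * χ)) (κ * Real.exp (α * M))

/-- Angle bound and well-definedness of the graph transform. -/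
def WellDefined (U : ℕ → Set (V d)) (N : ℕ) (α χbu χbs r θbar σ τ κ κh : ℝ)
    (M : ℕ → ℝ) (M0s : ℝ) : Prop :=
  (∀ n, 1 ≤ n → n ≤ N → θbar * Real.exp (-α * M n) ≤ S.θ n) ∧
  ∀ n ≤ N, ∀ ψ0 ∈ S.initClass α r τ σ κh M0s, ∃ ψn : S.Eu n → S.Es n,
    S.IsGraphTransform U n r (r * Real.exp (-M n)) ψ0 ψn ∧
    IsC1Holder α (r * Real.exp (-M n)) ψn ∧
    (κh ≤ κ * Real.exp (α * n * χbu) → ψn ∈ S.finalClass α χbs r τ σ κ n (M n))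

/-- Expansion along the images of admissible manifolds. -/
def Expansion (U : ℕ → Set (V d)) (N : ℕ) (α χbu r σ τ κh : ℝ)
    (M : ℕ → ℝ) (M0s : ℝ) : Prop :=
  ∀ ψ0 ∈ S.initClass α r τ σ κh M0s, ∀ m n, m ≤ n → n ≤ N → ∀ ψm : S.Eu m → S.Es m,
    S.IsGraphTransform U m r (r * Real.exp (-M m)) ψ0 ψm →
    ∀ v v' : S.Eu m, ‖v‖ < r * Real.exp (-M m) → ‖v'‖ < r * Real.exp (-M m) →
    ∀ x y : V d, x = (v : V d) + (ψm v : V d) → y = (v' : V d) + (ψm v' : V d) →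
    x ∈ S.orbitDomain U m n → y ∈ S.orbitDomain U m n →
    Real.exp (-M n) * Real.exp (((n : ℝ) - m) * χbu) * ‖x - y‖
        ≤ ‖S.comp m n x - S.comp m n y‖ ∧
    ∀ (a a' : S.Eu n) (b b' : S.Es n), S.comp m n x = (a : V d) + (b : V d) →
      S.comp m n y = (a' : V d) + (b' : V d) →
      Real.exp (-M n) * Real.exp (((n : ℝ) - m) * χbu) * ‖v - v'‖ ≤ ‖a - a'‖

/-- Attraction of nearby trajectories to the images of admissible manifolds. -/
def Attraction (U : ℕ → Set (V d)) (N : ℕ) (α χbs r σ τ κh : ℝ)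
    (M : ℕ → ℝ) (M0s : ℝ) : Prop :=
  ∀ ψ0 ∈ S.initClass α r τ σ κh M0s, ∀ n ≤ N, ∀ ψn : S.Eu n → S.Es n,
    S.IsGraphTransform U n r (r * Real.exp (-M n)) ψ0 ψn →
    ∀ (v0 : S.Eu 0) (w0 : S.Es 0) (vn : S.Eu n) (wn : S.Es n),
    (v0 : V d) + (w0 : V d) ∈ S.orbitDomain U 0 n →
    S.comp 0 n ((v0 : V d) + (w0 : V d)) = (vn : V d) + (wn : V d) →
    ‖vn‖ < r * Real.exp (-M n) →
    ‖wn - ψn vn‖ ≤ Real.exp (M0s - M n + n * χbs) * ‖w0 - ψ0 v0‖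

/-- Dependence of the graph transform on a small ball only, and `C^0`-contraction. -/
def Contraction (U : ℕ → Set (V d)) (N : ℕ) (α χbu χbs r σ τ κh : ℝ)
    (M : ℕ → ℝ) (M0s : ℝ) : Prop :=
  ∀ ψ0 ∈ S.initClass α r τ σ κh M0s, ∀ φ0 ∈ S.initClass α r τ σ κh M0s,
    ∀ n ≤ N, ∀ ψn φn : S.Eu n → S.Es n,
    S.IsGraphTransform U n r (r * Real.exp (-M n)) ψ0 ψn →
    S.IsGraphTransform U n r (r * Real.exp (-M n)) φ0 φn →
    ((∀ v : S.Eu 0, ‖v‖ < r →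
        ‖v‖ < Real.exp (-(n * χbu)) * Real.exp (M n) * r + τ → ψ0 v = φ0 v) →
      ∀ v : S.Eu n, ‖v‖ < r * Real.exp (-M n) → ψn v = φn v) ∧
    ∀ v : S.Eu n, ‖v‖ < r * Real.exp (-M n) →
      ‖ψn v - φn v‖ ≤ Real.exp (n * χbs) * Real.exp M0s *
        (3 * τ * Real.exp (-M n) + 2 * r * Real.exp (-(n * χbu)))

end LocalSystem

end EffHyp

end

/-! In the coordinates of the splitting, with the maximum norm, each map is a perturbation of a
block-diagonal linear map. The projections along the splitting have norm at most `1 / sin θ`, and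
the factor `sin θ` in (C3) cancels this, so the coordinate map has Hölder constant `4 β n`
(`holder_proj`). The maps need not be uniformly close to linear, nor dominated at each step; the
effective rate charges every such defect to the deficit `D`, which satisfies `D n + χ - λ_n^e ≤ D (n
+ 1)`. The second branch of `λ^e` gives `β n ≲ e^{α D}` (`beta_le_deficit_succ`, `beta_le_deficit`).
On a box of radius `r e^{-D n}` the nonlinearity is then of order `r^α`, so the derivatives are
uniformly `ε`-close to their linear parts.

One step of the graph transform is the inverse function theorem with constants. The base map `v ↦ p
(v, ψ v)` expands by `e^{λ^u} - ε` and covers the next ball. The Hölder constant is multiplied by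
roughly `e^{λ^s - (1 + α) λ^u}`, and the defect `Δ` bounds this by `e^{-α λ^e}`, so a bound of the
form `κ e^{α D}` reproduces itself (`kap_step_le`). Heights at the origin are multiplied by `e^{λ^s
+ δ}`. Slopes at the origin decay like the heights to the power `α`, because the preimage of the
origin moves by a small multiple of the height and `κh τ^α ≤ σ`. The slope on a whole ball is
recovered at each time from the slope at the origin and the Hölder constant, through `σ + κh r^α ≤
γ`. This closes the induction (`MapChain.adm_transform`), each step spending a small amount `δ` of
the gaps between the rates.

The domain of an orbit is a connected component containing 0; the relevant points of the initial
graph are joined to 0 inside it by the homotopy `t • ψ` (`HasRates.pull_mem_orbitDomain`). Expansion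
and attraction multiply the one-step estimates. Contraction traces a point of one image graph back
to its initial point and attracts that orbit to the other graph. Property (V) is Pliss' lemma for
the sequence `λ^e`. -/

open scoped Topology

noncomputable section
namespace EffHyp

/-! ### One step of the graph transform -/

section OneStep

open Metric Set ContinuousLinearMap

variable {X Y X' Y' : Type*} [NormedAddCommGroup X] [NormedSpace ℝ X] [NormedAddCommGroup Y]
  [NormedSpace ℝ Y] [NormedAddCommGroup X'] [NormedSpace ℝ X'] [NormedAddCommGroup Y']
  [NormedSpace ℝ Y']

/-- A map `(p, q) : X × Y → X' × Y'` which on the box `B(r) × B(s)` is `C^{1+α}`-close to the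
block-diagonal linear map `(A, B)`, where `A` expands by `a` and `B` is bounded by `μ`. -/
structure NearLinear (r s : ℝ) (p : X × Y → X') (q : X × Y → Y') (A : X →L[ℝ] X')
    (B : Y →L[ℝ] Y') (α a μ b ε : ℝ) : Prop where
  r_pos : 0 < r
  s_pos : 0 < s
  α_pos : 0 < α
  b_nonneg : 0 ≤ b
  ε_nonneg : 0 ≤ ε
  ε_lt : ε < a
  μ_nonneg : 0 ≤ μ
  diff_p : ∀ z ∈ ball (0 : X) r ×ˢ ball (0 : Y) s, DifferentiableAt ℝ p z
  diff_q : ∀ z ∈ ball (0 : X) r ×ˢ ball (0 : Y) s, DifferentiableAt ℝ q z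
  p_zero : p 0 = 0
  q_zero : q 0 = 0
  dp_zero : fderiv ℝ p 0 = A.comp (fst ℝ X Y)
  dq_zero : fderiv ℝ q 0 = B.comp (snd ℝ X Y)
  lower : ∀ v, a * ‖v‖ ≤ ‖A v‖
  upper : ∀ w, ‖B w‖ ≤ μ * ‖w‖
  surj : Function.Surjective A
  holder_p : HolderBound α b (ball (0 : X) r ×ˢ ball (0 : Y) s) (fderiv ℝ p)
  holder_q : HolderBound α b (ball (0 : X) r ×ˢ ball (0 : Y) s) (fderiv ℝ q)
  small : ∀ z ∈ ball (0 : X) r ×ˢ ball (0 : Y) s, b * ‖z‖ ^ α ≤ ε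

/-- A differentiable graph of slope at most `γ` inside the box `B(r) × B(s)`. -/
structure FlatGraph (r s γ : ℝ) (ψ : X → Y) : Prop where
  γ_nonneg : 0 ≤ γ
  γ_le : γ ≤ 1
  diff : DifferentiableOn ℝ ψ (ball 0 r)
  slope : ∀ v ∈ ball (0 : X) r, ‖fderiv ℝ ψ v‖ ≤ γ
  height : ∀ v ∈ ball (0 : X) r, ‖ψ v‖ < s

namespace FlatGraph

variable {r s γ : ℝ} {ψ : X → Y}

lemma mem_box (hψ : FlatGraph r s γ ψ) {v : X} (hv : v ∈ ball (0 : X) r) :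
    (v, ψ v) ∈ ball (0 : X) r ×ˢ ball (0 : Y) s :=
  ⟨hv, by simpa using hψ.height v hv⟩

lemma diffAt (hψ : FlatGraph r s γ ψ) {v : X} (hv : v ∈ ball (0 : X) r) :
    DifferentiableAt ℝ ψ v :=
  (hψ.diff v hv).differentiableAt (isOpen_ball.mem_nhds hv)

lemma norm_sub_le (hψ : FlatGraph r s γ ψ) {v v' : X} (hv : v ∈ ball (0 : X) r)
    (hv' : v' ∈ ball (0 : X) r) : ‖ψ v - ψ v'‖ ≤ γ * ‖v - v'‖ :=
  (convex_ball (0 : X) r).norm_image_sub_le_of_norm_fderiv_le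
    (fun _ hx => hψ.diffAt hx) hψ.slope hv' hv

/-- In the maximum norm a slope at most one costs nothing: lifting the base to the graph is
1-Lipschitz. -/
lemma norm_pair_sub_le (hψ : FlatGraph r s γ ψ) {v v' : X} (hv : v ∈ ball (0 : X) r)
    (hv' : v' ∈ ball (0 : X) r) : ‖((v, ψ v) : X × Y) - (v', ψ v')‖ ≤ ‖v - v'‖ := by
  refine max_le le_rfl ((hψ.norm_sub_le hv hv').trans ?_)
  exact mul_le_of_le_one_left (norm_nonneg _) hψ.γ_le

lemma norm_prod_le (hψ : FlatGraph r s γ ψ) {v : X} (hv : v ∈ ball (0 : X) r) :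
    ‖(ContinuousLinearMap.id ℝ X).prod (fderiv ℝ ψ v)‖ ≤ 1 := by
  rw [ContinuousLinearMap.opNorm_prod]
  exact max_le ContinuousLinearMap.norm_id_le ((hψ.slope v hv).trans hψ.γ_le)

lemma hasFDerivAt_pair (hψ : FlatGraph r s γ ψ) {v : X} (hv : v ∈ ball (0 : X) r) :
    HasFDerivAt (fun v => (v, ψ v)) ((ContinuousLinearMap.id ℝ X).prod (fderiv ℝ ψ v)) v :=
  (hasFDerivAt_id v).prodMk (hψ.diffAt hv).hasFDerivAt

end FlatGraph

/-- A bound for `T` from one for `T ∘ K`, where `K` is onto and expands by `c`. -/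
lemma opNorm_le_of_comp {Z : Type*} [NormedAddCommGroup Z] [NormedSpace ℝ Z]
    {K : X →L[ℝ] X'} {T : X' →L[ℝ] Z} {c m : ℝ} (hc : 0 < c) (hm : 0 ≤ m)
    (hK : ∀ v, c * ‖v‖ ≤ ‖K v‖) (hs : Function.Surjective K) (h : ‖T.comp K‖ ≤ m) :
    ‖T‖ ≤ m / c := by
  refine T.opNorm_le_bound (by positivity) fun u => ?_
  obtain ⟨v, rfl⟩ := hs u
  have h1 : ‖T (K v)‖ ≤ m * ‖v‖ := ((T.comp K).le_opNorm v).trans (by gcongr)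
  have h2 : ‖v‖ ≤ ‖K v‖ / c := by rw [le_div_iff₀ hc]; linarith [hK v]
  calc ‖T (K v)‖ ≤ m * ‖v‖ := h1
    _ ≤ m * (‖K v‖ / c) := by gcongr
    _ = m / c * ‖K v‖ := by ring

namespace NearLinear

variable {r s : ℝ} {p : X × Y → X'} {q : X × Y → Y'} {A : X →L[ℝ] X'}
  {B : Y →L[ℝ] Y'} {α a μ b ε γ : ℝ} {ψ : X → Y}

lemma zero_mem (H : NearLinear r s p q A B α a μ b ε) :
    (0 : X × Y) ∈ ball (0 : X) r ×ˢ ball (0 : Y) s :=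
  ⟨mem_ball_self H.r_pos, mem_ball_self H.s_pos⟩

lemma sub_pos (H : NearLinear r s p q A B α a μ b ε) : 0 < a - ε := by linarith [H.ε_lt]

lemma norm_dp_sub_le' (H : NearLinear r s p q A B α a μ b ε) {z : X × Y}
    (hz : z ∈ ball (0 : X) r ×ˢ ball (0 : Y) s) :
    ‖fderiv ℝ p z - A.comp (fst ℝ X Y)‖ ≤ b * ‖z‖ ^ α := by
  simpa [H.dp_zero] using H.holder_p z hz 0 H.zero_mem

lemma norm_dq_sub_le' (H : NearLinear r s p q A B α a μ b ε) {z : X × Y}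
    (hz : z ∈ ball (0 : X) r ×ˢ ball (0 : Y) s) :
    ‖fderiv ℝ q z - B.comp (snd ℝ X Y)‖ ≤ b * ‖z‖ ^ α := by
  simpa [H.dq_zero] using H.holder_q z hz 0 H.zero_mem

lemma norm_dp_sub_le (H : NearLinear r s p q A B α a μ b ε) {z : X × Y}
    (hz : z ∈ ball (0 : X) r ×ˢ ball (0 : Y) s) :
    ‖fderiv ℝ p z - A.comp (fst ℝ X Y)‖ ≤ ε := (H.norm_dp_sub_le' hz).trans (H.small z hz)

lemma norm_dq_sub_le (H : NearLinear r s p q A B α a μ b ε) {z : X × Y}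
    (hz : z ∈ ball (0 : X) r ×ˢ ball (0 : Y) s) :
    ‖fderiv ℝ q z - B.comp (snd ℝ X Y)‖ ≤ ε := (H.norm_dq_sub_le' hz).trans (H.small z hz)

lemma p_sub_le (H : NearLinear r s p q A B α a μ b ε) {z z' : X × Y}
    (hz : z ∈ ball (0 : X) r ×ˢ ball (0 : Y) s) (hz' : z' ∈ ball (0 : X) r ×ˢ ball (0 : Y) s) :
    ‖p z - p z' - A (z.1 - z'.1)‖ ≤ ε * ‖z - z'‖ := by
  simpa using ((convex_ball (0 : X) r).prod (convex_ball (0 : Y) s)).norm_image_sub_le_of_norm_fderiv_le'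
    H.diff_p (fun z hz => H.norm_dp_sub_le hz) hz' hz

lemma q_sub_le (H : NearLinear r s p q A B α a μ b ε) {z z' : X × Y}
    (hz : z ∈ ball (0 : X) r ×ˢ ball (0 : Y) s) (hz' : z' ∈ ball (0 : X) r ×ˢ ball (0 : Y) s) :
    ‖q z - q z' - B (z.2 - z'.2)‖ ≤ ε * ‖z - z'‖ := by
  simpa using ((convex_ball (0 : X) r).prod (convex_ball (0 : Y) s)).norm_image_sub_le_of_norm_fderiv_le'
    H.diff_q (fun z hz => H.norm_dq_sub_le hz) hz' hz

/-- The base map minus `A` is `ε`-Lipschitz. Its expansion, injectivity and covering property are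
therefore perturbations of those of `A`. -/
lemma base_sub_le (H : NearLinear r s p q A B α a μ b ε) (hψ : FlatGraph r s γ ψ) {v v' : X}
    (hv : v ∈ ball (0 : X) r) (hv' : v' ∈ ball (0 : X) r) :
    ‖p (v, ψ v) - p (v', ψ v') - A (v - v')‖ ≤ ε * ‖v - v'‖ :=
  (H.p_sub_le (hψ.mem_box hv) (hψ.mem_box hv')).trans
    (mul_le_mul_of_nonneg_left (hψ.norm_pair_sub_le hv hv') H.ε_nonneg)

/-- The base map `v ↦ p (v, ψ v)` expands. -/
lemma base_expands (H : NearLinear r s p q A B α a μ b ε) (hψ : FlatGraph r s γ ψ) {v v' : X}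
    (hv : v ∈ ball (0 : X) r) (hv' : v' ∈ ball (0 : X) r) :
    (a - ε) * ‖v - v'‖ ≤ ‖p (v, ψ v) - p (v', ψ v')‖ := by
  have h1 := H.base_sub_le hψ hv hv'
  have h2 := H.lower (v - v')
  have h3 : ‖A (v - v')‖ ≤ ‖p (v, ψ v) - p (v', ψ v')‖ +
      ‖p (v, ψ v) - p (v', ψ v') - A (v - v')‖ := by
    rw [← norm_sub_rev (A (v - v'))]
    simpa using norm_add_le (p (v, ψ v) - p (v', ψ v')) (A (v - v') - (p (v, ψ v) - p (v', ψ v')))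
  linarith

lemma base_injOn (H : NearLinear r s p q A B α a μ b ε) (hψ : FlatGraph r s γ ψ) :
    InjOn (fun v => p (v, ψ v)) (ball (0 : X) r) := by
  intro v hv v' hv' h
  have h1 := H.base_expands hψ hv hv'
  have h2 : p (v, ψ v) = p (v', ψ v') := h
  rw [h2, sub_self, norm_zero] at h1
  have := (mul_nonpos_iff_pos_imp_nonpos.1 h1).1 H.sub_pos
  exact sub_eq_zero.1 (norm_le_zero_iff.1 this)

/-- The fibre map `v ↦ q (v, ψ v)` is Lipschitz. -/
lemma fibre_sub_le (H : NearLinear r s p q A B α a μ b ε) (hψ : FlatGraph r s γ ψ) {v v' : X}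
    (hv : v ∈ ball (0 : X) r) (hv' : v' ∈ ball (0 : X) r) :
    ‖q (v, ψ v) - q (v', ψ v')‖ ≤ (μ * γ + ε) * ‖v - v'‖ := by
  have h1 := (H.q_sub_le (hψ.mem_box hv) (hψ.mem_box hv')).trans
    (mul_le_mul_of_nonneg_left (hψ.norm_pair_sub_le hv hv') H.ε_nonneg)
  have h2 := (H.upper (ψ v - ψ v')).trans
    (mul_le_mul_of_nonneg_left (hψ.norm_sub_le hv hv') H.μ_nonneg)
  have h3 := norm_add_le (q (v, ψ v) - q (v', ψ v') - B (ψ v - ψ v')) (B (ψ v - ψ v'))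
  rw [sub_add_cancel] at h3
  linarith

/-- The points `(0, ψ 0)` and `0` differ only in the direction of `Y`, which the linear part of `p`
does not see. -/
lemma base_zero_le (H : NearLinear r s p q A B α a μ b ε) (hψ : FlatGraph r s γ ψ) :
    ‖p (0, ψ 0)‖ ≤ ε * ‖ψ 0‖ := by
  simpa [H.p_zero, Prod.norm_def] using
    H.p_sub_le (hψ.mem_box (mem_ball_self H.r_pos)) H.zero_mem

/-- A point of the graph is controlled by its image. -/
lemma norm_le_of_base (H : NearLinear r s p q A B α a μ b ε) (hψ : FlatGraph r s γ ψ) {v : X}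
    (hv : v ∈ ball (0 : X) r) :
    ‖v‖ ≤ (‖p (v, ψ v)‖ + ε * ‖ψ 0‖) / (a - ε) := by
  rw [le_div_iff₀ H.sub_pos]
  have h1 := H.base_expands hψ hv (mem_ball_self H.r_pos)
  have h2 := norm_sub_le (p (v, ψ v)) (p (0, ψ 0))
  have h3 := H.base_zero_le hψ
  rw [sub_zero] at h1
  linarith

/-- The base map covers a ball. -/
lemma base_surj [CompleteSpace X] (H : NearLinear r s p q A B α a μ b ε)
    (hψ : FlatGraph r s γ ψ) {u : X'} (hu : ‖u‖ < (a - ε) * r - ε * ‖ψ 0‖) :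
    ∃ v ∈ ball (0 : X) r, p (v, ψ v) = u := by
  have ha : 0 < a := H.ε_nonneg.trans_lt H.ε_lt
  have hc := H.sub_pos
  -- Any set-theoretic section of `A` is a right inverse with constant `a⁻¹`, which suffices for the
  -- quantitative inverse function theorem around `p (0, ψ 0)`.
  let I : A.NonlinearRightInverse :=
    { toFun := Function.surjInv H.surj
      nnnorm := ⟨a⁻¹, by positivity⟩
      bound' := fun y => by
        have := H.lower (Function.surjInv H.surj y)
        rw [Function.surjInv_eq H.surj] at this
        change _ ≤ a⁻¹ * ‖y‖
        rw [inv_mul_eq_div, le_div_iff₀ ha]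
        linarith
      right_inv' := fun y => Function.surjInv_eq H.surj y }
  have hG : ApproximatesLinearOn (fun v => p (v, ψ v)) A (ball (0 : X) r)
      ⟨ε, H.ε_nonneg⟩ := fun v hv v' hv' => H.base_sub_le hψ hv hv'
  have h0 := H.base_zero_le hψ
  have h1 : ‖u - p (0, ψ 0)‖ < (a - ε) * r := by linarith [norm_sub_le u (p (0, ψ 0))]
  have h2 := hG.surjOn_closedBall_of_nonlinearRightInverse I
    (ε := ‖u - p (0, ψ 0)‖ / (a - ε)) (b := 0) (by positivity)
    (closedBall_subset_ball (by rwa [div_lt_iff₀ hc, mul_comm]))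
  have h3 : u ∈ closedBall (p (0, ψ 0)) (((I.nnnorm : ℝ)⁻¹ - ((⟨ε, H.ε_nonneg⟩ : NNReal) : ℝ)) *
      (‖u - p (0, ψ 0)‖ / (a - ε))) := by
    have : ((I.nnnorm : ℝ)⁻¹ - ((⟨ε, H.ε_nonneg⟩ : NNReal) : ℝ)) = a - ε := by
      change (a⁻¹)⁻¹ - ε = a - ε
      rw [inv_inv]
    rw [this, mem_closedBall, dist_eq_norm, mul_div_cancel₀ _ hc.ne']
  obtain ⟨v, hv, hvu⟩ := h2 h3
  exact ⟨v, closedBall_subset_ball (by rwa [div_lt_iff₀ hc, mul_comm]) hv, hvu⟩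

/-- The derivative of the base map. -/
def dBase (p : X × Y → X') (ψ : X → Y) (v : X) : X →L[ℝ] X' :=
  (fderiv ℝ p (v, ψ v)).comp ((ContinuousLinearMap.id ℝ X).prod (fderiv ℝ ψ v))

lemma hasFDerivAt_base (H : NearLinear r s p q A B α a μ b ε) (hψ : FlatGraph r s γ ψ) {v : X}
    (hv : v ∈ ball (0 : X) r) : HasFDerivAt (fun v => p (v, ψ v)) (dBase p ψ v) v :=
  (H.diff_p _ (hψ.mem_box hv)).hasFDerivAt.comp v (hψ.hasFDerivAt_pair hv)

lemma hasFDerivAt_fibre (H : NearLinear r s p q A B α a μ b ε) (hψ : FlatGraph r s γ ψ) {v : X}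
    (hv : v ∈ ball (0 : X) r) : HasFDerivAt (fun v => q (v, ψ v)) (dBase q ψ v) v :=
  (H.diff_q _ (hψ.mem_box hv)).hasFDerivAt.comp v (hψ.hasFDerivAt_pair hv)

lemma dBase_lower (H : NearLinear r s p q A B α a μ b ε) (hψ : FlatGraph r s γ ψ) {v : X}
    (hv : v ∈ ball (0 : X) r) (x : X) : (a - ε) * ‖x‖ ≤ ‖dBase p ψ v x‖ := by
  have h1 : ‖dBase p ψ v - A‖ ≤ ε := by
    have : dBase p ψ v - A = (fderiv ℝ p (v, ψ v) - A.comp (fst ℝ X Y)).comp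
        ((ContinuousLinearMap.id ℝ X).prod (fderiv ℝ ψ v)) := by
      ext x; simp [dBase]
    rw [this]
    calc _ ≤ _ := opNorm_comp_le _ _
      _ ≤ ε * 1 := mul_le_mul (H.norm_dp_sub_le (hψ.mem_box hv)) (hψ.norm_prod_le hv)
          (norm_nonneg _) H.ε_nonneg
      _ = ε := mul_one _
  have h2 := (dBase p ψ v - A).le_of_opNorm_le h1 x
  have h3 := H.lower x
  have h4 := norm_sub_le (dBase p ψ v x) ((dBase p ψ v - A) x)
  simp only [_root_.sub_apply, sub_sub_cancel] at h4 h2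
  linarith

/-- The bound keeps the slope and the distance at the point itself instead of `γ` and `ε`; this
precision is needed at the preimage of the origin. -/
lemma dFibre_le (H : NearLinear r s p q A B α a μ b ε) (hψ : FlatGraph r s γ ψ) {v : X}
    (hv : v ∈ ball (0 : X) r) :
    ‖dBase q ψ v‖ ≤ μ * ‖fderiv ℝ ψ v‖ + b * ‖((v, ψ v) : X × Y)‖ ^ α := by
  have h0 : dBase q ψ v = B.comp (fderiv ℝ ψ v) + (fderiv ℝ q (v, ψ v) -
      B.comp (snd ℝ X Y)).comp ((ContinuousLinearMap.id ℝ X).prod (fderiv ℝ ψ v)) := by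
    ext x; simp [dBase]
  rw [h0]
  refine (norm_add_le _ _).trans (add_le_add ?_ ?_)
  · exact (opNorm_comp_le _ _).trans
      (mul_le_mul_of_nonneg_right (B.opNorm_le_bound H.μ_nonneg H.upper) (norm_nonneg _))
  · have := H.norm_dq_sub_le' (hψ.mem_box hv)
    calc _ ≤ _ := opNorm_comp_le _ _
      _ ≤ (b * ‖((v, ψ v) : X × Y)‖ ^ α) * 1 := mul_le_mul this (hψ.norm_prod_le hv)
          (norm_nonneg _) ((norm_nonneg _).trans this)
      _ = _ := mul_one _

/-- Bijectivity of `A` makes the dimensions equal, so the injective derivative of the base map is an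
isomorphism. -/
lemma dBase_surj [FiniteDimensional ℝ X] (H : NearLinear r s p q A B α a μ b ε)
    (hψ : FlatGraph r s γ ψ) {v : X} (hv : v ∈ ball (0 : X) r) :
    ∃ e : X ≃L[ℝ] X', (e : X →L[ℝ] X') = dBase p ψ v := by
  have ha : 0 < a := H.ε_nonneg.trans_lt H.ε_lt
  have inj : ∀ {K : X →L[ℝ] X'} {c : ℝ}, 0 < c → (∀ x, c * ‖x‖ ≤ ‖K x‖) →
      Function.Injective K := by
    intro K c hc h
    refine (injective_iff_map_eq_zero K).2 fun x hx => ?_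
    have := h x
    rw [hx, norm_zero] at this
    exact norm_le_zero_iff.1 ((mul_nonpos_iff_pos_imp_nonpos.1 this).1 hc)
  let eA := LinearEquiv.ofBijective (A : X →ₗ[ℝ] X') ⟨inj ha H.lower, H.surj⟩
  have : FiniteDimensional ℝ X' := eA.finiteDimensional
  let e := LinearEquiv.ofInjectiveOfFinrankEq (dBase p ψ v : X →ₗ[ℝ] X')
    (inj H.sub_pos (H.dBase_lower hψ hv)) eA.finrank_eq
  exact ⟨e.toContinuousLinearEquiv, by ext x; rfl⟩

variable (p q r ψ) in
/-- The inverse of the base map of a graph over `B(r)`. -/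
def baseInv [Nonempty X] : X' → X := Function.invFunOn (fun v => p (v, ψ v)) (ball (0 : X) r)

variable (p q r ψ) in
/-- The image of the graph of `ψ` over `B(r)` under `(p, q)`, as a graph. -/
def transform : X' → Y' := fun u => q (baseInv r p ψ u, ψ (baseInv r p ψ u))

lemma baseInv_base (H : NearLinear r s p q A B α a μ b ε) (hψ : FlatGraph r s γ ψ) {v : X}
    (hv : v ∈ ball (0 : X) r) : baseInv r p ψ (p (v, ψ v)) = v :=
  (H.base_injOn hψ).leftInvOn_invFunOn hv

lemma transform_base (H : NearLinear r s p q A B α a μ b ε) (hψ : FlatGraph r s γ ψ) {v : X}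
    (hv : v ∈ ball (0 : X) r) : transform r p q ψ (p (v, ψ v)) = q (v, ψ v) := by
  rw [transform, H.baseInv_base hψ hv]

lemma baseInv_spec [CompleteSpace X] (H : NearLinear r s p q A B α a μ b ε)
    (hψ : FlatGraph r s γ ψ) {u : X'} (hu : ‖u‖ < (a - ε) * r - ε * ‖ψ 0‖) :
    baseInv r p ψ u ∈ ball (0 : X) r ∧ p (baseInv r p ψ u, ψ (baseInv r p ψ u)) = u := by
  obtain ⟨v, hv, rfl⟩ := H.base_surj hψ hu
  rw [H.baseInv_base hψ hv]
  exact ⟨hv, rfl⟩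

/-- The transform is the fibre map composed with the inverse of the base map, and the inverse is
continuous because the base map expands. The derivative `T` is characterised by its composition with
the base derivative, so later estimates never handle the inverse derivative. -/
lemma hasFDerivAt_transform [FiniteDimensional ℝ X] (H : NearLinear r s p q A B α a μ b ε)
    (hψ : FlatGraph r s γ ψ) {u : X'} (hu : ‖u‖ < (a - ε) * r - ε * ‖ψ 0‖) :
    ∃ T : X' →L[ℝ] Y', HasFDerivAt (transform r p q ψ) T u ∧
      T.comp (dBase p ψ (baseInv r p ψ u)) = dBase q ψ (baseInv r p ψ u) := by
  have : CompleteSpace X := FiniteDimensional.complete ℝ X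
  obtain ⟨hv, hpv⟩ := H.baseInv_spec hψ hu
  obtain ⟨e, he⟩ := H.dBase_surj hψ hv
  have hnear : ∀ᶠ u' in 𝓝 u, ‖u'‖ < (a - ε) * r - ε * ‖ψ 0‖ :=
    continuous_norm.continuousAt.eventually_lt continuousAt_const hu
  have hcont : ContinuousAt (baseInv r p ψ) u := by
    rw [Metric.continuousAt_iff']
    intro ρ hρ
    have h1 : ∀ᶠ u' in 𝓝 u, ‖u' - u‖ < (a - ε) * ρ := by
      have := Metric.ball_mem_nhds u (mul_pos H.sub_pos hρ)
      filter_upwards [this] with u' h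
      rwa [mem_ball, dist_eq_norm] at h
    filter_upwards [hnear, h1] with u' hu' h
    obtain ⟨hv', hpv'⟩ := H.baseInv_spec hψ hu'
    have h2 := H.base_expands hψ hv' hv
    rw [hpv, hpv'] at h2
    rw [dist_eq_norm]
    exact lt_of_mul_lt_mul_left (h2.trans_lt h) H.sub_pos.le
  have hinv : HasFDerivAt (baseInv r p ψ) (e.symm : X' →L[ℝ] X) u := by
    refine HasFDerivAt.of_local_left_inverse hcont ?_
      (f := fun v => p (v, ψ v)) (hnear.mono fun u' hu' => (H.baseInv_spec hψ hu').2)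
    rw [he]
    exact H.hasFDerivAt_base hψ hv
  refine ⟨_, (H.hasFDerivAt_fibre hψ hv).comp u hinv, ?_⟩
  rw [← he]
  ext x; simp

lemma transform_fderiv_le' [FiniteDimensional ℝ X] (H : NearLinear r s p q A B α a μ b ε)
    (hψ : FlatGraph r s γ ψ) {u : X'} (hu : ‖u‖ < (a - ε) * r - ε * ‖ψ 0‖) :
    ‖fderiv ℝ (transform r p q ψ) u‖ ≤ (μ * ‖fderiv ℝ ψ (baseInv r p ψ u)‖ +
      b * ‖((baseInv r p ψ u, ψ (baseInv r p ψ u)) : X × Y)‖ ^ α) / (a - ε) := by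
  have : CompleteSpace X := FiniteDimensional.complete ℝ X
  obtain ⟨T, hT, hTK⟩ := H.hasFDerivAt_transform hψ hu
  have hv := (H.baseInv_spec hψ hu).1
  obtain ⟨e, he⟩ := H.dBase_surj hψ hv
  have hb := H.dFibre_le hψ hv
  rw [hT.fderiv]
  refine opNorm_le_of_comp H.sub_pos ((norm_nonneg _).trans hb) (H.dBase_lower hψ hv) ?_
    (hTK ▸ hb)
  rw [← he]
  exact e.surjective

lemma transform_fderiv_le [FiniteDimensional ℝ X] (H : NearLinear r s p q A B α a μ b ε)
    (hψ : FlatGraph r s γ ψ) {u : X'} (hu : ‖u‖ < (a - ε) * r - ε * ‖ψ 0‖) :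
    ‖fderiv ℝ (transform r p q ψ) u‖ ≤ (μ * γ + ε) / (a - ε) := by
  have : CompleteSpace X := FiniteDimensional.complete ℝ X
  have hv := (H.baseInv_spec hψ hu).1
  have hc := H.sub_pos
  have hμ := H.μ_nonneg
  refine (H.transform_fderiv_le' hψ hu).trans ?_
  gcongr
  · exact hψ.slope _ hv
  · exact H.small _ (hψ.mem_box hv)

/-- Split the difference into the variation of `Dg`, applied to a lift of norm at most 1, and the
partial derivative `W` of `g` along `Y`, applied to the variation of `Dψ`. The bound `m` on `W` is
`ε` for `g = p` and `μ + ε` for `g = q`. -/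
lemma dBase_sub_le {Z : Type*} [NormedAddCommGroup Z] [NormedSpace ℝ Z] {g : X × Y → Z}
    {m κ : ℝ} {W : Y →L[ℝ] Z} (hα : 0 < α) (hb : 0 ≤ b)
    (hg : HolderBound α b (ball (0 : X) r ×ˢ ball (0 : Y) s) (fderiv ℝ g))
    (hψ : FlatGraph r s γ ψ) (hκ : HolderBound α κ (ball (0 : X) r) (fderiv ℝ ψ))
    {v v' : X} (hv : v ∈ ball (0 : X) r) (hv' : v' ∈ ball (0 : X) r)
    (hW : W = (fderiv ℝ g (v', ψ v')).comp (inr ℝ X Y)) (hm : ‖W‖ ≤ m) :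
    ‖dBase g ψ v - dBase g ψ v'‖ ≤ (b + m * κ) * ‖v - v'‖ ^ α := by
  have h0 : dBase g ψ v - dBase g ψ v' =
      (fderiv ℝ g (v, ψ v) - fderiv ℝ g (v', ψ v')).comp
        ((ContinuousLinearMap.id ℝ X).prod (fderiv ℝ ψ v)) +
      W.comp (fderiv ℝ ψ v - fderiv ℝ ψ v') := by
    rw [hW]
    ext x
    simp only [dBase, _root_.sub_apply, comp_apply, prod_apply, coe_id', id_eq,
      add_apply, inr_apply]
    have : ((0, fderiv ℝ ψ v x - fderiv ℝ ψ v' x) : X × Y) =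
      (x, fderiv ℝ ψ v x) - (x, fderiv ℝ ψ v' x) := by simp
    rw [this, map_sub]
    abel
  rw [h0, add_mul]
  refine (norm_add_le _ _).trans (add_le_add ?_ ?_)
  · calc _ ≤ _ := opNorm_comp_le _ _
      _ ≤ (b * ‖v - v'‖ ^ α) * 1 := by
        refine mul_le_mul ((hg _ (hψ.mem_box hv) _ (hψ.mem_box hv')).trans ?_)
          (hψ.norm_prod_le hv) (norm_nonneg _) (by positivity)
        gcongr
        exact hψ.norm_pair_sub_le hv hv'
      _ = _ := mul_one _
  · calc _ ≤ _ := opNorm_comp_le _ _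
      _ ≤ m * (κ * ‖v - v'‖ ^ α) := mul_le_mul hm (hκ _ hv _ hv') (norm_nonneg _)
        ((norm_nonneg _).trans hm)
      _ = _ := (mul_assoc _ _ _).symm

/-- The Hölder constant of the derivative of the transformed graph. -/
lemma transform_holder [FiniteDimensional ℝ X] (H : NearLinear r s p q A B α a μ b ε)
    (hψ : FlatGraph r s γ ψ) {κ : ℝ} (hκ0 : 0 ≤ κ)
    (hκ : HolderBound α κ (ball (0 : X) r) (fderiv ℝ ψ)) (h1 : (μ * γ + ε) / (a - ε) ≤ 1)
    {ρ : ℝ} (hρ : ρ ≤ (a - ε) * r - ε * ‖ψ 0‖) :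
    HolderBound α (((μ + 2 * ε) * κ + 2 * b) / (a - ε) ^ (1 + α)) (ball (0 : X') ρ)
      (fderiv ℝ (transform r p q ψ)) := by
  have : CompleteSpace X := FiniteDimensional.complete ℝ X
  intro u hu u' hu'
  have hu := (mem_ball_zero_iff.1 hu).trans_le hρ
  have hu' := (mem_ball_zero_iff.1 hu').trans_le hρ
  have hc := H.sub_pos
  obtain ⟨hv, hpv⟩ := H.baseInv_spec hψ hu
  obtain ⟨hv', hpv'⟩ := H.baseInv_spec hψ hu'
  obtain ⟨T, hT, hTK⟩ := H.hasFDerivAt_transform hψ hu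
  obtain ⟨T', hT', hTK'⟩ := H.hasFDerivAt_transform hψ hu'
  have hT1 : ‖T'‖ ≤ 1 := by
    rw [← hT'.fderiv]; exact (H.transform_fderiv_le hψ hu').trans h1
  have hexp := H.base_expands hψ hv hv'
  rw [hpv, hpv'] at hexp
  rw [hT.fderiv, hT'.fderiv]
  set v := baseInv r p ψ u
  set v' := baseInv r p ψ u'
  have hz' := hψ.mem_box hv'
  have hp : ‖dBase p ψ v - dBase p ψ v'‖ ≤ (b + ε * κ) * ‖v - v'‖ ^ α := by
    refine dBase_sub_le H.α_pos H.b_nonneg H.holder_p hψ hκ hv hv' rfl ?_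
    have : (fderiv ℝ p (v', ψ v')).comp (inr ℝ X Y) =
        (fderiv ℝ p (v', ψ v') - A.comp (fst ℝ X Y)).comp (inr ℝ X Y) := by
      ext; simp
    rw [this]
    refine (opNorm_comp_le _ _).trans ?_
    calc _ ≤ ε * 1 := mul_le_mul (H.norm_dp_sub_le hz') (norm_inr_le_one ℝ X Y)
          (norm_nonneg _) H.ε_nonneg
      _ = ε := mul_one _
  have hq : ‖dBase q ψ v - dBase q ψ v'‖ ≤ (b + (μ + ε) * κ) * ‖v - v'‖ ^ α := by
    refine dBase_sub_le H.α_pos H.b_nonneg H.holder_q hψ hκ hv hv' rfl ?_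
    have : (fderiv ℝ q (v', ψ v')).comp (inr ℝ X Y) = B +
        (fderiv ℝ q (v', ψ v') - B.comp (snd ℝ X Y)).comp (inr ℝ X Y) := by
      ext; simp
    rw [this]
    refine (norm_add_le _ _).trans (add_le_add (B.opNorm_le_bound H.μ_nonneg H.upper) ?_)
    refine (opNorm_comp_le _ _).trans ?_
    calc _ ≤ ε * 1 := mul_le_mul (H.norm_dq_sub_le hz') (norm_inr_le_one ℝ X Y)
          (norm_nonneg _) H.ε_nonneg
      _ = ε := mul_one _
  -- Subtract the identities defining `T` and `T'`. As `‖T'‖ ≤ 1`, the coefficients of `κ` add up to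
  -- `(μ + ε) + ε`.
  have hcomp : (T - T').comp (dBase p ψ v) = (dBase q ψ v - dBase q ψ v') -
      T'.comp (dBase p ψ v - dBase p ψ v') := by
    rw [ContinuousLinearMap.sub_comp, hTK, ContinuousLinearMap.comp_sub, hTK']
    abel
  have hm : ‖(T - T').comp (dBase p ψ v)‖ ≤ ((μ + 2 * ε) * κ + 2 * b) * ‖v - v'‖ ^ α := by
    rw [hcomp]
    have : ‖T'.comp (dBase p ψ v - dBase p ψ v')‖ ≤ 1 * ((b + ε * κ) * ‖v - v'‖ ^ α) :=
      (opNorm_comp_le _ _).trans (mul_le_mul hT1 hp (norm_nonneg _) zero_le_one)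
    refine (norm_sub_le _ _).trans ((add_le_add hq this).trans (le_of_eq ?_))
    ring
  obtain ⟨e, he⟩ := H.dBase_surj hψ hv
  have hμ := H.μ_nonneg
  have hε := H.ε_nonneg
  have hb := H.b_nonneg
  have h2 : ‖T - T'‖ ≤ (((μ + 2 * ε) * κ + 2 * b) * ‖v - v'‖ ^ α) / (a - ε) :=
    opNorm_le_of_comp hc (by positivity) (H.dBase_lower hψ hv)
      (by rw [← he]; exact e.surjective) hm
  -- Returning from `v` to `u` yields the extra power `α` of the expansion in the denominator.
  have h3 : ‖v - v'‖ ^ α ≤ ‖u - u'‖ ^ α / (a - ε) ^ α := by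
    rw [← Real.div_rpow (norm_nonneg _) hc.le]
    refine Real.rpow_le_rpow (norm_nonneg _) ?_ H.α_pos.le
    rw [le_div_iff₀ hc]; linarith
  calc ‖T - T'‖ ≤ (((μ + 2 * ε) * κ + 2 * b) * ‖v - v'‖ ^ α) / (a - ε) := h2
    _ ≤ (((μ + 2 * ε) * κ + 2 * b) * (‖u - u'‖ ^ α / (a - ε) ^ α)) / (a - ε) := by gcongr
    _ = _ := by
      rw [Real.rpow_add hc, Real.rpow_one]
      field_simp

/-- Attraction of points of the box to the transformed graph. -/
lemma attract [CompleteSpace X] (H : NearLinear r s p q A B α a μ b ε) (hψ : FlatGraph r s γ ψ)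
    {z : X × Y} (hz : z ∈ ball (0 : X) r ×ˢ ball (0 : Y) s)
    (h1 : (μ * γ + ε) / (a - ε) ≤ 1) (hu : ‖p z‖ < (a - ε) * r - ε * ‖ψ 0‖) :
    ‖q z - transform r p q ψ (p z)‖ ≤ (μ + 2 * ε) * ‖z.2 - ψ z.1‖ := by
  obtain ⟨v, w⟩ := z
  have hv : v ∈ ball (0 : X) r := hz.1
  obtain ⟨hv', hpv'⟩ := H.baseInv_spec hψ hu
  have hn : ‖((v, w) : X × Y) - (v, ψ v)‖ = ‖w - ψ v‖ := by simp [Prod.norm_def]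
  have h2 := H.p_sub_le hz (hψ.mem_box hv)
  have h3 := H.q_sub_le hz (hψ.mem_box hv)
  rw [hn] at h2 h3
  simp only [sub_self, map_zero, sub_zero] at h2
  have h4 := H.fibre_sub_le hψ hv hv'
  have h5 := H.base_expands hψ hv hv'
  rw [hpv'] at h5
  rw [transform]
  set v' := baseInv r p ψ (p (v, w))
  have hc := H.sub_pos
  rw [div_le_one hc] at h1
  -- Slide along the graph from `v` to `v'`, the base point landing at `p z`. The image graph has
  -- slope at most 1, so the vertical error is at most the horizontal one, `‖p (v, w) - p (v, ψ
  -- v)‖`.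
  have h6 : ‖q (v, ψ v) - q (v', ψ v')‖ ≤ ε * ‖w - ψ v‖ := by
    rw [norm_sub_rev] at h2
    exact h4.trans ((mul_le_mul_of_nonneg_right h1 (norm_nonneg _)).trans (h5.trans h2))
  have h7 := H.upper (w - ψ v)
  have h8 : q (v, w) - q (v', ψ v') = (q (v, w) - q (v, ψ v) - B (w - ψ v)) + B (w - ψ v) +
      (q (v, ψ v) - q (v', ψ v')) := by abel
  rw [h8]
  have h9 := norm_add₃_le (a := q (v, w) - q (v, ψ v) - B (w - ψ v)) (b := B (w - ψ v))
    (c := q (v, ψ v) - q (v', ψ v'))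
  simp only at h3 ⊢
  linarith

/-- Joint continuity of the inverse base maps of a continuous family of graphs. -/
lemma continuousOn_baseInv [CompleteSpace X] (H : NearLinear r s p q A B α a μ b ε)
    {Θ : Set ℝ} {Ψ : ℝ → X → Y} (hΨ : ∀ t ∈ Θ, FlatGraph r s γ (Ψ t)) {ρ : ℝ}
    (hρ : ∀ t ∈ Θ, ρ ≤ (a - ε) * r - ε * ‖Ψ t 0‖)
    (hcont : ContinuousOn (fun x : ℝ × X => Ψ x.1 x.2) (Θ ×ˢ ball 0 r)) :
    ContinuousOn (fun x : ℝ × X' => baseInv r p (Ψ x.1) x.2) (Θ ×ˢ ball 0 ρ) := by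
  rintro ⟨t, u⟩ ⟨ht, hu⟩
  have spec : ∀ x ∈ Θ ×ˢ ball (0 : X') ρ, baseInv r p (Ψ x.1) x.2 ∈ ball (0 : X) r ∧
      p (baseInv r p (Ψ x.1) x.2, Ψ x.1 (baseInv r p (Ψ x.1) x.2)) = x.2 := fun x hx =>
    H.baseInv_spec (hΨ _ hx.1) ((mem_ball_zero_iff.1 hx.2).trans_le (hρ _ hx.1))
  obtain ⟨hv, hpv⟩ := spec (t, u) ⟨ht, hu⟩
  simp only at hv hpv
  set v := baseInv r p (Ψ t) u with hvdef
  -- By expansion of the base map with parameter `x.1`, this quantity bounds the distance of the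
  -- preimage of `x.2` from `v`. Only continuity of the graphs in the parameter at the fixed point
  -- `v` is needed.
  have hlim : Filter.Tendsto (fun x : ℝ × X' => (a - ε)⁻¹ * ‖x.2 - p (v, Ψ x.1 v)‖)
      (𝓝[Θ ×ˢ ball 0 ρ] (t, u)) (𝓝 ((a - ε)⁻¹ * ‖u - p (v, Ψ t v)‖)) := by
    have hc1 : ContinuousWithinAt (fun x : ℝ × X' => Ψ x.1 v) (Θ ×ˢ ball 0 ρ) (t, u) := by
      have h1 := hcont (t, v) ⟨ht, hv⟩
      refine ContinuousWithinAt.comp (f := fun x : ℝ × X' => (x.1, v)) (x := (t, u))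
        (g := fun x : ℝ × X => Ψ x.1 x.2) h1 ?_ (fun x hx => ⟨hx.1, hv⟩)
      exact (by fun_prop : Continuous fun x : ℝ × X' => (x.1, v)).continuousWithinAt
    have hc2 : ContinuousWithinAt (fun x : ℝ × X' => p (v, Ψ x.1 v)) (Θ ×ˢ ball 0 ρ) (t, u) :=
      ContinuousAt.comp_continuousWithinAt (g := p) (f := fun x : ℝ × X' => (v, Ψ x.1 v))
        (H.diff_p _ ((hΨ t ht).mem_box hv)).continuousAt
        (continuousWithinAt_const.prodMk hc1)
    exact ((continuous_snd.continuousWithinAt.sub hc2).norm).const_mul _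
  rw [hpv, sub_self, norm_zero, mul_zero] at hlim
  rw [ContinuousWithinAt, tendsto_iff_norm_sub_tendsto_zero]
  refine squeeze_zero' (Filter.Eventually.of_forall fun _ => norm_nonneg _) ?_ hlim
  filter_upwards [self_mem_nhdsWithin] with x hx
  obtain ⟨hv', hpv'⟩ := spec x hx
  have h1 := H.base_expands (hΨ _ hx.1) hv' hv
  rw [hpv'] at h1
  rw [inv_mul_eq_div, le_div_iff₀ H.sub_pos, mul_comm]
  exact h1

lemma continuousOn_transform [CompleteSpace X] (H : NearLinear r s p q A B α a μ b ε)
    {Θ : Set ℝ} {Ψ : ℝ → X → Y} (hΨ : ∀ t ∈ Θ, FlatGraph r s γ (Ψ t)) {ρ : ℝ}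
    (hρ : ∀ t ∈ Θ, ρ ≤ (a - ε) * r - ε * ‖Ψ t 0‖)
    (hcont : ContinuousOn (fun x : ℝ × X => Ψ x.1 x.2) (Θ ×ˢ ball 0 r)) :
    ContinuousOn (fun x : ℝ × X' => transform r p q (Ψ x.1) x.2) (Θ ×ˢ ball 0 ρ) := by
  have hB := H.continuousOn_baseInv hΨ hρ hcont
  have hmem : ∀ x ∈ Θ ×ˢ ball (0 : X') ρ, baseInv r p (Ψ x.1) x.2 ∈ ball (0 : X) r :=
    fun x hx => (H.baseInv_spec (hΨ _ hx.1)
      ((mem_ball_zero_iff.1 hx.2).trans_le (hρ _ hx.1))).1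
  have hq : ContinuousOn q (ball (0 : X) r ×ˢ ball (0 : Y) s) :=
    fun z hz => (H.diff_q z hz).continuousAt.continuousWithinAt
  have h1 : ContinuousOn (fun x : ℝ × X' => Ψ x.1 (baseInv r p (Ψ x.1) x.2))
      (Θ ×ˢ ball 0 ρ) :=
    ContinuousOn.comp (g := fun x : ℝ × X => Ψ x.1 x.2) hcont
      (continuous_fst.continuousOn.prodMk hB) fun x hx => ⟨hx.1, hmem x hx⟩
  exact hq.comp (hB.prodMk h1) fun x hx => (hΨ _ hx.1).mem_box (hmem x hx)

end NearLinear

end OneStep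

end EffHyp
end

/-! ### Scalar estimates: radii, heights, slopes and Hölder constants -/

noncomputable section
namespace EffHyp

/-- Rates along a sequence of maps of length `N`, with deficits `D`, nonlinearity bounds `b`, and
constants subject to the smallness conditions under which the graph transform is controlled. -/
structure Rates where
  (N : ℕ)
  (α L χ χbu δ η C r τ γ σ κ κh M0 : ℝ)
  (lu ls le D b : ℕ → ℝ)
  α_pos : 0 < α
  α_le : α ≤ 1
  L_nonneg : 0 ≤ L
  δ_pos : 0 < δ
  δ_le : δ ≤ 1 / 2
  -- The loss `δ` in the exponent per step is small against every gap of rates, even after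
  -- multiplication by `α`.
  δ_χ : 10 * δ ≤ α * (χ - χbu)
  δ_χbu : 10 * δ ≤ α * χbu
  η_nonneg : 0 ≤ η
  η_le : 100 * η ≤ δ
  η_rpow : (2 * η) ^ α ≤ δ / 10
  γ_pos : 0 < γ
  γ_le : Real.exp (2 * L + 1) * γ ≤ δ / 10
  r_pos : 0 < r
  τ_nonneg : 0 ≤ τ
  τ_le : τ ≤ r
  σ_nonneg : 0 ≤ σ
  κ_pos : 0 < κ
  κ_le : κ ≤ κh
  κτ : κh * τ ^ α ≤ σ
  κr : σ + κh * r ^ α ≤ γ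
  C_nonneg : 0 ≤ C
  -- The conditions on `C` make the nonlinearity at most `ε` on the boxes, negligible for slopes at
  -- the origin, and at most a fraction `1 - e^{-δ}` of the next Hölder constant.
  C_r : 2 * C * r ^ α ≤ η * Real.exp (-L)
  C_κ : 20 * C * Real.exp L ≤ δ * κ
  C_κ' : 2 * Real.exp (2 * L + 2) * C ≤ Real.exp (-(α * χbu)) * (1 - Real.exp (-δ)) * κ
  D_zero : D 0 = 0
  D_nonneg : ∀ n, 0 ≤ D n
  D_succ : ∀ n < N, D n + χ - le n ≤ D (n + 1)
  lu_le : ∀ n < N, lu n ≤ L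
  le_lu : ∀ n < N, -L ≤ lu n
  ls_le : ∀ n < N, ls n ≤ L
  le_ls : ∀ n < N, -L ≤ ls n
  le_le : ∀ n < N, le n ≤ lu n
  dom : ∀ n < N, ls n - lu n ≤ α * (ls n - le n)
  dom' : ∀ n < N, ls n - lu n - α * lu n ≤ -(α * le n)
  b_nonneg : ∀ n < N, 0 ≤ b n
  b_le : ∀ n < N, b n ≤ C * Real.exp (α * D n)
  b_le' : ∀ n < N, b n ≤ C * Real.exp (α * D (n + 1))
  stable : ∀ n ≤ N, ∑ k ∈ Finset.range n, ls k + n * δ - M0 + D n ≤ 0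

namespace Rates

open Real

variable (R : Rates)

/-- The radius of the base of the graphs at time `n`. -/
def rad (n : ℕ) : ℝ := R.r * exp (-R.D n)

/-- The height of the box at time `n`. -/
def height (n : ℕ) : ℝ := R.τ * exp (-R.D n) + R.γ * R.rad n

/-- The exponent governing the decay of heights and slopes at the origin. -/
def decay (n : ℕ) : ℝ := ∑ k ∈ Finset.range n, R.ls k + n * R.δ - R.M0 + R.D n

/-- The bound for the height of the graphs at the origin. -/
def tau (n : ℕ) : ℝ := R.τ * exp (R.decay n - R.D n)

/-- The bound for the slope of the graphs at the origin. -/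
def sig (n : ℕ) : ℝ := R.σ * exp (R.α * R.decay n)

/-- The bound for the Hölder constant, up to the factor `e^{α D_n}`. -/
def kapFactor (n : ℕ) : ℝ := max R.κ (R.κh * exp (-(R.α * n * R.χbu)))

/-- The bound for the Hölder constant of the derivatives of the graphs. -/
def kap (n : ℕ) : ℝ := R.kapFactor n * exp (R.α * R.D n)

/-- The bound for the distance of the maps from their linear parts. -/
def ε : ℝ := R.η * exp (-R.L)

lemma χbu_ge : 10 * R.δ ≤ R.χbu := by
  have := R.δ_χbu; have := R.α_le; have := R.δ_pos; have := R.α_pos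
  have h : 0 < R.χbu := by by_contra h; nlinarith
  nlinarith

lemma χ_ge : R.χbu + 10 * R.δ ≤ R.χ := by
  have := R.δ_χ; have := R.α_le; have := R.δ_pos; have := R.α_pos
  have h : 0 < R.χ - R.χbu := by by_contra h; nlinarith
  nlinarith

lemma one_add_δ_le : 1 + R.δ ≤ exp R.δ := by linarith [add_one_le_exp R.δ]

lemma exp_δ_le : exp R.δ ≤ 2 := by
  have h1 := add_one_le_exp (-R.δ)
  have h2 : exp R.δ * exp (-R.δ) = 1 := by rw [← exp_add]; simp
  nlinarith [R.δ_le, exp_pos R.δ]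

/-- Small relative errors cost at most a factor `e^{-δ}`. -/
lemma exp_neg_δ_le {x : ℝ} (hx : 2 * x ≤ R.δ) : exp (-R.δ) ≤ 1 - x := by
  have h1 := R.one_add_δ_le
  have h2 : exp R.δ * exp (-R.δ) = 1 := by rw [← exp_add]; simp
  have := R.δ_pos; have := R.δ_le
  have h3 : 1 ≤ exp R.δ * (1 - x) := by nlinarith
  have := exp_pos R.δ
  by_contra h
  push Not at h
  nlinarith

lemma ε_nonneg : 0 ≤ R.ε := mul_nonneg R.η_nonneg (exp_pos _).le

/-- All rates are at least `e^{-L}`, so `ε = η e^{-L}` is a small relative error at every time. -/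
lemma ε_le_lu {n : ℕ} (hn : n < R.N) : R.ε ≤ R.η * exp (R.lu n) :=
  mul_le_mul_of_nonneg_left (exp_le_exp.2 (R.le_lu n hn)) R.η_nonneg

lemma ε_le_ls {n : ℕ} (hn : n < R.N) : R.ε ≤ R.η * exp (R.ls n) :=
  mul_le_mul_of_nonneg_left (exp_le_exp.2 (R.le_ls n hn)) R.η_nonneg

lemma exp_sub_δ_le {n : ℕ} (hn : n < R.N) : exp (R.lu n - R.δ) ≤ exp (R.lu n) - 2 * R.ε := by
  have h1 := R.exp_neg_δ_le (x := 2 * R.η) (by linarith [R.η_le, R.δ_pos])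
  have h2 := R.ε_le_lu hn
  rw [sub_eq_add_neg, exp_add]
  nlinarith [exp_pos (R.lu n)]

lemma exp_sub_δ_le' {n : ℕ} (hn : n < R.N) : exp (R.lu n - R.δ) ≤ exp (R.lu n) - R.ε := by
  linarith [R.exp_sub_δ_le hn, R.ε_nonneg]

lemma expand_pos {n : ℕ} (hn : n < R.N) : 0 < exp (R.lu n) - R.ε :=
  (exp_pos _).trans_le (R.exp_sub_δ_le' hn)

lemma contract_le {n : ℕ} (hn : n < R.N) :
    exp (R.ls n) + 4 * R.ε ≤ exp (R.ls n + R.δ) := by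
  have h2 := R.ε_le_ls hn
  have h1 := R.one_add_δ_le
  rw [exp_add]
  nlinarith [exp_pos (R.ls n), R.η_le, R.η_nonneg]

lemma rad_pos (n : ℕ) : 0 < R.rad n := mul_pos R.r_pos (exp_pos _)

lemma γ_le_δ : R.γ ≤ R.δ / 10 := by
  refine le_trans ?_ R.γ_le
  exact le_mul_of_one_le_left R.γ_pos.le (one_le_exp (by linarith [R.L_nonneg]))

lemma γ_le_one : R.γ ≤ 1 := by linarith [R.γ_le_δ, R.δ_le]

lemma tau_nonneg (n : ℕ) : 0 ≤ R.tau n := mul_nonneg R.τ_nonneg (exp_pos _).le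

lemma tau_le {n : ℕ} (hn : n ≤ R.N) : R.tau n ≤ R.τ * exp (-R.D n) := by
  have h : R.decay n ≤ 0 := R.stable n hn
  exact mul_le_mul_of_nonneg_left (exp_le_exp.2 (by linarith)) R.τ_nonneg

lemma tau_le_rad {n : ℕ} (hn : n ≤ R.N) : R.tau n ≤ R.rad n :=
  (R.tau_le hn).trans (mul_le_mul_of_nonneg_right R.τ_le (exp_pos _).le)

lemma height_pos (n : ℕ) : 0 < R.height n :=
  add_pos_of_nonneg_of_pos (mul_nonneg R.τ_nonneg (exp_pos _).le)
    (mul_pos R.γ_pos (R.rad_pos n))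

lemma height_le (n : ℕ) : R.height n ≤ 2 * R.rad n := by
  have h1 : R.τ * exp (-R.D n) ≤ R.rad n := mul_le_mul_of_nonneg_right R.τ_le (exp_pos _).le
  have h2 : R.γ * R.rad n ≤ 1 * R.rad n :=
    mul_le_mul_of_nonneg_right R.γ_le_one (R.rad_pos n).le
  unfold height
  linarith

lemma two_rpow_le : (2 : ℝ) ^ R.α ≤ 2 := by
  simpa using rpow_le_rpow_of_exponent_le (by norm_num : (1 : ℝ) ≤ 2) R.α_le

lemma mul_exp_rpow {x y : ℝ} (hx : 0 ≤ x) : (x * exp y) ^ R.α = x ^ R.α * exp (R.α * y) := by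
  rw [mul_rpow hx (exp_pos _).le, ← exp_mul, mul_comm y]

/-- The boxes shrink like `e^{-D}` precisely to cancel the growth `e^{α D}` of the nonlinearity. -/
lemma b_rad_le {n : ℕ} (hn : n < R.N) {x : ℝ} (hx : 0 ≤ x) (h : x ≤ 2 * R.rad n) :
    R.b n * x ^ R.α ≤ R.ε := by
  have hr := R.rad_pos n
  have hα := R.α_pos
  have hb := R.b_nonneg n hn
  have h1 : x ^ R.α ≤ 2 * (R.r ^ R.α * exp (R.α * -R.D n)) := by
    refine (rpow_le_rpow hx h R.α_pos.le).trans ?_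
    rw [mul_rpow (by norm_num) hr.le, rad, R.mul_exp_rpow R.r_pos.le]
    have := rpow_pos_of_pos R.r_pos R.α
    exact mul_le_mul_of_nonneg_right R.two_rpow_le (by positivity)
  have h2 : exp (R.α * R.D n) * exp (R.α * -R.D n) = 1 := by rw [← exp_add]; simp
  have hC := R.C_nonneg
  calc R.b n * x ^ R.α ≤ (R.C * exp (R.α * R.D n)) * (2 * (R.r ^ R.α * exp (R.α * -R.D n))) :=
        mul_le_mul (R.b_le n hn) h1 (rpow_nonneg hx _) (by positivity)
    _ = 2 * R.C * R.r ^ R.α * (exp (R.α * R.D n) * exp (R.α * -R.D n)) := by ring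
    _ ≤ R.ε := by rw [h2, mul_one]; exact R.C_r

/-- This makes the image graph cover the next ball: radii grow by at most `e^{λ^u - χ}`, and the
base expands by at least `e^{λ^u - δ}` even after losing `ε` to the perturbation and `ε` to the
shift of the centre. -/
lemma rad_succ_le {n : ℕ} (hn : n < R.N) :
    R.rad (n + 1) ≤ (exp (R.lu n) - R.ε) * R.rad n - R.ε * R.tau n := by
  have h1 := R.exp_sub_δ_le hn
  have h2 := R.tau_le_rad hn.le
  have h3 := R.rad_pos n
  have h4 : R.rad (n + 1) ≤ exp (R.lu n - R.δ) * R.rad n := by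
    have : exp (R.lu n - R.δ) * R.rad n = R.r * exp (R.lu n - R.δ - R.D n) := by
      rw [sub_eq_add_neg _ (R.D n), exp_add (R.lu n - R.δ), rad]; ring
    rw [this, rad]
    refine mul_le_mul_of_nonneg_left (exp_le_exp.2 ?_) R.r_pos.le
    linarith [R.D_succ n hn, R.le_le n hn, R.χ_ge, R.χbu_ge, R.δ_pos]
  nlinarith [R.ε_nonneg]

/-- Without domination the cone of slope `γ` need not be invariant. But `γ` is tiny against
`e^{-(2L+1)}`, so a single image still has slope at most `δ / 3`. -/
lemma slope_le {n : ℕ} (hn : n < R.N) :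
    (exp (R.ls n) * R.γ + R.ε) / (exp (R.lu n) - R.ε) ≤ R.δ / 3 := by
  rw [div_le_iff₀ (R.expand_pos hn)]
  have h1 := R.exp_sub_δ_le' hn
  have h2 : exp (-R.L - 1) ≤ exp (R.lu n) - R.ε :=
    le_trans (exp_le_exp.2 (by linarith [R.le_lu n hn, R.δ_le])) h1
  have h3 : exp (R.ls n) * R.γ ≤ R.δ / 10 * exp (-R.L - 1) := by
    have : exp R.L * R.γ = (exp (2 * R.L + 1) * R.γ) * exp (-R.L - 1) := by
      rw [mul_right_comm, ← exp_add]; ring_nf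
    calc exp (R.ls n) * R.γ ≤ exp R.L * R.γ :=
          mul_le_mul_of_nonneg_right (exp_le_exp.2 (R.ls_le n hn)) R.γ_pos.le
      _ ≤ _ := by rw [this]; exact mul_le_mul_of_nonneg_right R.γ_le (exp_pos _).le
  have h4 : R.ε ≤ R.η * 3 * exp (-R.L - 1) := by
    have : exp (-R.L) = exp 1 * exp (-R.L - 1) := by rw [← exp_add]; ring_nf
    rw [ε, this, mul_assoc]
    refine mul_le_mul_of_nonneg_left ?_ R.η_nonneg
    exact mul_le_mul_of_nonneg_right (by linarith [exp_one_lt_d9]) (exp_pos _).le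
  have h5 : R.δ / 3 * exp (-R.L - 1) ≤ R.δ / 3 * (exp (R.lu n) - R.ε) :=
    mul_le_mul_of_nonneg_left h2 (by linarith [R.δ_pos])
  nlinarith [exp_pos (-R.L - 1), R.η_le, R.δ_pos]

lemma slope_le_one {n : ℕ} (hn : n < R.N) :
    (exp (R.ls n) * R.γ + R.ε) / (exp (R.lu n) - R.ε) ≤ 1 :=
  (R.slope_le hn).trans (by linarith [R.δ_le])

lemma decay_succ (n : ℕ) :
    R.decay (n + 1) = R.decay n + R.ls n + R.δ + (R.D (n + 1) - R.D n) := by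
  unfold decay
  rw [Finset.sum_range_succ]
  push_cast
  ring

lemma tau_succ (n : ℕ) : R.tau (n + 1) = exp (R.ls n + R.δ) * R.tau n := by
  unfold tau
  rw [mul_left_comm, ← exp_add, R.decay_succ]
  ring_nf

lemma sig_nonneg (n : ℕ) : 0 ≤ R.sig n := mul_nonneg R.σ_nonneg (exp_pos _).le

/-- The exponent `decay` grows by at least `λ^s - λ^e + χ + δ`. Multiplied by `α`, this exceeds `λ^s
- λ^u + 2δ` by `dom`, as `α χ` is at least `20 δ`. -/
lemma sig_succ {n : ℕ} (hn : n < R.N) :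
    exp (R.ls n - R.lu n + 2 * R.δ) * R.sig n ≤ R.sig (n + 1) := by
  unfold sig
  rw [mul_left_comm, ← exp_add]
  refine mul_le_mul_of_nonneg_left (exp_le_exp.2 ?_) R.σ_nonneg
  rw [R.decay_succ]
  have h1 := R.dom n hn
  have h2 := mul_le_mul_of_nonneg_left (R.D_succ n hn) R.α_pos.le
  have h3 := mul_pos R.α_pos R.δ_pos
  have h4 := R.δ_χ
  have h5 := R.δ_χbu
  have := R.δ_pos
  nlinarith

lemma sig_le {n : ℕ} (hn : n ≤ R.N) : R.sig n ≤ R.σ := by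
  have h : R.decay n ≤ 0 := R.stable n hn
  refine mul_le_of_le_one_right R.σ_nonneg (exp_le_one_iff.2 ?_)
  exact mul_nonpos_of_nonneg_of_nonpos R.α_pos.le h

lemma κh_pos : 0 < R.κh := R.κ_pos.trans_le R.κ_le

lemma kapFactor_pos (n : ℕ) : 0 < R.kapFactor n := lt_max_of_lt_left R.κ_pos

lemma kapFactor_le (n : ℕ) : R.kapFactor n ≤ R.κh := by
  refine max_le R.κ_le (mul_le_of_le_one_right R.κh_pos.le (exp_le_one_iff.2 ?_))
  have h1 : 0 ≤ R.α * R.χbu := by linarith [R.δ_χbu, R.δ_pos]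
  have h2 : 0 ≤ (n : ℝ) * (R.α * R.χbu) := by positivity
  linarith

/-- A large initial constant `κh` is forgotten at the rate `α χbu` until `κ` takes over. -/
lemma kapFactor_succ (n : ℕ) :
    exp (-(R.α * R.χbu)) * R.kapFactor n ≤ R.kapFactor (n + 1) := by
  unfold kapFactor
  rw [mul_max_of_nonneg _ _ (exp_pos _).le]
  refine max_le_max ?_ (le_of_eq ?_)
  · refine mul_le_of_le_one_left R.κ_pos.le (exp_le_one_iff.2 ?_)
    linarith [R.δ_χbu, R.δ_pos]
  · rw [mul_left_comm, ← exp_add]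
    push_cast
    ring_nf

lemma kap_pos (n : ℕ) : 0 < R.kap n := mul_pos (R.kapFactor_pos n) (exp_pos _)

lemma kap_rpow_le {n : ℕ} {x : ℝ} (hx : 0 ≤ x) (h : x ≤ R.rad n) :
    R.kap n * x ^ R.α ≤ R.κh * R.r ^ R.α := by
  have h1 : x ^ R.α ≤ R.r ^ R.α * exp (R.α * -R.D n) := by
    rw [← R.mul_exp_rpow R.r_pos.le]
    exact rpow_le_rpow hx h R.α_pos.le
  have h2 : exp (R.α * R.D n) * exp (R.α * -R.D n) = 1 := by rw [← exp_add]; simp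
  have h3 := rpow_pos_of_pos R.r_pos R.α
  calc R.kap n * x ^ R.α ≤ R.kap n * (R.r ^ R.α * exp (R.α * -R.D n)) :=
        mul_le_mul_of_nonneg_left h1 (R.kap_pos n).le
    _ = R.kapFactor n * R.r ^ R.α * (exp (R.α * R.D n) * exp (R.α * -R.D n)) := by
        unfold kap; ring
    _ = R.kapFactor n * R.r ^ R.α := by rw [h2, mul_one]
    _ ≤ _ := mul_le_mul_of_nonneg_right (R.kapFactor_le n) h3.le

lemma tau_rpow (n : ℕ) :
    R.tau n ^ R.α * exp (R.α * R.D n) = R.τ ^ R.α * exp (R.α * R.decay n) := by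
  rw [tau, R.mul_exp_rpow R.τ_nonneg, mul_assoc, ← exp_add]
  ring_nf

/-- For the preimage of the origin, at distance at most `2 η tau`: `kap n * tau n ^ α` carries the
same exponential as `sig n`, and `κh τ^α ≤ σ` compares the prefactors. -/
lemma kap_base_le {n : ℕ} {x : ℝ} (hx : 0 ≤ x) (h : x ≤ 2 * R.η * R.tau n) :
    R.kap n * x ^ R.α ≤ R.δ / 10 * R.sig n := by
  have hη := R.η_nonneg
  have h1 : x ^ R.α ≤ R.δ / 10 * R.tau n ^ R.α := by
    refine (rpow_le_rpow hx h R.α_pos.le).trans ?_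
    rw [mul_rpow (by positivity) (R.tau_nonneg n)]
    exact mul_le_mul_of_nonneg_right R.η_rpow (rpow_nonneg (R.tau_nonneg n) _)
  have h3 : R.kapFactor n * R.τ ^ R.α ≤ R.σ :=
    (mul_le_mul_of_nonneg_right (R.kapFactor_le n) (rpow_nonneg R.τ_nonneg _)).trans R.κτ
  have hδ := R.δ_pos
  calc R.kap n * x ^ R.α ≤ R.kap n * (R.δ / 10 * R.tau n ^ R.α) :=
        mul_le_mul_of_nonneg_left h1 (R.kap_pos n).le
    _ = R.δ / 10 * (R.kapFactor n * (R.tau n ^ R.α * exp (R.α * R.D n))) := by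
        unfold kap; ring
    _ = R.δ / 10 * ((R.kapFactor n * R.τ ^ R.α) * exp (R.α * R.decay n)) := by
        rw [tau_rpow]; ring
    _ ≤ _ := by unfold sig; gcongr

lemma b_tau_le {n : ℕ} (hn : n < R.N) {x : ℝ} (hx : 0 ≤ x) (h : x ≤ 2 * R.tau n) :
    R.b n * x ^ R.α ≤ R.δ / 10 * (exp (R.ls n) * R.sig n) := by
  have hC := R.C_nonneg
  have hδ := R.δ_pos
  have h1 : x ^ R.α ≤ 2 * R.tau n ^ R.α := by
    refine (rpow_le_rpow hx h R.α_pos.le).trans ?_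
    rw [mul_rpow (by norm_num) (R.tau_nonneg n)]
    exact mul_le_mul_of_nonneg_right R.two_rpow_le (rpow_nonneg (R.tau_nonneg n) _)
  have hτ := rpow_nonneg R.τ_nonneg R.α
  have h2 : 2 * R.C * R.τ ^ R.α ≤ R.δ / 10 * (exp (R.ls n) * R.σ) := by
    have e1 : exp R.L * exp (-R.L) = 1 := by rw [← exp_add]; simp
    have e2 : R.κ * R.τ ^ R.α ≤ R.σ := (mul_le_mul_of_nonneg_right R.κ_le hτ).trans R.κτ
    have e3 : exp (-R.L) ≤ exp (R.ls n) := exp_le_exp.2 (R.le_ls n hn)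
    calc 2 * R.C * R.τ ^ R.α = (20 * R.C * exp R.L) * (R.τ ^ R.α / 10 * exp (-R.L)) := by
          linear_combination (-2 * R.C * R.τ ^ R.α) * e1
      _ ≤ (R.δ * R.κ) * (R.τ ^ R.α / 10 * exp (-R.L)) :=
          mul_le_mul_of_nonneg_right R.C_κ (by positivity)
      _ = R.δ / 10 * (exp (-R.L) * (R.κ * R.τ ^ R.α)) := by ring
      _ ≤ _ := by
          have := R.σ_nonneg
          have := R.κ_pos
          gcongr
  calc R.b n * x ^ R.α ≤ (R.C * exp (R.α * R.D n)) * (2 * R.tau n ^ R.α) :=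
        mul_le_mul (R.b_le n hn) h1 (rpow_nonneg hx _) (by positivity)
    _ = 2 * R.C * (R.tau n ^ R.α * exp (R.α * R.D n)) := by ring
    _ = (2 * R.C * R.τ ^ R.α) * exp (R.α * R.decay n) := by rw [tau_rpow]; ring
    _ ≤ (R.δ / 10 * (exp (R.ls n) * R.σ)) * exp (R.α * R.decay n) := by gcongr
    _ = _ := by unfold sig; ring

lemma sig_step_le {n : ℕ} (hn : n < R.N) {x y m : ℝ} (hx : 0 ≤ x) (hx' : x ≤ 2 * R.η * R.tau n)
    (hy : 0 ≤ y) (hy' : y ≤ 2 * R.tau n) (hm : m ≤ R.sig n + R.kap n * x ^ R.α) :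
    (exp (R.ls n) * m + R.b n * y ^ R.α) / (exp (R.lu n) - R.ε) ≤ R.sig (n + 1) := by
  refine le_trans ?_ (R.sig_succ hn)
  rw [div_le_iff₀ (R.expand_pos hn)]
  have h1 := R.kap_base_le hx hx'
  have h2 := R.b_tau_le hn hy hy'
  have hs := R.sig_nonneg n
  have h3 : exp (R.ls n) * m ≤ exp (R.ls n) * ((1 + R.δ / 10) * R.sig n) :=
    mul_le_mul_of_nonneg_left (by linarith) (exp_pos _).le
  have h4 : exp (R.ls n) * (1 + R.δ) * R.sig n ≤
      exp (R.ls n - R.lu n + 2 * R.δ) * R.sig n * exp (R.lu n - R.δ) := by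
    rw [mul_right_comm _ (R.sig n), ← exp_add,
      show R.ls n - R.lu n + 2 * R.δ + (R.lu n - R.δ) = R.ls n + R.δ by ring, exp_add]
    exact mul_le_mul_of_nonneg_right
      (mul_le_mul_of_nonneg_left R.one_add_δ_le (exp_pos _).le) hs
  have h5 := mul_le_mul_of_nonneg_left (R.exp_sub_δ_le' hn)
    (mul_nonneg (exp_pos (R.ls n - R.lu n + 2 * R.δ)).le hs)
  have h6 : 0 ≤ exp (R.ls n) * R.sig n * R.δ := by
    have := R.δ_pos
    positivity
  nlinarith

/-- By `dom'` and the growth of `D`, the old constant contributes at most a fraction `e^{-δ}` of the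
new bound. The nonlinearity, bounded through `D (n + 1)`, contributes at most the remaining `1 -
e^{-δ}`, since `κ` is large. -/
lemma kap_step_le {n : ℕ} (hn : n < R.N) :
    ((exp (R.ls n) + 2 * R.ε) * R.kap n + 2 * R.b n) / (exp (R.lu n) - R.ε) ^ (1 + R.α) ≤
      R.kap (n + 1) := by
  have hα := R.α_pos
  have hα' := R.α_le
  have hδ := R.δ_pos
  have hL := R.L_nonneg
  have hk := R.kap_pos n
  have hb := R.b_nonneg n hn
  have hC := R.C_nonneg
  have hε := R.ε_nonneg
  have h1 : exp ((R.lu n - R.δ) * (1 + R.α)) ≤ (exp (R.lu n) - R.ε) ^ (1 + R.α) := by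
    rw [exp_mul]
    exact rpow_le_rpow (exp_pos _).le (R.exp_sub_δ_le' hn) (by linarith)
  have h2 : exp (R.ls n) + 2 * R.ε ≤ exp (R.ls n + R.δ) := by linarith [R.contract_le hn]
  calc ((exp (R.ls n) + 2 * R.ε) * R.kap n + 2 * R.b n) / (exp (R.lu n) - R.ε) ^ (1 + R.α)
      ≤ (exp (R.ls n + R.δ) * R.kap n + 2 * (R.C * exp (R.α * R.D (n + 1)))) /
          exp ((R.lu n - R.δ) * (1 + R.α)) := by
        have := R.b_le' n hn
        gcongr
    _ = exp (R.ls n + R.δ - (R.lu n - R.δ) * (1 + R.α)) * R.kap n +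
          2 * R.C * exp (-((R.lu n - R.δ) * (1 + R.α))) * exp (R.α * R.D (n + 1)) := by
        rw [div_eq_mul_inv, ← exp_neg, sub_eq_add_neg (R.ls n + R.δ), exp_add (R.ls n + R.δ)]
        ring
    _ ≤ exp (-R.δ) * R.kapFactor (n + 1) * exp (R.α * R.D (n + 1)) +
          (1 - exp (-R.δ)) * R.kapFactor (n + 1) * exp (R.α * R.D (n + 1)) := by
        refine add_le_add ?_ (mul_le_mul_of_nonneg_right ?_ (exp_pos _).le)
        · have e1 : exp (R.ls n + R.δ - (R.lu n - R.δ) * (1 + R.α)) * R.kap n =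
              exp (R.ls n + R.δ - (R.lu n - R.δ) * (1 + R.α) + R.α * R.D n) *
                R.kapFactor n := by
            rw [kap, exp_add _ (R.α * R.D n)]; ring
          have e2 : exp (-R.δ) * (exp (-(R.α * R.χbu)) * R.kapFactor n) *
              exp (R.α * R.D (n + 1)) =
              exp (-R.δ - R.α * R.χbu + R.α * R.D (n + 1)) * R.kapFactor n := by
            rw [exp_add, sub_eq_add_neg, exp_add]; ring
          calc _ = _ := e1
            _ ≤ exp (-R.δ - R.α * R.χbu + R.α * R.D (n + 1)) * R.kapFactor n := by
              refine mul_le_mul_of_nonneg_right (exp_le_exp.2 ?_) (R.kapFactor_pos n).le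
              have f1 := R.dom' n hn
              have f2 := mul_le_mul_of_nonneg_left (R.D_succ n hn) hα.le
              have f3 := R.δ_χ
              nlinarith
            _ = _ := e2.symm
            _ ≤ _ := mul_le_mul_of_nonneg_right
              (mul_le_mul_of_nonneg_left (R.kapFactor_succ n) (exp_pos _).le) (exp_pos _).le
        · have e1 : exp (-((R.lu n - R.δ) * (1 + R.α))) ≤ exp (2 * R.L + 2) := by
            refine exp_le_exp.2 ?_
            have := R.le_lu n hn
            have := R.lu_le n hn
            have := R.δ_le
            nlinarith
          have e2 : 0 ≤ 1 - exp (-R.δ) := by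
            have : exp (-R.δ) ≤ 1 := exp_le_one_iff.2 (by linarith)
            linarith
          have e3 := R.kapFactor_succ n
          have e4 : R.κ ≤ R.kapFactor n := le_max_left _ _
          calc 2 * R.C * exp (-((R.lu n - R.δ) * (1 + R.α))) ≤ 2 * R.C * exp (2 * R.L + 2) := by
                gcongr
            _ = 2 * exp (2 * R.L + 2) * R.C := by ring
            _ ≤ _ := R.C_κ'
            _ = (1 - exp (-R.δ)) * (exp (-(R.α * R.χbu)) * R.κ) := by ring
            _ ≤ (1 - exp (-R.δ)) * (exp (-(R.α * R.χbu)) * R.kapFactor n) := by gcongr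
            _ ≤ _ := mul_le_mul_of_nonneg_left e3 e2
    _ = R.kap (n + 1) := by unfold kap; ring

lemma base_le {n : ℕ} (hn : n < R.N) {t : ℝ} (ht : t ≤ R.tau n) :
    R.ε * t / (exp (R.lu n) - R.ε) ≤ 2 * R.η * R.tau n := by
  rw [div_le_iff₀ (R.expand_pos hn)]
  have h1 := R.exp_sub_δ_le' hn
  have h2 : exp (R.lu n) ≤ 2 * exp (R.lu n - R.δ) := by
    have : exp (R.lu n) = exp R.δ * exp (R.lu n - R.δ) := by rw [← exp_add]; ring_nf
    rw [this]
    exact mul_le_mul_of_nonneg_right R.exp_δ_le (exp_pos _).le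
  have h3 := R.ε_le_lu hn
  have h4 := R.tau_nonneg n
  have h5 := R.η_nonneg
  calc R.ε * t ≤ R.ε * R.tau n := mul_le_mul_of_nonneg_left ht R.ε_nonneg
    _ ≤ (R.η * exp (R.lu n)) * R.tau n := mul_le_mul_of_nonneg_right h3 h4
    _ ≤ (R.η * (2 * (exp (R.lu n) - R.ε))) * R.tau n := by
        gcongr
        linarith
    _ = _ := by ring

lemma sum_le_ge {m n : ℕ} (hmn : m ≤ n) (hn : n ≤ R.N) :
    ((n : ℝ) - m) * R.χ + R.D m - R.D n ≤ ∑ k ∈ Finset.Ico m n, R.le k := by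
  induction n, hmn using Nat.le_induction with
  | base => simp
  | succ n hmn ih =>
    rw [Finset.sum_Ico_succ_top hmn]
    have h1 := ih (by omega)
    have h2 := R.D_succ n (by omega)
    push_cast
    linarith

lemma sum_expand_ge {m n : ℕ} (hmn : m ≤ n) (hn : n ≤ R.N) :
    ((n : ℝ) - m) * (R.χ - R.δ) - R.D n ≤ ∑ k ∈ Finset.Ico m n, (R.lu k - R.δ) := by
  have h1 := R.sum_le_ge hmn hn
  have h2 : ∑ k ∈ Finset.Ico m n, (R.le k - R.δ) ≤ ∑ k ∈ Finset.Ico m n, (R.lu k - R.δ) := by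
    refine Finset.sum_le_sum fun k hk => ?_
    linarith [R.le_le k ((Finset.mem_Ico.1 hk).2.trans_le hn)]
  have h3 : ∑ k ∈ Finset.Ico m n, (R.le k - R.δ) =
      ∑ k ∈ Finset.Ico m n, R.le k - ((n : ℝ) - m) * R.δ := by
    rw [Finset.sum_sub_distrib, Finset.sum_const, Nat.card_Ico, nsmul_eq_mul, Nat.cast_sub hmn]
  linarith [R.D_nonneg m]

end Rates
end EffHyp
end

/-! ### Iterated graph transforms and their orbits -/

noncomputable section
namespace EffHyp

open Metric Set NearLinear

/-- A sequence of nearly linear maps `(p_n, q_n) : X_n × Y_n → X_{n+1} × Y_{n+1}` with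
prescribed rates. -/
structure MapChain (R : Rates) (X Y : ℕ → Type) [∀ n, NormedAddCommGroup (X n)]
    [∀ n, NormedSpace ℝ (X n)] [∀ n, FiniteDimensional ℝ (X n)] [∀ n, NormedAddCommGroup (Y n)]
    [∀ n, NormedSpace ℝ (Y n)] where
  /-- the components of the maps in `X` -/
  p : ∀ n, X n × Y n → X (n + 1)
  /-- the components of the maps in `Y` -/
  q : ∀ n, X n × Y n → Y (n + 1)
  /-- the linear parts in `X` -/
  A : ∀ n, X n →L[ℝ] X (n + 1)
  /-- the linear parts in `Y` -/
  B : ∀ n, Y n →L[ℝ] Y (n + 1)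
  near : ∀ n < R.N, NearLinear (R.rad n) (R.height n) (p n) (q n) (A n) (B n) R.α
    (Real.exp (R.lu n)) (Real.exp (R.ls n)) (R.b n) R.ε

namespace Rates

variable (R : Rates) {X Y : Type*} [NormedAddCommGroup X] [NormedSpace ℝ X]
  [NormedAddCommGroup Y] [NormedSpace ℝ Y]

/-- The functions over `B(r_n)` which satisfy the bounds at time `n`. -/
structure Adm (n : ℕ) (ψ : X → Y) : Prop where
  diff : DifferentiableOn ℝ ψ (ball 0 (R.rad n))
  zero : ‖ψ 0‖ ≤ R.tau n
  dzero : ‖fderiv ℝ ψ 0‖ ≤ R.sig n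
  holder : HolderBound R.α (R.kap n) (ball 0 (R.rad n)) (fderiv ℝ ψ)

variable {R} {n : ℕ} {ψ : X → Y}

lemma Adm.fderiv_le (h : R.Adm n ψ) {v : X} (hv : v ∈ ball (0 : X) (R.rad n)) :
    ‖fderiv ℝ ψ v‖ ≤ R.sig n + R.kap n * ‖v‖ ^ R.α := by
  have h1 := h.holder v hv 0 (mem_ball_self (R.rad_pos n))
  rw [sub_zero] at h1
  have h2 := norm_sub_le (fderiv ℝ ψ v - fderiv ℝ ψ 0) (-fderiv ℝ ψ 0)
  rw [norm_neg, sub_neg_eq_add, sub_add_cancel] at h2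
  linarith [h.dzero]

/-- The factor `e^{α D}` in the Hölder constant cancels against the radius, so the slope is at most
`σ + κh r^α ≤ γ` at every time. -/
lemma Adm.flat (h : R.Adm n ψ) (hn : n ≤ R.N) :
    FlatGraph (R.rad n) (R.height n) R.γ ψ := by
  have hslope : ∀ v ∈ ball (0 : X) (R.rad n), ‖fderiv ℝ ψ v‖ ≤ R.γ := fun v hv =>
    calc _ ≤ _ := h.fderiv_le hv
      _ ≤ R.σ + R.κh * R.r ^ R.α := add_le_add (R.sig_le hn)
        (R.kap_rpow_le (norm_nonneg _) (mem_ball_zero_iff.1 hv).le)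
      _ ≤ R.γ := R.κr
  refine ⟨R.γ_pos.le, R.γ_le_one, h.diff, hslope, fun v hv => ?_⟩
  have h1 := (convex_ball (0 : X) (R.rad n)).norm_image_sub_le_of_norm_fderiv_le
    (fun _ hx => (h.diff _ hx).differentiableAt (isOpen_ball.mem_nhds hx)) hslope
    (mem_ball_self (R.rad_pos n)) hv
  have h2 := norm_add_le (ψ v - ψ 0) (ψ 0)
  rw [sub_add_cancel] at h2
  rw [sub_zero] at h1
  have h3 : R.γ * ‖v‖ < R.γ * R.rad n :=
    mul_lt_mul_of_pos_left (mem_ball_zero_iff.1 hv) R.γ_pos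
  have h4 := h.zero.trans (R.tau_le hn)
  unfold Rates.height
  linarith

/-- Needed for the homotopy from `ψ` to the zero graph. -/
lemma Adm.smul (h : R.Adm n ψ) {t : ℝ} (ht : t ∈ Icc (0 : ℝ) 1) : R.Adm n (t • ψ) := by
  have e : ∀ v, fderiv ℝ (t • ψ) v = t • fderiv ℝ ψ v := fun v => by
    rw [fderiv_const_smul_field]; rfl
  have ht' : ‖t‖ ≤ 1 := by rw [Real.norm_eq_abs, abs_of_nonneg ht.1]; exact ht.2
  have le : ∀ x : Y, ‖t • x‖ ≤ ‖x‖ :=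
    fun x => by rw [norm_smul]; exact mul_le_of_le_one_left (norm_nonneg _) ht'
  have le' : ∀ x : X →L[ℝ] Y, ‖t • x‖ ≤ ‖x‖ :=
    fun x => by rw [norm_smul]; exact mul_le_of_le_one_left (norm_nonneg _) ht'
  refine ⟨h.diff.const_smul t, (le _).trans h.zero, ?_, fun x hx y hy => ?_⟩
  · rw [e]; exact (le' _).trans h.dzero
  · rw [e, e, ← smul_sub]; exact (le' _).trans (h.holder x hx y hy)

end Rates

namespace MapChain

variable {R : Rates} {X Y : ℕ → Type} [∀ n, NormedAddCommGroup (X n)]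
  [∀ n, NormedSpace ℝ (X n)] [∀ n, FiniteDimensional ℝ (X n)] [∀ n, NormedAddCommGroup (Y n)]
  [∀ n, NormedSpace ℝ (Y n)] (M : MapChain R X Y)

/-- The iterated graph transform. -/
def gt (ψ : X 0 → Y 0) : ∀ n, X n → Y n
  | 0 => ψ
  | n + 1 => transform (R.rad n) (M.p n) (M.q n) (gt ψ n)

/-- The preimage in `B(r_0)` of a point under the iterated base maps. -/
def pull (ψ : X 0 → Y 0) : ∀ n, X n → X 0
  | 0 => id
  | n + 1 => fun u => pull ψ n (baseInv (R.rad n) (M.p n) (M.gt ψ n) u)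

variable {M}

/-- The induction step. The value and slope over the new origin come from a base point within `2 η
tau` of the old one, so they are governed by the data at the old origin up to small relative errors.
-/
lemma adm_transform {n : ℕ} (hn : n < R.N) {ψ : X n → Y n} (h : R.Adm n ψ) :
    R.Adm (n + 1) (transform (R.rad n) (M.p n) (M.q n) ψ) := by
  have H := M.near n hn
  have hψ := h.flat hn.le
  have : CompleteSpace (X n) := FiniteDimensional.complete ℝ _
  have hrad : R.rad (n + 1) ≤ (Real.exp (R.lu n) - R.ε) * R.rad n - R.ε * ‖ψ 0‖ :=
    (R.rad_succ_le hn).trans (by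
      have := mul_le_mul_of_nonneg_left h.zero R.ε_nonneg
      linarith)
  have h0 : ‖(0 : X (n + 1))‖ < (Real.exp (R.lu n) - R.ε) * R.rad n - R.ε * ‖ψ 0‖ := by
    rw [norm_zero]; exact (R.rad_pos _).trans_le hrad
  obtain ⟨hv, hpv⟩ := H.baseInv_spec hψ h0
  have hv2 := H.norm_le_of_base hψ hv
  have hd := H.transform_fderiv_le' hψ h0
  have hz0 : transform (R.rad n) (M.p n) (M.q n) ψ 0 =
    M.q n (baseInv (R.rad n) (M.p n) ψ 0, ψ (baseInv (R.rad n) (M.p n) ψ 0)) := rfl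
  rw [hpv, norm_zero, zero_add] at hv2
  set v := baseInv (R.rad n) (M.p n) ψ 0
  have hv3 : ‖v‖ ≤ 2 * R.η * R.tau n := hv2.trans (R.base_le hn h.zero)
  have htau := R.tau_nonneg n
  have hη : 2 * R.η ≤ 1 := by linarith [R.η_le, R.δ_le]
  have hv4 : ‖v‖ ≤ R.tau n := hv3.trans (mul_le_of_le_one_left htau hη)
  have hψv : ‖ψ v‖ ≤ (1 + 2 * R.η) * R.tau n := by
    have h1 := hψ.norm_sub_le hv (mem_ball_self (R.rad_pos n))
    have h2 := norm_add_le (ψ v - ψ 0) (ψ 0)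
    rw [sub_add_cancel] at h2
    rw [sub_zero] at h1
    have h3 : R.γ * ‖v‖ ≤ 1 * ‖v‖ := mul_le_mul_of_nonneg_right R.γ_le_one (norm_nonneg _)
    linarith [h.zero]
  have hz : ‖((v, ψ v) : X n × Y n)‖ ≤ 2 * R.tau n :=
    max_le (by linarith) (hψv.trans (by nlinarith))
  refine ⟨fun u hu => ?_, ?_, ?_, ?_⟩
  · obtain ⟨T, hT, -⟩ := H.hasFDerivAt_transform hψ ((mem_ball_zero_iff.1 hu).trans_le hrad)
    exact hT.differentiableAt.differentiableWithinAt
  · rw [hz0, R.tau_succ]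
    have h1 := H.q_sub_le (hψ.mem_box hv) H.zero_mem
    simp only [H.q_zero, sub_zero, Prod.snd_zero] at h1
    have h2 := norm_add_le (M.q n (v, ψ v) - M.B n (ψ v)) (M.B n (ψ v))
    rw [sub_add_cancel] at h2
    have h3 := H.upper (ψ v)
    have h4 := mul_le_mul_of_nonneg_left hψv (Real.exp_pos (R.ls n)).le
    have h5 := mul_le_mul_of_nonneg_left hz R.ε_nonneg
    have h6 := R.ε_le_ls hn
    have h7 : Real.exp (R.ls n) * (1 + 4 * R.η) ≤ Real.exp (R.ls n + R.δ) := by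
      rw [Real.exp_add]
      refine mul_le_mul_of_nonneg_left ?_ (Real.exp_pos _).le
      linarith [R.one_add_δ_le, R.η_le, R.η_nonneg, R.δ_pos]
    have h8 := mul_le_mul_of_nonneg_right h7 htau
    have h9 := mul_le_mul_of_nonneg_right h6 htau
    linarith
  · exact hd.trans (R.sig_step_le hn (norm_nonneg _) hv3 (norm_nonneg _) hz (h.fderiv_le hv))
  · intro u hu u' hu'
    refine (H.transform_holder hψ (R.kap_pos n).le h.holder (R.slope_le_one hn) hrad u hu u'
      hu').trans ?_
    exact mul_le_mul_of_nonneg_right (R.kap_step_le hn) (Real.rpow_nonneg (norm_nonneg _) _)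

lemma adm_gt {ψ : X 0 → Y 0} (h : R.Adm 0 ψ) : ∀ {n}, n ≤ R.N → R.Adm n (M.gt ψ n)
  | 0, _ => h
  | _ + 1, hn => adm_transform hn (adm_gt h (Nat.le_of_succ_le hn))

lemma flat_gt {ψ : X 0 → Y 0} (h : R.Adm 0 ψ) {n : ℕ} (hn : n ≤ R.N) :
    FlatGraph (R.rad n) (R.height n) R.γ (M.gt ψ n) := (adm_gt h hn).flat hn

lemma rad_succ_le {ψ : X 0 → Y 0} (h : R.Adm 0 ψ) {n : ℕ} (hn : n < R.N) :
    R.rad (n + 1) ≤ (Real.exp (R.lu n) - R.ε) * R.rad n - R.ε * ‖M.gt ψ n 0‖ :=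
  (R.rad_succ_le hn).trans (by
    have := mul_le_mul_of_nonneg_left (adm_gt (M := M) h hn.le).zero R.ε_nonneg
    linarith)

lemma baseInv_spec {ψ : X 0 → Y 0} (h : R.Adm 0 ψ) {n : ℕ} (hn : n < R.N) {u : X (n + 1)}
    (hu : ‖u‖ < R.rad (n + 1)) :
    ‖baseInv (R.rad n) (M.p n) (M.gt ψ n) u‖ < R.rad n ∧
      M.p n (baseInv (R.rad n) (M.p n) (M.gt ψ n) u,
        M.gt ψ n (baseInv (R.rad n) (M.p n) (M.gt ψ n) u)) = u := by
  have : CompleteSpace (X n) := FiniteDimensional.complete ℝ _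
  have := (M.near n hn).baseInv_spec (flat_gt (M := M) h hn.le)
    (hu.trans_le (rad_succ_le h hn))
  rwa [mem_ball_zero_iff] at this

/-- `z_k`, `m ≤ k ≤ n`, is an orbit segment. -/
def IsOrbit (M : MapChain R X Y) (m n : ℕ) (z : ∀ k, X k × Y k) : Prop :=
  ∀ k, m ≤ k → k < n → z (k + 1) = (M.p k (z k), M.q k (z k))

lemma IsOrbit.mono {z : ∀ k, X k × Y k} {m n n' : ℕ} (h : M.IsOrbit m n z) (hn : n' ≤ n) :
    M.IsOrbit m n' z := fun k hk hk' => h k hk (hk'.trans_le hn)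

lemma IsOrbit.graph {ψ : X 0 → Y 0} (h : R.Adm 0 ψ) {z : ∀ k, X k × Y k} {m n : ℕ}
    (hmn : m ≤ n) (hn : n ≤ R.N) (hz : M.IsOrbit m n z)
    (hr : ∀ k, m ≤ k → k < n → ‖(z k).1‖ < R.rad k)
    (h0 : (z m).2 = M.gt ψ m (z m).1) : (z n).2 = M.gt ψ n (z n).1 := by
  induction n, hmn using Nat.le_induction with
  | base => exact h0
  | succ n hmn ih =>
    have h1 := ih (by omega) (hz.mono n.le_succ) fun k hk hk' => hr k hk (by omega)
    have h2 := hr n hmn n.lt_succ_self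
    have h3 := (M.near n (by omega)).transform_base (flat_gt (M := M) h (by omega))
      (mem_ball_zero_iff.2 h2)
    rw [hz n hmn n.lt_succ_self]
    rw [← h1] at h3
    exact h3.symm

/-- Expansion of the base components along orbits in the graphs. -/
lemma IsOrbit.expands {ψ : X 0 → Y 0} (h : R.Adm 0 ψ) {x y : ∀ k, X k × Y k} {m n : ℕ}
    (hmn : m ≤ n) (hn : n ≤ R.N) (hx : M.IsOrbit m n x) (hy : M.IsOrbit m n y)
    (hxr : ∀ k, m ≤ k → k < n → ‖(x k).1‖ < R.rad k)
    (hyr : ∀ k, m ≤ k → k < n → ‖(y k).1‖ < R.rad k)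
    (hx0 : (x m).2 = M.gt ψ m (x m).1) (hy0 : (y m).2 = M.gt ψ m (y m).1) :
    Real.exp (∑ k ∈ Finset.Ico m n, (R.lu k - R.δ)) * ‖(x m).1 - (y m).1‖ ≤
      ‖(x n).1 - (y n).1‖ := by
  induction n, hmn using Nat.le_induction with
  | base => simp
  | succ n hmn ih =>
    have hx' : ∀ k, m ≤ k → k < n → ‖(x k).1‖ < R.rad k := fun k hk hk' => hxr k hk (by omega)
    have hy' : ∀ k, m ≤ k → k < n → ‖(y k).1‖ < R.rad k := fun k hk hk' => hyr k hk (by omega)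
    have h1 := ih (by omega) (hx.mono n.le_succ) (hy.mono n.le_succ) hx' hy'
    have gx := (hx.mono n.le_succ).graph h hmn (by omega) hx' hx0
    have gy := (hy.mono n.le_succ).graph h hmn (by omega) hy' hy0
    have h2 := (M.near n (by omega)).base_expands (flat_gt (M := M) h (by omega))
      (mem_ball_zero_iff.2 (hxr n hmn n.lt_succ_self))
      (mem_ball_zero_iff.2 (hyr n hmn n.lt_succ_self))
    rw [← gx, ← gy] at h2
    rw [hx n hmn n.lt_succ_self, hy n hmn n.lt_succ_self, Finset.sum_Ico_succ_top hmn,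
      Real.exp_add]
    refine le_trans ?_ h2
    calc _ = Real.exp (R.lu n - R.δ) *
          (Real.exp (∑ k ∈ Finset.Ico m n, (R.lu k - R.δ)) * ‖(x m).1 - (y m).1‖) := by ring
      _ ≤ (Real.exp (R.lu n) - R.ε) * ‖(x n).1 - (y n).1‖ :=
        mul_le_mul (R.exp_sub_δ_le' (by omega)) h1 (by positivity)
          (R.expand_pos (by omega)).le

/-- The images of orbits in the graphs lie in a narrow cone. -/
lemma IsOrbit.cone {ψ : X 0 → Y 0} (h : R.Adm 0 ψ) {x y : ∀ k, X k × Y k} {m n : ℕ}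
    (hmn : m < n) (hn : n ≤ R.N) (hx : M.IsOrbit m n x) (hy : M.IsOrbit m n y)
    (hxr : ∀ k, m ≤ k → k < n → ‖(x k).1‖ < R.rad k)
    (hyr : ∀ k, m ≤ k → k < n → ‖(y k).1‖ < R.rad k)
    (hx0 : (x m).2 = M.gt ψ m (x m).1) (hy0 : (y m).2 = M.gt ψ m (y m).1) :
    ‖(x n).2 - (y n).2‖ ≤ R.δ / 3 * ‖(x n).1 - (y n).1‖ := by
  obtain ⟨n, rfl⟩ : ∃ k, n = k + 1 := ⟨n - 1, by omega⟩
  have hmn' : m ≤ n := by omega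
  have gx := (hx.mono n.le_succ).graph h hmn' (by omega)
    (fun k hk hk' => hxr k hk (by omega)) hx0
  have gy := (hy.mono n.le_succ).graph h hmn' (by omega)
    (fun k hk hk' => hyr k hk (by omega)) hy0
  have hxb := mem_ball_zero_iff.2 (hxr n hmn' n.lt_succ_self)
  have hyb := mem_ball_zero_iff.2 (hyr n hmn' n.lt_succ_self)
  have H := M.near n (by omega)
  have hf := flat_gt (M := M) h (n := n) (by omega)
  have h2 := H.base_expands hf hxb hyb
  have h3 := H.fibre_sub_le hf hxb hyb
  rw [← gx, ← gy] at h2 h3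
  rw [hx n hmn' n.lt_succ_self, hy n hmn' n.lt_succ_self]
  -- The cone comes from the last step alone, whence the hypothesis `m < n`.
  have h4 := R.slope_le (n := n) (by omega)
  rw [div_le_iff₀ (R.expand_pos (by omega))] at h4
  have h5 := mul_le_mul_of_nonneg_right h4 (norm_nonneg ((x n).1 - (y n).1))
  have h6 := mul_le_mul_of_nonneg_left h2 (by linarith [R.δ_pos] : 0 ≤ R.δ / 3)
  simp only
  calc _ ≤ _ := h3
    _ ≤ _ := h5
    _ = _ := mul_assoc _ _ _
    _ ≤ _ := h6

/-- Attraction of orbits to the graphs. -/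
lemma IsOrbit.attract {ψ : X 0 → Y 0} (h : R.Adm 0 ψ) {z : ∀ k, X k × Y k} {n : ℕ}
    (hn : n ≤ R.N) (hz : M.IsOrbit 0 n z)
    (hr : ∀ k < n, z k ∈ ball (0 : X k) (R.rad k) ×ˢ ball (0 : Y k) (R.height k))
    (hzn : ‖(z n).1‖ < R.rad n) :
    ‖(z n).2 - M.gt ψ n (z n).1‖ ≤
      Real.exp (∑ k ∈ Finset.range n, R.ls k + n * R.δ) * ‖(z 0).2 - ψ (z 0).1‖ := by
  induction n with
  | zero => simp [gt]
  | succ n ih =>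
    have : CompleteSpace (X n) := FiniteDimensional.complete ℝ _
    have h1 := ih (by omega) (hz.mono n.le_succ) (fun k hk => hr k (by omega))
      (mem_ball_zero_iff.1 (hr n n.lt_succ_self).1)
    have e := hz n n.zero_le n.lt_succ_self
    have h2 := (M.near n (by omega)).attract (flat_gt (M := M) h (by omega))
      (hr n n.lt_succ_self) (R.slope_le_one (by omega))
      (by rw [e] at hzn; exact hzn.trans_le (rad_succ_le h (by omega)))
    rw [e, Finset.sum_range_succ]
    refine h2.trans ?_
    have h3 := R.contract_le (n := n) (by omega)
    have e2 : Real.exp (∑ k ∈ Finset.range n, R.ls k + R.ls n + (n + 1 : ℕ) * R.δ) =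
        Real.exp (R.ls n + R.δ) * Real.exp (∑ k ∈ Finset.range n, R.ls k + n * R.δ) := by
      rw [← Real.exp_add]; push_cast; ring_nf
    rw [e2, mul_assoc]
    refine mul_le_mul (by linarith [R.ε_nonneg]) h1 (norm_nonneg _) (Real.exp_pos _).le

/-- The initial base point of an orbit in the graphs is controlled by its final base point. -/
lemma IsOrbit.initial_le {ψ : X 0 → Y 0} (h : R.Adm 0 ψ) {z : ∀ k, X k × Y k} {n : ℕ}
    (hn : n ≤ R.N) (hz : M.IsOrbit 0 n z) (hr : ∀ k < n, ‖(z k).1‖ < R.rad k)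
    (h0 : (z 0).2 = ψ (z 0).1) :
    ‖(z 0).1‖ ≤ Real.exp (-∑ k ∈ Finset.Ico 0 n, (R.lu k - R.δ)) * ‖(z n).1‖ +
      R.τ * (1 - Real.exp (-(n * R.δ))) := by
  induction n with
  | zero => simp
  | succ n ih =>
    have hN : n < R.N := by omega
    have h1 := ih (by omega) (hz.mono n.le_succ) (fun k hk => hr k (by omega))
    have g := (hz.mono n.le_succ).graph (M := M) h n.zero_le (by omega)
      (fun k _ hk' => hr k (by omega)) h0
    have H := M.near n hN
    have h2 := H.norm_le_of_base (flat_gt (M := M) h hN.le)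
      (mem_ball_zero_iff.2 (hr n n.lt_succ_self))
    rw [← g] at h2
    have h3 := R.base_le hN (adm_gt (M := M) h hN.le).zero
    have h4 : ‖(z n).1‖ ≤ Real.exp (-(R.lu n - R.δ)) * ‖(z (n + 1)).1‖ + 2 * R.η * R.tau n := by
      rw [hz n n.zero_le n.lt_succ_self]
      refine h2.trans ?_
      rw [add_div]
      refine add_le_add ?_ h3
      rw [Real.exp_neg, div_eq_inv_mul]
      exact mul_le_mul_of_nonneg_right
        (inv_anti₀ (Real.exp_pos _) (R.exp_sub_δ_le' hN)) (norm_nonneg _)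
    -- The shift of the centre at time `n`, pulled back to time 0, is at most a multiple `η e^{-n
    -- δ}` of `τ`, since `e^{D n} tau n ≤ τ`. Bounding it by a difference makes the sum telescope.
    have h5 : Real.exp (-∑ k ∈ Finset.Ico 0 n, (R.lu k - R.δ)) * (2 * R.η * R.tau n) ≤
        R.τ * (Real.exp (-(n * R.δ)) - Real.exp (-((n + 1 : ℕ) * R.δ))) := by
      have e1 := R.sum_expand_ge n.zero_le hN.le
      have e2 : Real.exp (-∑ k ∈ Finset.Ico 0 n, (R.lu k - R.δ)) ≤
          Real.exp (-(n * R.δ)) * Real.exp (R.D n) := by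
        rw [← Real.exp_add]
        refine Real.exp_le_exp.2 ?_
        have := R.χ_ge; have := R.χbu_ge; have := R.δ_pos
        have : (n : ℝ) * R.δ ≤ n * (R.χ - R.δ) :=
          mul_le_mul_of_nonneg_left (by linarith) n.cast_nonneg
        push_cast at e1
        linarith
      have e3 : Real.exp (R.D n) * R.tau n ≤ R.τ := by
        have := mul_le_mul_of_nonneg_left (R.tau_le hN.le) (Real.exp_pos (R.D n)).le
        rwa [mul_left_comm, ← Real.exp_add, add_neg_cancel, Real.exp_zero, mul_one] at this
      have e4 : Real.exp (-((n + 1 : ℕ) * R.δ)) = Real.exp (-(n * R.δ)) * Real.exp (-R.δ) := by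
        rw [← Real.exp_add]; push_cast; ring_nf
      have e5 := R.exp_neg_δ_le (x := 2 * R.η) (by linarith [R.η_le, R.δ_pos])
      have hη := R.η_nonneg
      have ht := R.tau_nonneg n
      have hτ := R.τ_nonneg
      calc _ ≤ (Real.exp (-(n * R.δ)) * Real.exp (R.D n)) * (2 * R.η * R.tau n) := by gcongr
        _ = Real.exp (-(n * R.δ)) * (2 * R.η) * (Real.exp (R.D n) * R.tau n) := by ring
        _ ≤ Real.exp (-(n * R.δ)) * (1 - Real.exp (-R.δ)) * R.τ := by
          refine mul_le_mul ?_ e3 (by positivity) ?_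
          · gcongr; linarith
          · exact mul_nonneg (Real.exp_pos _).le (by linarith)
        _ = _ := by rw [e4]; ring
    have h6 := mul_le_mul_of_nonneg_left h4
      (Real.exp_pos (-∑ k ∈ Finset.Ico 0 n, (R.lu k - R.δ))).le
    have e6 : Real.exp (-∑ k ∈ Finset.Ico 0 (n + 1), (R.lu k - R.δ)) =
        Real.exp (-∑ k ∈ Finset.Ico 0 n, (R.lu k - R.δ)) * Real.exp (-(R.lu n - R.δ)) := by
      rw [← Real.exp_add, Finset.sum_Ico_succ_top n.zero_le, neg_add]
    rw [e6]
    linarith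

lemma continuousOn_gt {ψ : X 0 → Y 0} (h : R.Adm 0 ψ) {n : ℕ} (hn : n ≤ R.N) :
    ContinuousOn (fun x : ℝ × X n => M.gt (x.1 • ψ) n x.2)
      (Icc (0 : ℝ) 1 ×ˢ ball 0 (R.rad n)) := by
  induction n with
  | zero =>
    exact continuous_fst.continuousOn.smul
      (h.diff.continuousOn.comp continuous_snd.continuousOn fun x hx => hx.2)
  | succ n ih =>
    have : CompleteSpace (X n) := FiniteDimensional.complete ℝ _
    exact (M.near n (by omega)).continuousOn_transform
      (Ψ := fun t => M.gt (t • ψ) n) (fun t ht => flat_gt (h.smul ht) (by omega))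
      (fun t ht => rad_succ_le (h.smul ht) (by omega)) (ih (by omega))

lemma continuousOn_pull {ψ : X 0 → Y 0} (h : R.Adm 0 ψ) {n : ℕ} (hn : n ≤ R.N) :
    ContinuousOn (fun x : ℝ × X n => M.pull (x.1 • ψ) n x.2)
      (Icc (0 : ℝ) 1 ×ˢ ball 0 (R.rad n)) := by
  induction n with
  | zero => exact continuous_snd.continuousOn
  | succ n ih =>
    have : CompleteSpace (X n) := FiniteDimensional.complete ℝ _
    have h1 := (M.near n (by omega)).continuousOn_baseInv
      (Ψ := fun t => M.gt (t • ψ) n) (fun t ht => flat_gt (h.smul ht) (by omega))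
      (fun t ht => rad_succ_le (h.smul ht) (by omega)) (continuousOn_gt h (by omega))
    exact (ih (by omega)).comp (continuous_fst.continuousOn.prodMk h1) fun x hx =>
      ⟨hx.1, mem_ball_zero_iff.2
        (baseInv_spec (h.smul hx.1) (by omega) (mem_ball_zero_iff.1 hx.2)).1⟩

lemma pull_mem {ψ : X 0 → Y 0} (h : R.Adm 0 ψ) {n : ℕ} (hn : n ≤ R.N) {u : X n}
    (hu : ‖u‖ < R.rad n) : ‖M.pull ψ n u‖ < R.rad 0 := by
  induction n with
  | zero => exact hu
  | succ n ih => exact ih (by omega) (baseInv_spec h (by omega) hu).1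

/-- Provides the base point of the homotopy: for `t = 0` the pull-back of the origin is the origin.
-/
lemma zero_orbit {ψ : X 0 → Y 0} (h : R.Adm 0 ψ) (hψ : ψ 0 = 0) {n : ℕ} (hn : n ≤ R.N) :
    M.gt ψ n 0 = 0 ∧ M.pull ψ n 0 = 0 := by
  induction n with
  | zero => exact ⟨hψ, rfl⟩
  | succ n ih =>
    obtain ⟨h1, h2⟩ := ih (by omega)
    have H := M.near n (by omega)
    have hf := flat_gt (M := M) h (n := n) (by omega)
    have h3 := H.transform_base hf (mem_ball_self (R.rad_pos n))
    have h4 := H.baseInv_base hf (mem_ball_self (R.rad_pos n))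
    have h0 : ((0 : X n), (0 : Y n)) = 0 := rfl
    rw [h1, h0, H.p_zero] at h3 h4
    rw [H.q_zero] at h3
    exact ⟨h3, (congrArg (M.pull ψ n) h4).trans h2⟩

end MapChain
end EffHyp
end

/-! ### Coordinates adapted to the splitting -/

noncomputable section
namespace EffHyp

open Metric Set NearLinear

/-- The norm of the projection along a complement at angle at least `θ`. -/
lemma norm_mul_sin_le {E : Type*} [NormedAddCommGroup E] [InnerProductSpace ℝ E]
    {P Q : Submodule ℝ E} {θ : ℝ} (hθ : 0 < θ)
    (h : ∀ v ∈ P, ∀ w ∈ Q, v ≠ 0 → w ≠ 0 → θ ≤ InnerProductGeometry.angle v w)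
    {v w : E} (hv : v ∈ P) (hw : w ∈ Q) : ‖v‖ * Real.sin θ ≤ ‖v + w‖ := by
  by_cases hv0 : v = 0
  · simp [hv0]
  by_cases hw0 : w = 0
  · simpa [hw0] using mul_le_of_le_one_right (norm_nonneg v) (Real.sin_le_one θ)
  have h1 := h v hv w hw hv0 hw0
  -- Since `-w` also lies in `Q`, the angle lies between `θ` and `π - θ`, hence its sine is at least
  -- `sin θ`.
  have h2 := h v hv (-w) (Q.neg_mem hw) hv0 (neg_ne_zero.2 hw0)
  rw [InnerProductGeometry.angle_neg_right] at h2
  set φ := InnerProductGeometry.angle v w with hφ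
  have hsin : Real.sin θ ≤ Real.sin φ := by
    rcases le_total φ (Real.pi / 2) with h3 | h3
    · exact Real.sin_le_sin_of_le_of_le_pi_div_two (by linarith [Real.pi_pos]) h3 h1
    · rw [← Real.sin_pi_sub φ]
      exact Real.sin_le_sin_of_le_of_le_pi_div_two (by linarith [Real.pi_pos]) (by linarith) h2
  have hs0 : 0 ≤ Real.sin φ := InnerProductGeometry.sin_angle_nonneg v w
  have hin := InnerProductGeometry.cos_angle_mul_norm_mul_norm v w
  rw [← hφ] at hin
  have hsq := norm_add_sq_real v w
  rw [← hin] at hsq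
  refine (mul_le_mul_of_nonneg_left hsin (norm_nonneg v)).trans ?_
  refine abs_le_of_sq_le_sq' ?_ (norm_nonneg _) |>.2
  rw [hsq, mul_pow, Real.sin_sq]
  -- The difference of the two sides is exactly this square.
  nlinarith [sq_nonneg (‖w‖ + ‖v‖ * Real.cos φ)]

lemma norm_mul_sin_le' {E : Type*} [NormedAddCommGroup E] [InnerProductSpace ℝ E]
    {P Q : Submodule ℝ E} {θ : ℝ} (hθ : 0 < θ)
    (h : ∀ v ∈ P, ∀ w ∈ Q, v ≠ 0 → w ≠ 0 → θ ≤ InnerProductGeometry.angle v w)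
    {v w : E} (hv : v ∈ P) (hw : w ∈ Q) : ‖w‖ * Real.sin θ ≤ ‖v + w‖ := by
  rw [add_comm]
  refine norm_mul_sin_le hθ (fun w hw v hv hw0 hv0 => ?_) hw hv
  rw [InnerProductGeometry.angle_comm]
  exact h v hv w hw hv0 hw0

namespace LocalSystem

variable {d : ℕ} (S : LocalSystem d)

open Classical in
/-- The projection to the unstable subspace along the stable one. -/
def projU (n : ℕ) : V d →L[ℝ] S.Eu n :=
  if h : IsCompl (S.Eu n) (S.Es n) then
    LinearMap.toContinuousLinearMap ((S.Eu n).projectionOnto (S.Es n) h) else 0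

open Classical in
/-- The projection to the stable subspace along the unstable one. -/
def projS (n : ℕ) : V d →L[ℝ] S.Es n :=
  if h : IsCompl (S.Eu n) (S.Es n) then
    LinearMap.toContinuousLinearMap ((S.Es n).projectionOnto (S.Eu n) h.symm) else 0

/-- The coordinates of a splitting. -/
def inc (n : ℕ) : S.Eu n × S.Es n →L[ℝ] V d := (S.Eu n).subtypeL.coprod (S.Es n).subtypeL

@[simp] lemma inc_apply (n : ℕ) (z : S.Eu n × S.Es n) :
    S.inc n z = (z.1 : V d) + (z.2 : V d) := rfl

variable {S}

lemma projU_add {n : ℕ} (h : IsCompl (S.Eu n) (S.Es n)) (v : S.Eu n) (w : S.Es n) :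
    S.projU n ((v : V d) + (w : V d)) = v := by
  simp [projU, h, map_add]

lemma projS_add {n : ℕ} (h : IsCompl (S.Eu n) (S.Es n)) (v : S.Eu n) (w : S.Es n) :
    S.projS n ((v : V d) + (w : V d)) = w := by
  simp [projS, h, map_add]

lemma proj_add_proj {n : ℕ} (h : IsCompl (S.Eu n) (S.Es n)) (x : V d) :
    (S.projU n x : V d) + (S.projS n x : V d) = x := by
  simpa [projU, projS, h] using Submodule.projection_add_projection_eq_self h x

lemma inc_proj {n : ℕ} (h : IsCompl (S.Eu n) (S.Es n)) (x : V d) :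
    S.inc n (S.projU n x, S.projS n x) = x := proj_add_proj h x

lemma inc_injective {n : ℕ} (h : IsCompl (S.Eu n) (S.Es n)) : Function.Injective (S.inc n) := by
  intro z z' hz
  rw [inc_apply, inc_apply] at hz
  have h1 := congrArg (S.projU n) hz
  have h2 := congrArg (S.projS n) hz
  rw [projU_add h, projU_add h] at h1
  rw [projS_add h, projS_add h] at h2
  exact Prod.ext h1 h2

lemma norm_inc_le (n : ℕ) (z : S.Eu n × S.Es n) : ‖S.inc n z‖ ≤ 2 * ‖z‖ := by
  rw [inc_apply]
  have h1 := norm_add_le (z.1 : V d) (z.2 : V d)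
  have h2 : ‖(z.1 : V d)‖ ≤ ‖z‖ := norm_fst_le z
  have h3 : ‖(z.2 : V d)‖ ≤ ‖z‖ := norm_snd_le z
  linarith

lemma mem_box_iff {n : ℕ} (h : IsCompl (S.Eu n) (S.Es n)) {r s : ℝ} {z : S.Eu n × S.Es n} :
    S.inc n z ∈ box (S.Eu n) (S.Es n) r s ↔ ‖z.1‖ < r ∧ ‖z.2‖ < s := by
  constructor
  · rintro ⟨v, w, hv, hw, e⟩
    have : z = (v, w) := inc_injective h e
    exact this ▸ ⟨hv, hw⟩
  · exact fun hz => ⟨z.1, z.2, hz.1, hz.2, rfl⟩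

lemma mem_cylinder_iff {n : ℕ} (h : IsCompl (S.Eu n) (S.Es n)) {r : ℝ} {z : S.Eu n × S.Es n} :
    S.inc n z ∈ cylinder (S.Eu n) (S.Es n) r ↔ ‖z.1‖ < r := by
  constructor
  · rintro ⟨v, w, hv, e⟩
    have : z = (v, w) := inc_injective h e
    exact this ▸ hv
  · exact fun hz => ⟨z.1, z.2, hz, rfl⟩

lemma mem_graphOn_iff {n : ℕ} (h : IsCompl (S.Eu n) (S.Es n)) {r : ℝ} {ψ : S.Eu n → S.Es n}
    {z : S.Eu n × S.Es n} :
    S.inc n z ∈ graphOn r ψ ↔ ‖z.1‖ < r ∧ z.2 = ψ z.1 := by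
  constructor
  · rintro ⟨v, hv, e⟩
    have : z = (v, ψ v) := inc_injective h e
    subst this
    exact ⟨hv, rfl⟩
  · exact fun hz => ⟨z.1, hz.1, by rw [← hz.2]; rfl⟩

lemma comp_self (m : ℕ) : S.comp m m = id := by
  cases m with
  | zero => rfl
  | succ m => simp [comp]

lemma comp_succ {m n : ℕ} (h : m ≤ n) (x : V d) : S.comp m (n + 1) x = S.f n (S.comp m n x) := by
  simp [comp, h]

lemma norm_projU_le {n : ℕ} (h : IsCompl (S.Eu n) (S.Es n)) (hθ : 0 < S.θ n)
    (hs : 0 < Real.sin (S.θ n))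
    (ha : ∀ v ∈ S.Eu n, ∀ w ∈ S.Es n, v ≠ 0 → w ≠ 0 →
      S.θ n ≤ InnerProductGeometry.angle v w) : ‖S.projU n‖ ≤ 1 / Real.sin (S.θ n) := by
  refine ContinuousLinearMap.opNorm_le_bound _ (by positivity) fun x => ?_
  have := norm_mul_sin_le hθ ha (S.projU n x).2 (S.projS n x).2
  rw [proj_add_proj h] at this
  rw [one_div, inv_mul_eq_div, le_div_iff₀ hs]
  exact this

lemma norm_projS_le {n : ℕ} (h : IsCompl (S.Eu n) (S.Es n)) (hθ : 0 < S.θ n)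
    (hs : 0 < Real.sin (S.θ n))
    (ha : ∀ v ∈ S.Eu n, ∀ w ∈ S.Es n, v ≠ 0 → w ≠ 0 →
      S.θ n ≤ InnerProductGeometry.angle v w) : ‖S.projS n‖ ≤ 1 / Real.sin (S.θ n) := by
  refine ContinuousLinearMap.opNorm_le_bound _ (by positivity) fun x => ?_
  have := norm_mul_sin_le' hθ ha (S.projU n x).2 (S.projS n x).2
  rw [proj_add_proj h] at this
  rw [one_div, inv_mul_eq_div, le_div_iff₀ hs]
  exact this

variable (S) in
/-- The sequence of maps has the given rates on the boxes of the given sizes. -/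
structure HasRates (R : Rates) : Prop where
  c1 : S.C1 R.N R.α
  c2 : S.C2 R.N
  c3 : S.C3 R.N R.α
  dom : ∀ n < R.N, box (S.Eu n) (S.Es n) (R.rad n) (R.height n) ⊆ S.Ω n
  lu : ∀ n < R.N, R.lu n = S.lamU n
  ls : ∀ n < R.N, R.ls n = S.lamS n
  b : ∀ n < R.N, R.b n = 4 * S.β n

variable {R : Rates}

/-- Applied with `c = sin θ`: the norm `1 / c` of the projection cancels the factor `c` of the
Hölder bound. The factor 4 is the norm 2 of the inclusion times `2 ^ α ≤ 2`. -/
lemma holder_proj {E : Type*} [NormedAddCommGroup E] [NormedSpace ℝ E] {n : ℕ} {α K c : ℝ}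
    (hα : 0 < α) (hα1 : α ≤ 1) (hc : 0 < c) (hK : 0 ≤ K) {π : V d →L[ℝ] E}
    (hπ : ‖π‖ ≤ 1 / c) {Q : Set (S.Eu n × S.Es n)}
    (hQ : ∀ z ∈ Q, S.inc n z ∈ S.Ω n)
    (hf : HolderBound α (K * c) (S.Ω n) (fderiv ℝ (S.f n)))
    (hd : ∀ z ∈ Q, fderiv ℝ (fun z => π (S.f n (S.inc n z))) z =
      (π.comp (fderiv ℝ (S.f n) (S.inc n z))).comp (S.inc n)) :
    HolderBound α (4 * K) Q (fderiv ℝ (fun z => π (S.f n (S.inc n z)))) := by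
  intro z hz z' hz'
  rw [hd z hz, hd z' hz', ← ContinuousLinearMap.sub_comp, ← ContinuousLinearMap.comp_sub]
  have h1 := hf _ (hQ z hz) _ (hQ z' hz')
  rw [← map_sub] at h1
  have h2 : ‖S.inc n (z - z')‖ ^ α ≤ 2 * ‖z - z'‖ ^ α := by
    refine (Real.rpow_le_rpow (norm_nonneg _) (norm_inc_le n _) hα.le).trans ?_
    rw [Real.mul_rpow (by norm_num) (norm_nonneg _)]
    refine mul_le_mul_of_nonneg_right ?_ (Real.rpow_nonneg (norm_nonneg _) _)
    simpa using Real.rpow_le_rpow_of_exponent_le (by norm_num : (1 : ℝ) ≤ 2) hα1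
  have h3 : ‖S.inc n‖ ≤ 2 := (S.inc n).opNorm_le_bound (by norm_num) (norm_inc_le n)
  have h4 := Real.rpow_nonneg (norm_nonneg (z - z')) α
  calc _ ≤ _ := ContinuousLinearMap.opNorm_comp_le _ _
    _ ≤ (‖π‖ * ‖fderiv ℝ (S.f n) (S.inc n z) - fderiv ℝ (S.f n) (S.inc n z')‖) * ‖S.inc n‖ :=
      mul_le_mul_of_nonneg_right (ContinuousLinearMap.opNorm_comp_le _ _)
        (S.inc n).opNorm_nonneg
    _ ≤ (1 / c * (K * c * (2 * ‖z - z'‖ ^ α))) * 2 := by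
      refine mul_le_mul (mul_le_mul hπ ?_ (norm_nonneg _) (by positivity)) h3
        (S.inc n).opNorm_nonneg (by positivity)
      exact h1.trans (mul_le_mul_of_nonneg_left h2 (by positivity))
    _ = _ := by field_simp; ring

/-- The coordinate representation of a sequence of maps. -/
def HasRates.chain (hS : S.HasRates R) :
    MapChain R (fun n => S.Eu n) (fun n => S.Es n) where
  p n z := S.projU (n + 1) (S.f n (S.inc n z))
  q n z := S.projS (n + 1) (S.f n (S.inc n z))
  A n := ((S.projU (n + 1)).comp (fderiv ℝ (S.f n) 0)).comp (S.Eu n).subtypeL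
  B n := ((S.projS (n + 1)).comp (fderiv ℝ (S.f n) 0)).comp (S.Es n).subtypeL
  near n hn := by
    obtain ⟨hΩ, h0, hf0, hf1, -, -, -⟩ := hS.c1 n hn
    have hc := hS.c2.1 n hn.le
    have hc' := hS.c2.1 (n + 1) hn
    obtain ⟨hEu, hEs⟩ := hS.c2.2 n hn
    obtain ⟨hθ, hang⟩ := hS.c3.1 (n + 1) hn
    obtain ⟨hβ, hu, hs, hsin, hh⟩ := hS.c3.2 n hn
    have hsin' : 0 < Real.sin (S.θ (n + 1)) := by
      by_contra h
      push Not at h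
      nlinarith
    have hmem : ∀ z ∈ ball (0 : S.Eu n) (R.rad n) ×ˢ ball (0 : S.Es n) (R.height n),
        S.inc n z ∈ S.Ω n := fun z hz =>
      hS.dom n hn ((mem_box_iff hc).2 ⟨mem_ball_zero_iff.1 hz.1, mem_ball_zero_iff.1 hz.2⟩)
    have hfd : ∀ x ∈ S.Ω n, HasFDerivAt (S.f n) (fderiv ℝ (S.f n) x) x := fun x hx =>
      ((hf1.differentiableOn one_ne_zero x hx).differentiableAt
        (hΩ.mem_nhds hx)).hasFDerivAt
    have hd : ∀ {E : Type} [NormedAddCommGroup E] [NormedSpace ℝ E] (π : V d →L[ℝ] E),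
        ∀ z ∈ ball (0 : S.Eu n) (R.rad n) ×ˢ ball (0 : S.Es n) (R.height n),
        HasFDerivAt (fun z => π (S.f n (S.inc n z)))
          ((π.comp (fderiv ℝ (S.f n) (S.inc n z))).comp (S.inc n)) z := by
      intro E _ _ π z hz
      exact ((π.hasFDerivAt.comp _ (hfd _ (hmem z hz)))).comp z (S.inc n).hasFDerivAt
    have h0m : (0 : S.Eu n × S.Es n) ∈
        ball (0 : S.Eu n) (R.rad n) ×ˢ ball (0 : S.Es n) (R.height n) :=
      ⟨mem_ball_self (R.rad_pos n), mem_ball_self (R.height_pos n)⟩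
    have hAu : ∀ v : S.Eu n, fderiv ℝ (S.f n) 0 v ∈ S.Eu (n + 1) := fun v => by
      rw [← hEu]; exact Submodule.mem_map_of_mem v.2
    have hAs : ∀ w : S.Es n, fderiv ℝ (S.f n) 0 w ∈ S.Es (n + 1) := fun w => by
      rw [← hEs]; exact Submodule.mem_map_of_mem w.2
    have pU : ∀ x (hx : x ∈ S.Eu (n + 1)), S.projU (n + 1) x = ⟨x, hx⟩ := fun x hx => by
      simpa using projU_add hc' ⟨x, hx⟩ 0
    have pU' : ∀ x ∈ S.Es (n + 1), S.projU (n + 1) x = 0 := fun x hx => by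
      simpa using projU_add hc' 0 ⟨x, hx⟩
    have pS : ∀ x (hx : x ∈ S.Es (n + 1)), S.projS (n + 1) x = ⟨x, hx⟩ := fun x hx => by
      simpa using projS_add hc' 0 ⟨x, hx⟩
    have pS' : ∀ x ∈ S.Eu (n + 1), S.projS (n + 1) x = 0 := fun x hx => by
      simpa using projS_add hc' ⟨x, hx⟩ 0
    refine
      { r_pos := R.rad_pos n
        s_pos := R.height_pos n
        α_pos := R.α_pos
        b_nonneg := R.b_nonneg n hn
        ε_nonneg := R.ε_nonneg
        ε_lt := by linarith [R.expand_pos hn]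
        μ_nonneg := (Real.exp_pos _).le
        diff_p := fun z hz => (hd _ z hz).differentiableAt
        diff_q := fun z hz => (hd _ z hz).differentiableAt
        p_zero := by simp only [map_zero, hf0]
        q_zero := by simp only [map_zero, hf0]
        dp_zero := ?_
        dq_zero := ?_
        lower := fun v => ?_
        upper := fun w => ?_
        surj := fun u => ?_
        holder_p := ?_
        holder_q := ?_
        small := fun z hz => ?_ }
    · rw [(hd _ 0 h0m).fderiv]
      refine ContinuousLinearMap.ext fun z => ?_
      simp only [map_zero, ContinuousLinearMap.comp_apply, inc_apply, map_add, pU' _ (hAs z.2),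
        add_zero]
      rfl
    · rw [(hd _ 0 h0m).fderiv]
      refine ContinuousLinearMap.ext fun z => ?_
      simp only [map_zero, ContinuousLinearMap.comp_apply, inc_apply, map_add, pS' _ (hAu z.1),
        zero_add]
      rfl
    · simp only [ContinuousLinearMap.comp_apply, Submodule.subtypeL_apply, pU _ (hAu v)]
      rw [hS.lu n hn]
      exact hu v v.2
    · simp only [ContinuousLinearMap.comp_apply, Submodule.subtypeL_apply, pS _ (hAs w)]
      rw [hS.ls n hn]
      exact hs w w.2
    · have : (u : V d) ∈ (S.Eu n).map (fderiv ℝ (S.f n) 0 : V d →ₗ[ℝ] V d) := by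
        rw [hEu]; exact u.2
      obtain ⟨v, hv, hvu⟩ := this
      refine ⟨⟨v, hv⟩, ?_⟩
      simp only [ContinuousLinearMap.comp_apply, Submodule.subtypeL_apply]
      rw [pU _ (hAu ⟨v, hv⟩)]
      exact Subtype.ext hvu
    · rw [hS.b n hn]
      exact holder_proj R.α_pos R.α_le hsin' hβ.le (norm_projU_le hc' hθ hsin' hang) hmem hh
        fun z hz => (hd _ z hz).fderiv
    · rw [hS.b n hn]
      exact holder_proj R.α_pos R.α_le hsin' hβ.le (norm_projS_le hc' hθ hsin' hang) hmem hh
        fun z hz => (hd _ z hz).fderiv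
    · refine R.b_rad_le hn (norm_nonneg _) (max_le ?_ ?_)
      · linarith [mem_ball_zero_iff.1 hz.1, R.rad_pos n]
      · exact (mem_ball_zero_iff.1 hz.2).le.trans (R.height_le n)

variable (S R) in
/-- The boxes of the given sizes. -/
def boxes (n : ℕ) : Set (V d) := box (S.Eu n) (S.Es n) (R.rad n) (R.height n)

variable (S) in
/-- The orbit of a point in coordinates. -/
def coordOrbit (m : ℕ) (x : V d) (k : ℕ) : S.Eu k × S.Es k :=
  (S.projU k (S.comp m k x), S.projS k (S.comp m k x))

namespace HasRates

variable (hS : S.HasRates R)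
include hS

lemma compl {n : ℕ} (hn : n ≤ R.N) : IsCompl (S.Eu n) (S.Es n) := hS.c2.1 n hn

lemma f_inc {n : ℕ} (hn : n < R.N) (z : S.Eu n × S.Es n) :
    S.f n (S.inc n z) = S.inc (n + 1) (hS.chain.p n z, hS.chain.q n z) :=
  (inc_proj (hS.compl hn) _).symm

lemma inc_coordOrbit {m k : ℕ} (hk : k ≤ R.N) (x : V d) :
    S.inc k (S.coordOrbit m x k) = S.comp m k x := inc_proj (hS.compl hk) _

lemma coordOrbit_eq {m k : ℕ} (hk : k ≤ R.N) {x : V d} {z : S.Eu k × S.Es k}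
    (h : S.comp m k x = S.inc k z) : S.coordOrbit m x k = z :=
  inc_injective (hS.compl hk) ((hS.inc_coordOrbit hk x).trans h)

lemma isOrbit_coordOrbit {m n : ℕ} (hn : n ≤ R.N) (x : V d) :
    hS.chain.IsOrbit m n (S.coordOrbit m x) := by
  intro k hk hkn
  refine hS.coordOrbit_eq (by omega) ?_
  rw [comp_succ hk, ← hS.inc_coordOrbit (by omega), hS.f_inc (by omega)]

lemma coordOrbit_mem {m n : ℕ} (hn : n ≤ R.N) {x : V d}
    (hx : x ∈ S.orbitDomain (S.boxes R) m n) {k : ℕ} (hm : m ≤ k) (hk : k < n) :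
    ‖(S.coordOrbit m x k).1‖ < R.rad k ∧ ‖(S.coordOrbit m x k).2‖ < R.height k := by
  have h := connectedComponentIn_subset _ _ hx k hm hk
  rw [← hS.inc_coordOrbit (by omega)] at h
  exact (mem_box_iff (hS.compl (by omega))).1 h

/-- The orbit passes over the successive base preimages of `u`, and flatness of the graphs keeps it
in the boxes. -/
lemma pull_orbit {ψ : S.Eu 0 → S.Es 0} (h : R.Adm 0 ψ) {n : ℕ} (hn : n ≤ R.N) {u : S.Eu n}
    (hu : ‖u‖ < R.rad n) :
    S.comp 0 n (S.inc 0 (hS.chain.pull ψ n u, ψ (hS.chain.pull ψ n u))) =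
      S.inc n (u, hS.chain.gt ψ n u) ∧
    ∀ k < n, S.comp 0 k (S.inc 0 (hS.chain.pull ψ n u, ψ (hS.chain.pull ψ n u))) ∈
      S.boxes R k := by
  induction n with
  | zero => exact ⟨rfl, fun k hk => absurd hk (Nat.not_lt_zero k)⟩
  | succ n ih =>
    obtain ⟨h1, h2⟩ := MapChain.baseInv_spec (M := hS.chain) h (n := n) (by omega) hu
    obtain ⟨h3, h4⟩ := ih (by omega) h1
    refine ⟨?_, fun k hk => ?_⟩
    · rw [comp_succ n.zero_le, MapChain.pull, h3, hS.f_inc (by omega), h2]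
      rfl
    · rcases Nat.lt_succ_iff_lt_or_eq.1 hk with hk | rfl
      · exact h4 k hk
      · rw [MapChain.pull, h3]
        exact (mem_box_iff (hS.compl (by omega))).2 ⟨h1,
          (MapChain.flat_gt (M := hS.chain) h (by omega)).height _ (mem_ball_zero_iff.2 h1)⟩

/-- Over the convex set of pairs `(t, u)`, the pulled-back points on the graphs of `t • ψ` form a
connected set of orbits staying in the boxes. It contains 0, from `t = 0` and `u = 0`, so it lies in
the component of 0. -/
lemma pull_mem_orbitDomain {ψ : S.Eu 0 → S.Es 0} (h : R.Adm 0 ψ) {n : ℕ} (hn : n ≤ R.N)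
    {u : S.Eu n} (hu : ‖u‖ < R.rad n) :
    S.inc 0 (hS.chain.pull ψ n u, ψ (hS.chain.pull ψ n u)) ∈
      S.orbitDomain (S.boxes R) 0 n := by
  let Φ : ℝ × S.Eu n → V d := fun x => S.inc 0 (hS.chain.pull (x.1 • ψ) n x.2,
    (x.1 • ψ) (hS.chain.pull (x.1 • ψ) n x.2))
  have hΦ : ContinuousOn Φ (Icc (0 : ℝ) 1 ×ˢ ball 0 (R.rad n)) := by
    have h1 := MapChain.continuousOn_pull (M := hS.chain) h hn
    have h2 : ContinuousOn (fun x : ℝ × S.Eu n => x.1 • ψ (hS.chain.pull (x.1 • ψ) n x.2))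
        (Icc (0 : ℝ) 1 ×ˢ ball 0 (R.rad n)) :=
      continuous_fst.continuousOn.smul (h.diff.continuousOn.comp h1 fun x hx =>
        mem_ball_zero_iff.2 (MapChain.pull_mem (h.smul hx.1) hn (mem_ball_zero_iff.1 hx.2)))
    exact (S.inc 0).continuous.comp_continuousOn (h1.prodMk h2)
  have hpre : IsPreconnected (Φ '' (Icc (0 : ℝ) 1 ×ˢ ball 0 (R.rad n))) :=
    (((convex_Icc (0 : ℝ) 1).prod (convex_ball (0 : S.Eu n) (R.rad n))).isPreconnected).image
      _ hΦ
  have h0 : (0 : V d) ∈ Φ '' (Icc (0 : ℝ) 1 ×ˢ ball 0 (R.rad n)) := by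
    refine ⟨(0, 0), ⟨⟨le_rfl, zero_le_one⟩, mem_ball_self (R.rad_pos n)⟩, ?_⟩
    have := (MapChain.zero_orbit (M := hS.chain)
      (h.smul (t := 0) ⟨le_rfl, zero_le_one⟩) (by simp) hn).2
    simp only [Φ, this]
    simp
  have hsub := hpre.subset_connectedComponentIn h0
    (F := {x | ∀ k, 0 ≤ k → k < n → S.comp 0 k x ∈ S.boxes R k}) (by
      rintro _ ⟨⟨t, u⟩, ⟨ht, hu⟩, rfl⟩ k - hk
      exact (hS.pull_orbit (h.smul ht) hn (mem_ball_zero_iff.1 hu)).2 k hk)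
  refine hsub ⟨(1, u), ⟨⟨zero_le_one, le_rfl⟩, mem_ball_zero_iff.2 hu⟩, ?_⟩
  simp [Φ]

/-- One inclusion is invariance of the graphs along orbits, the other the pull-back. Any radius up
to `rad n` is allowed, since `M n` may exceed the deficit. -/
lemma isGraphTransform_gt {ψ : S.Eu 0 → S.Es 0} (h : R.Adm 0 ψ) {n : ℕ} (hn : n ≤ R.N)
    {ρ : ℝ} (hρ : ρ ≤ R.rad n) :
    S.IsGraphTransform (S.boxes R) n R.r ρ ψ (hS.chain.gt ψ n) := by
  have hr : R.rad 0 = R.r := by simp [Rates.rad, R.D_zero]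
  apply Subset.antisymm
  · rintro _ ⟨⟨x, ⟨hxg, hxd⟩, rfl⟩, hc⟩
    have hx0 : S.inc 0 (S.coordOrbit 0 x 0) = x := hS.inc_coordOrbit (Nat.zero_le _) x
    rw [← hx0, mem_graphOn_iff (hS.compl (Nat.zero_le _))] at hxg
    rw [← hS.inc_coordOrbit hn] at hc ⊢
    rw [mem_cylinder_iff (hS.compl hn)] at hc
    exact (mem_graphOn_iff (hS.compl hn)).2 ⟨hc,
      (hS.isOrbit_coordOrbit hn x).graph h n.zero_le hn
        (fun k hk hk' => (hS.coordOrbit_mem hn hxd hk hk').1) hxg.2⟩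
  · rintro _ ⟨u, hu, rfl⟩
    have hu' := hu.trans_le hρ
    refine ⟨⟨_, ⟨?_, hS.pull_mem_orbitDomain h hn hu'⟩, (hS.pull_orbit h hn hu').1⟩,
      ⟨u, _, hu, rfl⟩⟩
    exact (mem_graphOn_iff (hS.compl (Nat.zero_le _))).2
      ⟨(MapChain.pull_mem h hn hu').trans_eq hr, rfl⟩

lemma eq_gt {ψ : S.Eu 0 → S.Es 0} (h : R.Adm 0 ψ) {n : ℕ} (hn : n ≤ R.N)
    {ρ : ℝ} (hρ : ρ ≤ R.rad n) {φ : S.Eu n → S.Es n}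
    (hφ : S.IsGraphTransform (S.boxes R) n R.r ρ ψ φ) {v : S.Eu n} (hv : ‖v‖ < ρ) :
    φ v = hS.chain.gt ψ n v := by
  have h1 := hφ.symm.trans (hS.isGraphTransform_gt h hn hρ)
  have h2 : S.inc n (v, φ v) ∈ graphOn ρ φ :=
    (mem_graphOn_iff (hS.compl hn)).2 ⟨hv, rfl⟩
  rw [h1] at h2
  exact ((mem_graphOn_iff (hS.compl hn)).1 h2).2

end HasRates

end LocalSystem
end EffHyp
end

/-! ### Properties (I) to (IV) -/

noncomputable section
namespace EffHyp

open Metric Set NearLinear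

namespace LocalSystem

variable {d : ℕ} {S : LocalSystem d} {R : Rates}

/-- At time 0 the deficit vanishes and `decay 0 = -M0`, which is where the factors `e^{-M0}` and
`e^{-α M0}` come from. -/
lemma adm_of_mem_initClass {ψ : S.Eu 0 → S.Es 0}
    (h : ψ ∈ S.initClass R.α R.r R.τ R.σ R.κh R.M0) : R.Adm 0 ψ := by
  have h0 : R.decay 0 = -R.M0 := by simp [Rates.decay, R.D_zero]
  have hr : R.rad 0 = R.r := by simp [Rates.rad, R.D_zero]
  obtain ⟨h1, h2, h3, h4⟩ := h
  refine ⟨by rwa [hr], ?_, ?_, ?_⟩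
  · rwa [Rates.tau, h0, R.D_zero, sub_zero]
  · rwa [Rates.sig, h0, mul_neg, ← neg_mul]
  · rw [hr]
    have : R.kap 0 = R.κh := by
      simp [Rates.kap, Rates.kapFactor, R.D_zero, max_eq_right R.κ_le]
    rwa [this]

namespace HasRates

variable {M : ℕ → ℝ} {χhs χbs : ℝ}

lemma rad_ge (hM : ∀ n ≤ R.N, R.D n ≤ M n) {n : ℕ} (hn : n ≤ R.N) :
    R.r * Real.exp (-M n) ≤ R.rad n :=
  mul_le_mul_of_nonneg_left (Real.exp_le_exp.2 (neg_le_neg (hM n hn))) R.r_pos.le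

lemma sum_ls_le (hS : S.HasRates R) (hst : S.StableBound R.N χhs M R.M0) (hχ : χhs + R.δ ≤ χbs) {n : ℕ}
    (hn : n ≤ R.N) :
    ∑ k ∈ Finset.range n, R.ls k + n * R.δ ≤ R.M0 - M n + n * χbs := by
  have h1 : ∑ k ∈ Finset.range n, R.ls k = ∑ k ∈ Finset.range n, S.lamS k :=
    Finset.sum_congr rfl fun k hk => hS.ls k ((Finset.mem_range.1 hk).trans_le hn)
  have h2 := hst n hn
  have h3 := mul_le_mul_of_nonneg_left hχ n.cast_nonneg
  linarith

variable (hS : S.HasRates R) (hM : ∀ n ≤ R.N, R.D n ≤ M n)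
include hS hM

lemma wellDefined {θbar : ℝ} (hst : S.StableBound R.N χhs M R.M0) (hχ : χhs + R.δ ≤ χbs)
    (hθ : ∀ n, 1 ≤ n → n ≤ R.N → θbar * Real.exp (-R.α * M n) ≤ S.θ n) :
    S.WellDefined (S.boxes R) R.N R.α R.χbu χbs R.r θbar R.σ R.τ R.κ R.κh M R.M0 := by
  refine ⟨hθ, fun n hn ψ hψ => ?_⟩
  have h := adm_of_mem_initClass hψ
  have hg := MapChain.adm_gt (M := hS.chain) h hn
  have hr := rad_ge hM hn
  have hsub : ball (0 : S.Eu n) (R.r * Real.exp (-M n)) ⊆ ball 0 (R.rad n) := ball_subset_ball hr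
  have hls := hS.sum_ls_le hst hχ hn
  have hα := R.α_pos
  have hDM := hM n hn
  refine ⟨hS.chain.gt ψ n, hS.isGraphTransform_gt h hn hr, ⟨hg.diff.mono hsub, R.kap n,
    fun x hx y hy => hg.holder x (hsub hx) y (hsub hy)⟩, fun hκ => ⟨hg.diff.mono hsub, ?_, ?_,
    fun x hx y hy => (hg.holder x (hsub hx) y (hsub hy)).trans ?_⟩⟩
  · refine hg.zero.trans ?_
    rw [mul_assoc, ← Real.exp_add]
    refine mul_le_mul_of_nonneg_left (Real.exp_le_exp.2 ?_) R.τ_nonneg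
    unfold Rates.decay
    linarith
  · refine hg.dzero.trans (mul_le_mul_of_nonneg_left (Real.exp_le_exp.2 ?_) R.σ_nonneg)
    rw [mul_assoc]
    refine mul_le_mul_of_nonneg_left ?_ hα.le
    unfold Rates.decay
    linarith
  · refine mul_le_mul_of_nonneg_right ?_ (Real.rpow_nonneg (norm_nonneg _) _)
    refine mul_le_mul ?_ (Real.exp_le_exp.2 (mul_le_mul_of_nonneg_left hDM hα.le))
      (Real.exp_pos _).le R.κ_pos.le
    -- The hypothesis on `κh` says exactly that its remnant at time `n` is at most `κ`.
    refine max_le le_rfl ?_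
    have := mul_le_mul_of_nonneg_right hκ (Real.exp_pos (-(R.α * n * R.χbu))).le
    rwa [mul_assoc R.κ, ← Real.exp_add, add_neg_cancel, Real.exp_zero, mul_one] at this

lemma expansion : S.Expansion (S.boxes R) R.N R.α R.χbu R.r R.σ R.τ R.κh M R.M0 := by
  intro ψ hψ m n hmn hn ψm hψm v v' hv hv' x y hx hy hxd hyd
  have h := adm_of_mem_initClass hψ
  have hm : m ≤ R.N := hmn.trans hn
  have hr := rad_ge hM hm
  have ox := hS.isOrbit_coordOrbit (m := m) hn x
  have oy := hS.isOrbit_coordOrbit (m := m) hn y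
  have ex : S.coordOrbit m x m = (v, ψm v) :=
    hS.coordOrbit_eq hm (by rw [comp_self, id, hx]; rfl)
  have ey : S.coordOrbit m y m = (v', ψm v') :=
    hS.coordOrbit_eq hm (by rw [comp_self, id, hy]; rfl)
  have gx := hS.eq_gt h hm hr hψm hv
  have gy := hS.eq_gt h hm hr hψm hv'
  have rx := fun k hk hk' => (hS.coordOrbit_mem (m := m) (k := k) hn hxd hk hk').1
  have ry := fun k hk hk' => (hS.coordOrbit_mem (m := m) (k := k) hn hyd hk hk').1
  have x0 : (S.coordOrbit m x m).2 = hS.chain.gt ψ m (S.coordOrbit m x m).1 := by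
    rw [ex]; exact gx
  have y0 : (S.coordOrbit m y m).2 = hS.chain.gt ψ m (S.coordOrbit m y m).1 := by
    rw [ey]; exact gy
  have hexp := ox.expands h hmn hn oy rx ry x0 y0
  have hsum := R.sum_expand_ge hmn hn
  have hDM := hM n hn
  have hgap := R.χ_ge
  have hδ := R.δ_pos
  have hcast : (0 : ℝ) ≤ (n : ℝ) - m := sub_nonneg.2 (Nat.cast_le.2 hmn)
  rw [ex, ey] at hexp
  simp only at hexp
  constructor
  · rcases hmn.eq_or_lt with rfl | hlt
    · rw [comp_self, sub_self, zero_mul, Real.exp_zero, mul_one]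
      refine mul_le_of_le_one_left (norm_nonneg _) (Real.exp_le_one_iff.2 ?_)
      linarith [R.D_nonneg m]
    · have hcone := ox.cone h hlt hn oy rx ry x0 y0
      have hcast1 : (1 : ℝ) ≤ (n : ℝ) - m := by
        have : ((m + 1 : ℕ) : ℝ) ≤ n := Nat.cast_le.2 hlt
        push_cast at this
        linarith
      -- As `n - m ≥ 1`, the gap of rates leaves a spare factor `1 + δ`. It pays for comparing full
      -- distances with base distances, by `(1 - δ / 3) (1 + δ) ≥ 1 + δ / 10`.
      have h1 : Real.exp (-M n) * Real.exp (((n : ℝ) - m) * R.χbu) * (1 + R.δ) ≤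
          Real.exp (∑ k ∈ Finset.Ico m n, (R.lu k - R.δ)) := by
        refine (mul_le_mul_of_nonneg_left R.one_add_δ_le (by positivity)).trans ?_
        rw [← Real.exp_add, ← Real.exp_add]
        refine Real.exp_le_exp.2 ?_
        nlinarith
      have h2 : ‖x - y‖ ≤ (1 + R.δ / 10) * ‖v - v'‖ := by
        have e : x - y = ((v - v' : S.Eu m) : V d) + ((ψm v - ψm v' : S.Es m) : V d) := by
          rw [hx, hy]; push_cast; abel
        have f := (MapChain.flat_gt (M := hS.chain) h hm).norm_sub_le
          (mem_ball_zero_iff.2 (hv.trans_le hr)) (mem_ball_zero_iff.2 (hv'.trans_le hr))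
        rw [← gx, ← gy] at f
        have f2 := mul_le_mul_of_nonneg_right R.γ_le_δ (norm_nonneg (v - v'))
        rw [e]
        refine (norm_add_le _ _).trans ?_
        rw [Submodule.norm_coe, Submodule.norm_coe]
        linarith
      -- The reverse triangle inequality in a narrow cone; the angle of the splitting does not
      -- enter.
      have h3 : (1 - R.δ / 3) * ‖(S.coordOrbit m x n).1 - (S.coordOrbit m y n).1‖ ≤
          ‖S.comp m n x - S.comp m n y‖ := by
        rw [← hS.inc_coordOrbit hn x, ← hS.inc_coordOrbit hn y, ← map_sub, inc_apply]
        have := norm_sub_norm_le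
          (((S.coordOrbit m x n - S.coordOrbit m y n).1 : S.Eu n) : V d)
          (-(((S.coordOrbit m x n - S.coordOrbit m y n).2 : S.Es n) : V d))
        rw [sub_neg_eq_add, norm_neg, Submodule.norm_coe, Submodule.norm_coe] at this
        simp only [Prod.fst_sub, Prod.snd_sub] at this ⊢
        linarith
      have hE : 0 ≤ Real.exp (-M n) * Real.exp (((n : ℝ) - m) * R.χbu) := by positivity
      have hδ' := R.δ_le
      set E := Real.exp (-M n) * Real.exp (((n : ℝ) - m) * R.χbu)
      calc E * ‖x - y‖ ≤ E * ((1 + R.δ / 10) * ‖v - v'‖) := mul_le_mul_of_nonneg_left h2 hE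
        _ ≤ E * (((1 - R.δ / 3) * (1 + R.δ)) * ‖v - v'‖) := by
          gcongr
          nlinarith
        _ = (1 - R.δ / 3) * ((E * (1 + R.δ)) * ‖v - v'‖) := by ring
        _ ≤ (1 - R.δ / 3) *
            (Real.exp (∑ k ∈ Finset.Ico m n, (R.lu k - R.δ)) * ‖v - v'‖) := by
          refine mul_le_mul_of_nonneg_left (mul_le_mul_of_nonneg_right h1 (norm_nonneg _)) ?_
          linarith
        _ ≤ _ := (mul_le_mul_of_nonneg_left hexp (by linarith)).trans h3
  · intro a a' b b' ha hb
    have ea : S.coordOrbit m x n = (a, b) := hS.coordOrbit_eq hn ha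
    have eb : S.coordOrbit m y n = (a', b') := hS.coordOrbit_eq hn hb
    rw [ea, eb] at hexp
    refine le_trans (mul_le_mul_of_nonneg_right ?_ (norm_nonneg _)) hexp
    rw [← Real.exp_add]
    refine Real.exp_le_exp.2 ?_
    nlinarith

lemma attraction (hst : S.StableBound R.N χhs M R.M0) (hχ : χhs + R.δ ≤ χbs) :
    S.Attraction (S.boxes R) R.N R.α χbs R.r R.σ R.τ R.κh M R.M0 := by
  intro ψ hψ n hn ψn hψn v0 w0 vn wn hd hc hvn
  have h := adm_of_mem_initClass hψ
  have hr := rad_ge hM hn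
  have o := hS.isOrbit_coordOrbit (m := 0) hn ((v0 : V d) + (w0 : V d))
  have e0 : S.coordOrbit 0 ((v0 : V d) + (w0 : V d)) 0 = (v0, w0) :=
    hS.coordOrbit_eq (Nat.zero_le _) rfl
  have en : S.coordOrbit 0 ((v0 : V d) + (w0 : V d)) n = (vn, wn) := hS.coordOrbit_eq hn hc
  have := o.attract h hn (fun k hk => by
      have := hS.coordOrbit_mem hn hd k.zero_le hk
      exact ⟨mem_ball_zero_iff.2 this.1, mem_ball_zero_iff.2 this.2⟩)
    (by rw [en]; exact hvn.trans_le hr)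
  rw [e0, en] at this
  rw [hS.eq_gt h hn hr hψn hvn]
  refine this.trans (mul_le_mul_of_nonneg_right (Real.exp_le_exp.2 ?_) (norm_nonneg _))
  exact hS.sum_ls_le hst hχ hn

/-- Points of an iterated graph come from points of the initial graph near the origin. -/
lemma exists_initial {ψ : S.Eu 0 → S.Es 0} (h : R.Adm 0 ψ) {n : ℕ} (hn : n ≤ R.N)
    {ψn : S.Eu n → S.Es n}
    (hψn : S.IsGraphTransform (S.boxes R) n R.r (R.r * Real.exp (-M n)) ψ ψn)
    {v : S.Eu n} (hv : ‖v‖ < R.r * Real.exp (-M n)) :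
    ∃ v0 : S.Eu 0, ‖v0‖ < R.r ∧ ‖v0‖ < Real.exp (-(n * R.χbu)) * R.r + R.τ ∧
      (v0 : V d) + (ψ v0 : V d) ∈ S.orbitDomain (S.boxes R) 0 n ∧
      S.comp 0 n ((v0 : V d) + (ψ v0 : V d)) = (v : V d) + (ψn v : V d) := by
  have hv' : (v : V d) + (ψn v : V d) ∈ graphOn (R.r * Real.exp (-M n)) ψn := ⟨v, hv, rfl⟩
  rw [← hψn] at hv'
  obtain ⟨⟨_, ⟨⟨v0, hv0, rfl⟩, hd⟩, hc⟩, -⟩ := hv'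
  refine ⟨v0, hv0, ?_, hd, hc⟩
  have o := hS.isOrbit_coordOrbit (m := 0) hn ((v0 : V d) + (ψ v0 : V d))
  have e0 : S.coordOrbit 0 ((v0 : V d) + (ψ v0 : V d)) 0 = (v0, ψ v0) :=
    hS.coordOrbit_eq (Nat.zero_le _) rfl
  have en : S.coordOrbit 0 ((v0 : V d) + (ψ v0 : V d)) n = (v, ψn v) := hS.coordOrbit_eq hn hc
  have h1 := o.initial_le h hn (fun k hk => (hS.coordOrbit_mem hn hd k.zero_le hk).1)
    (by rw [e0])
  rw [e0, en] at h1
  have h2 := R.sum_expand_ge n.zero_le hn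
  have h3 : R.τ * (1 - Real.exp (-(n * R.δ))) ≤ R.τ :=
    mul_le_of_le_one_right R.τ_nonneg (by linarith [Real.exp_pos (-(n * R.δ))])
  have h4 : Real.exp (-∑ k ∈ Finset.Ico 0 n, (R.lu k - R.δ)) * ‖v‖ <
      Real.exp (-(n * R.χbu)) * R.r := by
    calc _ < Real.exp (-∑ k ∈ Finset.Ico 0 n, (R.lu k - R.δ)) * (R.r * Real.exp (-M n)) :=
          mul_lt_mul_of_pos_left hv (Real.exp_pos _)
      _ = Real.exp (-∑ k ∈ Finset.Ico 0 n, (R.lu k - R.δ) - M n) * R.r := by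
          rw [sub_eq_add_neg, Real.exp_add]; ring
      _ ≤ _ := by
          refine mul_le_mul_of_nonneg_right (Real.exp_le_exp.2 ?_) R.r_pos.le
          have h5 := R.χ_ge
          have h6 := R.δ_pos
          have h7 : (n : ℝ) * R.χbu ≤ n * (R.χ - R.δ) :=
            mul_le_mul_of_nonneg_left (by linarith) n.cast_nonneg
          push_cast at h2
          linarith [hM n hn]
  simp only at h1
  linarith

lemma contraction (hst : S.StableBound R.N χhs M R.M0) (hχ : χhs + R.δ ≤ χbs) :
    S.Contraction (S.boxes R) R.N R.α R.χbu χbs R.r R.σ R.τ R.κh M R.M0 := by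
  intro ψ hψ φ hφ n hn ψn φn hψn hφn
  have h := adm_of_mem_initClass hψ
  have h' := adm_of_mem_initClass hφ
  constructor
  · intro heq v hv
    obtain ⟨v0, hv0, hv0', hd, hc⟩ := hS.exists_initial hM h hn hψn hv
    have e := heq v0 hv0 (hv0'.trans_le (by
      have h1 : 1 ≤ Real.exp (M n) := Real.one_le_exp ((R.D_nonneg n).trans (hM n hn))
      have h2 : 0 ≤ Real.exp (-(n * R.χbu)) * R.r := by have := R.r_pos; positivity
      nlinarith))
    have hmem : S.inc n (v, ψn v) ∈ graphOn (R.r * Real.exp (-M n)) φn := by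
      rw [← hφn]
      exact ⟨⟨_, ⟨⟨v0, hv0, by rw [e]⟩, hd⟩, hc⟩, ⟨v, ψn v, hv, rfl⟩⟩
    exact ((mem_graphOn_iff (hS.compl hn)).1 hmem).2
  · intro v hv
    obtain ⟨v0, hv0, hv0', hd, hc⟩ := hS.exists_initial hM h hn hψn hv
    -- The orbit starting on the graph of `ψ` is attracted to the image of the graph of `φ`, so only
    -- the vertical distance over `v0` has to be bounded.
    have h1 := hS.attraction hM hst hχ φ hφ n hn φn hφn v0 (ψ v0) v (ψn v) hd hc hv
    have hr0 : R.rad 0 = R.r := by simp [Rates.rad, R.D_zero]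
    have bound : ∀ {g : S.Eu 0 → S.Es 0}, g ∈ S.initClass R.α R.r R.τ R.σ R.κh R.M0 →
        ‖g v0‖ ≤ R.τ * Real.exp (-R.M0) + R.γ * ‖v0‖ := by
      intro g hg
      have f := ((adm_of_mem_initClass hg).flat (Nat.zero_le _)).norm_sub_le
        (mem_ball_zero_iff.2 (hv0.trans_eq hr0.symm)) (mem_ball_self (R.rad_pos 0))
      have f2 := norm_add_le (g v0 - g 0) (g 0)
      rw [sub_add_cancel] at f2
      rw [sub_zero] at f
      linarith [hg.2.1]
    have h2 := norm_sub_le (ψ v0) (φ v0)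
    have h3 := bound hψ
    have h4 := bound hφ
    have hM0 : 0 ≤ R.M0 := by
      have := hst 0 (Nat.zero_le _)
      simp only [Finset.range_zero, Finset.sum_empty, Nat.cast_zero, zero_mul, zero_sub] at this
      linarith [hM 0 (Nat.zero_le _), R.D_nonneg 0]
    have h5 : R.τ * Real.exp (-R.M0) ≤ R.τ :=
      mul_le_of_le_one_right R.τ_nonneg (Real.exp_le_one_iff.2 (by linarith))
    have hγ : R.γ ≤ 1 / 2 := by linarith [R.γ_le_δ, R.δ_le]
    have h6 : R.γ * ‖v0‖ ≤ 1 / 2 * (Real.exp (-(n * R.χbu)) * R.r + R.τ) :=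
      mul_le_mul hγ hv0'.le (norm_nonneg _) (by norm_num)
    -- Two heights at the origin give `2 τ`; two slopes at most `1/2` over `‖v0‖` give the remaining
    -- `τ` and the term in `r`.
    have h7 : ‖ψ v0 - φ v0‖ ≤ 3 * R.τ + R.r * Real.exp (-(n * R.χbu)) := by linarith
    have hE : Real.exp (-M n) ≤ 1 :=
      Real.exp_le_one_iff.2 (by linarith [hM n hn, R.D_nonneg n])
    have hr := R.r_pos
    have e : Real.exp (R.M0 - M n + n * χbs) =
        Real.exp (n * χbs) * Real.exp R.M0 * Real.exp (-M n) := by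
      rw [← Real.exp_add, ← Real.exp_add]; ring_nf
    rw [e] at h1
    refine h1.trans ?_
    rw [mul_assoc]
    refine mul_le_mul_of_nonneg_left ?_ (by positivity)
    have h8 := mul_le_mul_of_nonneg_left h7 (Real.exp_pos (-M n)).le
    have h9 : 0 ≤ R.r * Real.exp (-(n * R.χbu)) := by positivity
    nlinarith

end HasRates

end LocalSystem
end EffHyp
end

/-! ### Hyperbolic times and the deficit -/

noncomputable section
namespace EffHyp

open Classical in
/-- Pliss' lemma: a sequence with large average and bounded above has many times all of whose
backward averages are large. -/
lemma exists_hyperbolic_times {a : ℕ → ℝ} {N : ℕ} {L χ χ' : ℝ} (ha : ∀ k < N, a k ≤ L)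
    (hL : χ ≤ L) (hsum : (N : ℝ) * χ' ≤ ∑ k ∈ Finset.range N, a k) :
    ∃ Γ ⊆ Finset.Icc 1 N, N * (χ' - χ) ≤ (L - χ) * Γ.card ∧
      ∀ n ∈ Γ, ∀ m < n, ((n : ℝ) - m) * χ ≤ ∑ k ∈ Finset.Ico m n, a k := by
  let P : ℕ → Prop := fun n => 1 ≤ n ∧ ∀ m < n, ((n : ℝ) - m) * χ ≤ ∑ k ∈ Finset.Ico m n, a k
  -- Bounding all earlier partial sums at once lets the induction jump back. A hyperbolic time
  -- raises the sum by at most `L - χ`. At any other time some tail averages below `χ`, so the sum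
  -- is less than the one at the start `j` of that tail.
  have key : ∀ n ≤ N, ∀ m ≤ n, ∑ k ∈ Finset.range m, (a k - χ) ≤
      (L - χ) * ((Finset.range (n + 1)).filter P).card := by
    intro n
    induction n with
    | zero =>
      intro _ m hm
      rw [Nat.le_zero.1 hm]
      simp only [Finset.range_zero, Finset.sum_empty]
      exact mul_nonneg (by linarith) (Nat.cast_nonneg _)
    | succ n ih =>
      intro hn m hm
      have ih := ih (by omega)
      have hins := Finset.range_add_one (n := n + 1)
      by_cases hP : P (n + 1)
      · have hcard : ((Finset.range (n + 1 + 1)).filter P).card =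
            ((Finset.range (n + 1)).filter P).card + 1 := by
          rw [hins, Finset.filter_insert, if_pos hP, Finset.card_insert_of_notMem (by simp)]
        rw [hcard]
        push_cast
        rcases Nat.le_succ_iff.1 hm with hm | rfl
        · linarith [ih m hm]
        · rw [Finset.sum_range_succ]
          linarith [ih n le_rfl, ha n (by omega)]
      · have hcard : ((Finset.range (n + 1 + 1)).filter P).card =
            ((Finset.range (n + 1)).filter P).card := by
          rw [hins, Finset.filter_insert, if_neg hP]
        rw [hcard]
        rcases Nat.le_succ_iff.1 hm with hm | rfl
        · exact ih m hm
        · have : ∃ j < n + 1, ∑ k ∈ Finset.Ico j (n + 1), a k < (((n + 1 : ℕ) : ℝ) - j) * χ := by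
            by_contra! h
            exact hP ⟨by omega, h⟩
          obtain ⟨j, hj, hlt⟩ := this
          have h1 := ih j (by omega)
          have h2 := Finset.sum_range_add_sum_Ico (fun k => a k - χ) hj.le
          rw [Finset.sum_sub_distrib (s := Finset.Ico j (n + 1)), Finset.sum_const, Nat.card_Ico,
            nsmul_eq_mul, Nat.cast_sub hj.le] at h2
          linarith
  refine ⟨(Finset.range (N + 1)).filter P, fun n hn => ?_, ?_, fun n hn => ?_⟩
  · rw [Finset.mem_filter, Finset.mem_range] at hn
    exact Finset.mem_Icc.2 ⟨hn.2.1, by omega⟩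
  · have := key N le_rfl N le_rfl
    rw [Finset.sum_sub_distrib, Finset.sum_const, Finset.card_range, nsmul_eq_mul] at this
    linarith
  · exact (Finset.mem_filter.1 hn).2.2

namespace LocalSystem

variable {d : ℕ} {S : LocalSystem d} {α βbar χ L : ℝ} {N : ℕ}

lemma deficit_nonneg (n : ℕ) : 0 ≤ S.deficit α βbar χ n := by
  have := Finset.le_sup' (fun m => ∑ k ∈ Finset.Ico m n, (χ - S.lamE α βbar k))
    (Finset.self_mem_range_succ n)
  simp only [Finset.Ico_self, Finset.sum_empty] at this
  exact this

lemma deficit_zero : S.deficit α βbar χ 0 = 0 := by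
  simp [deficit]

lemma deficit_succ (n : ℕ) :
    S.deficit α βbar χ n + χ - S.lamE α βbar n ≤ S.deficit α βbar χ (n + 1) := by
  obtain ⟨m, hm, e⟩ := Finset.exists_mem_eq_sup' (Finset.nonempty_range_add_one (n := n))
    (fun m => ∑ k ∈ Finset.Ico m n, (χ - S.lamE α βbar k))
  rw [Finset.mem_range] at hm
  have h1 := Finset.le_sup' (fun m => ∑ k ∈ Finset.Ico m (n + 1), (χ - S.lamE α βbar k))
    (Finset.mem_range.2 (show m < n + 1 + 1 by omega))
  rw [Finset.sum_Ico_succ_top (by omega)] at h1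
  have e' : S.deficit α βbar χ n = ∑ k ∈ Finset.Ico m n, (χ - S.lamE α βbar k) := e
  rw [e']
  exact le_trans (by linarith) h1

lemma deficit_le {n : ℕ} {M : ℝ} (h : S.UnstableBound α βbar χ n M) :
    S.deficit α βbar χ n ≤ M := by
  refine Finset.sup'_le _ _ fun m hm => ?_
  rw [Finset.mem_range] at hm
  rcases (Nat.lt_succ_iff.1 hm).eq_or_lt with rfl | hlt
  · simpa using h.1
  · have := h.2 m hlt
    rw [Finset.sum_sub_distrib, Finset.sum_const, Nat.card_Ico, nsmul_eq_mul,
      Nat.cast_sub hlt.le]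
    linarith

lemma defect_nonneg (n : ℕ) : 0 ≤ S.defect α n := le_max_left _ _

lemma le_mul_defect (hα : 0 < α) (n : ℕ) : S.lamS n - S.lamU n ≤ α * S.defect α n := by
  have : (S.lamS n - S.lamU n) / α ≤ S.defect α n := le_max_right _ _
  rwa [div_le_iff₀' hα] at this

lemma lamE_le (n : ℕ) : S.lamE α βbar n ≤ S.lamU n - S.defect α n := by
  unfold lamE
  split_ifs
  · exact le_rfl
  · exact min_le_left _ _

lemma lamE_le_lamU (n : ℕ) : S.lamE α βbar n ≤ S.lamU n :=
  (lamE_le n).trans (by linarith [S.defect_nonneg (α := α) n])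

/-- While `β n` exceeds the threshold, the second branch of `λ^e` gives `β n ≤ β (n - 1) e^{-α
λ_n^e}`, and the deficit grows by at least `-λ_n^e`. Below the threshold the bound is trivial,
because the deficit is nonnegative. -/
lemma beta_le_deficit_succ (hα : 0 < α) (hβbar : 0 < βbar) (hχ : 0 < χ)
    (hβ : ∀ n < N, 0 < S.β n) (h0 : S.β 0 ≤ βbar) {n : ℕ} (hn : n < N) :
    S.β n ≤ βbar * Real.exp (α * S.deficit α βbar χ (n + 1)) := by
  have triv : ∀ {n}, S.β n ≤ βbar → S.β n ≤ βbar * Real.exp (α * S.deficit α βbar χ (n + 1)) :=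
    fun h => h.trans (le_mul_of_one_le_right hβbar.le
      (Real.one_le_exp (mul_nonneg hα.le (deficit_nonneg _))))
  induction n with
  | zero => exact triv h0
  | succ n ih =>
    by_cases hb : S.β (n + 1) ≤ βbar
    · exact triv hb
    have h1 := ih (by omega)
    have hpos := hβ n (by omega)
    have hpos' := hβ (n + 1) hn
    have h2 : S.lamE α βbar (n + 1) ≤ 1 / α * Real.log (S.β n / S.β (n + 1)) := by
      rw [lamE, if_neg hb]
      exact min_le_right _ _
    have h3 : α * S.lamE α βbar (n + 1) ≤ Real.log (S.β n / S.β (n + 1)) := by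
      have := mul_le_mul_of_nonneg_left h2 hα.le
      rwa [← mul_assoc, mul_one_div_cancel hα.ne', one_mul] at this
    have h4 : Real.exp (α * S.lamE α βbar (n + 1)) * S.β (n + 1) ≤ S.β n := by
      rw [← le_div_iff₀ hpos', ← Real.exp_log (div_pos hpos hpos')]
      exact Real.exp_le_exp.2 h3
    have h5 : S.β (n + 1) ≤ S.β n * Real.exp (-(α * S.lamE α βbar (n + 1))) := by
      rw [Real.exp_neg, ← div_eq_mul_inv, le_div_iff₀ (Real.exp_pos _), mul_comm]
      exact h4
    calc S.β (n + 1) ≤ S.β n * Real.exp (-(α * S.lamE α βbar (n + 1))) := h5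
      _ ≤ (βbar * Real.exp (α * S.deficit α βbar χ (n + 1))) *
          Real.exp (-(α * S.lamE α βbar (n + 1))) :=
        mul_le_mul_of_nonneg_right h1 (Real.exp_pos _).le
      _ = βbar * Real.exp (α * (S.deficit α βbar χ (n + 1) - S.lamE α βbar (n + 1))) := by
        rw [mul_assoc, ← Real.exp_add]; ring_nf
      _ ≤ _ := by
        refine mul_le_mul_of_nonneg_left (Real.exp_le_exp.2 ?_) hβbar.le
        refine mul_le_mul_of_nonneg_left ?_ hα.le
        linarith [S.deficit_succ (α := α) (βbar := βbar) (χ := χ) (n + 1)]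

/-- The bound on the boxes must involve the deficit at time `n` itself; shifting by one step costs
`e^L` by (C4). -/
lemma beta_le_deficit (hα : 0 < α) (hβbar : 0 < βbar) (hχ : 0 < χ) (hL : 0 ≤ L)
    (hβ : ∀ n < N, 0 < S.β n) (h0 : S.β 0 ≤ βbar)
    (hβL : ∀ n, n + 1 < N → S.β (n + 1) ≤ Real.exp L * S.β n) {n : ℕ} (hn : n < N) :
    S.β n ≤ Real.exp L * βbar * Real.exp (α * S.deficit α βbar χ n) := by
  cases n with
  | zero =>
    rw [deficit_zero, mul_zero, Real.exp_zero, mul_one]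
    exact h0.trans (le_mul_of_one_le_left hβbar.le (Real.one_le_exp hL))
  | succ n =>
    rw [mul_assoc]
    exact (hβL n hn).trans (mul_le_mul_of_nonneg_left
      (beta_le_deficit_succ hα hβbar hχ hβ h0 (by omega)) (Real.exp_pos _).le)

/-- The conclusions for one choice of constants that are small in terms of `δ` and `η`. -/
lemma conclusions {χbu χhs χbs δ η r τ γ σ κ κh θbar M0s : ℝ} {M : ℕ → ℝ}
    (hL : 0 ≤ L) (hβbar : 0 < βbar) (hα : 0 < α) (hα1 : α ≤ 1) (hχ : 0 < χ) (hχbs : χbs < 0)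
    (hδ : 0 < δ) (hδ1 : δ ≤ 1 / 2) (hδχ : 10 * δ ≤ α * (χ - χbu)) (hδχbu : 10 * δ ≤ α * χbu)
    (hδs : χhs + δ ≤ χbs) (hη : 0 ≤ η) (hηδ : 100 * η ≤ δ) (hηα : (2 * η) ^ α ≤ δ / 10)
    (hγ : 0 < γ) (hγ' : Real.exp (2 * L + 1) * γ ≤ δ / 10) (hr : 0 < r)
    (hrη : 2 * (4 * (Real.exp L * βbar)) * r ^ α ≤ η * Real.exp (-L))
    (hθ : θbar ≤ 1 / βbar) (hτ : 0 ≤ τ) (hτr : τ ≤ r) (hσ : 0 ≤ σ) (hκ : 0 < κ) (hκh : κ ≤ κh)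
    (hκ1 : 20 * (4 * (Real.exp L * βbar)) * Real.exp L ≤ δ * κ)
    (hκ2 : 2 * Real.exp (2 * L + 2) * (4 * (Real.exp L * βbar)) ≤
      Real.exp (-(α * χbu)) * (1 - Real.exp (-δ)) * κ)
    (hκτ : κh * τ ^ α ≤ σ) (hκr : σ + κh * r ^ α ≤ γ)
    (c1 : S.C1 N α) (c2 : S.C2 N) (c3 : S.C3 N α) (c4 : S.C4 N L)
    (c5 : S.C5 N α βbar χ r τ γ) (h0 : S.β 0 ≤ βbar)
    (hM : ∀ n ≤ N, S.UnstableBound α βbar χ n (M n)) (hst : S.StableBound N χhs M M0s) :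
    S.WellDefined (S.localBox α βbar χ r τ γ) N α χbu χbs r θbar σ τ κ κh M M0s ∧
      S.Expansion (S.localBox α βbar χ r τ γ) N α χbu r σ τ κh M M0s ∧
      S.Attraction (S.localBox α βbar χ r τ γ) N α χbs r σ τ κh M M0s ∧
      S.Contraction (S.localBox α βbar χ r τ γ) N α χbu χbs r σ τ κh M M0s := by
  have hβ : ∀ n < N, 0 < S.β n := fun n hn => (c3.2 n hn).1
  have hDM : ∀ n ≤ N, S.deficit α βbar χ n ≤ M n := fun n hn => deficit_le (hM n hn)
  have hb1 : ∀ n < N, S.β n ≤ βbar * Real.exp (α * S.deficit α βbar χ (n + 1)) :=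
    fun n hn => beta_le_deficit_succ hα hβbar hχ hβ h0 hn
  have hb2 : ∀ n < N, S.β n ≤ Real.exp L * βbar * Real.exp (α * S.deficit α βbar χ n) :=
    fun n hn => beta_le_deficit hα hβbar hχ hL hβ h0 c4.2 hn
  let R : Rates :=
    { N := N, α := α, L := L, χ := χ, χbu := χbu, δ := δ, η := η
      C := 4 * (Real.exp L * βbar)
      r := r, τ := τ, γ := γ, σ := σ, κ := κ, κh := κh, M0 := M0s
      lu := S.lamU, ls := S.lamS, le := S.lamE α βbar, D := S.deficit α βbar χ
      b := fun n => 4 * S.β n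
      α_pos := hα, α_le := hα1, L_nonneg := hL, δ_pos := hδ, δ_le := hδ1, δ_χ := hδχ
      δ_χbu := hδχbu, η_nonneg := hη, η_le := hηδ, η_rpow := hηα, γ_pos := hγ, γ_le := hγ'
      r_pos := hr, τ_nonneg := hτ, τ_le := hτr, σ_nonneg := hσ, κ_pos := hκ, κ_le := hκh
      κτ := hκτ, κr := hκr, C_nonneg := by positivity, C_r := hrη, C_κ := hκ1, C_κ' := hκ2
      D_zero := deficit_zero, D_nonneg := deficit_nonneg, D_succ := fun n _ => deficit_succ n
      lu_le := fun n hn => (abs_le.1 (c4.1 n hn).1).2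
      le_lu := fun n hn => (abs_le.1 (c4.1 n hn).1).1
      ls_le := fun n hn => (abs_le.1 (c4.1 n hn).2).2
      le_ls := fun n hn => (abs_le.1 (c4.1 n hn).2).1
      le_le := fun n _ => lamE_le_lamU n
      dom := fun n _ => by
        have h1 := mul_le_mul_of_nonneg_left (S.lamE_le (α := α) (βbar := βbar) n) hα.le
        have h2 := S.le_mul_defect hα n
        have h3 := mul_nonneg hα.le (S.defect_nonneg (α := α) n)
        -- Under domination `α ≤ 1` suffices; otherwise the defect makes up for `λ^s - λ^u`.
        rcases le_total 0 (S.lamS n - S.lamU n) with h | h <;> nlinarith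
      dom' := fun n _ => by
        have h1 := mul_le_mul_of_nonneg_left (S.lamE_le (α := α) (βbar := βbar) n) hα.le
        have h2 := S.le_mul_defect hα n
        linarith
      b_nonneg := fun n hn => by linarith [hβ n hn]
      b_le := fun n hn => by
        have := hb2 n hn
        linarith
      b_le' := fun n hn => by
        have h1 := hb1 n hn
        have h2 : βbar * Real.exp (α * S.deficit α βbar χ (n + 1)) ≤
            Real.exp L * (βbar * Real.exp (α * S.deficit α βbar χ (n + 1))) :=
          le_mul_of_one_le_left (by positivity) (Real.one_le_exp hL)
        linarith
      stable := fun n hn => by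
        have h1 := hst n hn
        have h2 := hDM n hn
        have h3 : (n : ℝ) * (χhs + δ) ≤ 0 :=
          mul_nonpos_of_nonneg_of_nonpos n.cast_nonneg (by linarith)
        linarith }
  have hS : S.HasRates R :=
    { c1 := c1, c2 := c2, c3 := c3, dom := c5
      lu := fun _ _ => rfl, ls := fun _ _ => rfl, b := fun _ _ => rfl }
  refine ⟨hS.wellDefined hDM hst hδs fun n hn1 hn => ?_, hS.expansion hDM,
    hS.attraction hDM hst hδs, hS.contraction hDM hst hδs⟩
  obtain ⟨n, rfl⟩ : ∃ k, n = k + 1 := ⟨n - 1, by omega⟩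
  have hθ0 := (c3.1 (n + 1) hn).1
  have hsin := (c3.2 n hn).2.2.2.1
  have h1 := hb1 n hn
  -- Since `1 ≤ β sin θ ≤ β θ`, control of `β` by the deficit bounds the angle from below.
  have h2 : 1 ≤ βbar * Real.exp (α * S.deficit α βbar χ (n + 1)) * S.θ (n + 1) :=
    hsin.trans (mul_le_mul h1 (Real.sin_le hθ0.le) (by
      by_contra h
      push Not at h
      nlinarith [hβ n hn]) (by positivity))
  have h3 : Real.exp (α * S.deficit α βbar χ (n + 1)) * Real.exp (-α * M (n + 1)) ≤ 1 := by
    rw [← Real.exp_add]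
    refine Real.exp_le_one_iff.2 ?_
    have := mul_le_mul_of_nonneg_left (hDM (n + 1) hn) hα.le
    linarith
  calc θbar * Real.exp (-α * M (n + 1)) ≤ 1 / βbar * Real.exp (-α * M (n + 1)) * 1 := by
        rw [mul_one]
        gcongr
    _ ≤ 1 / βbar * Real.exp (-α * M (n + 1)) *
        (βbar * Real.exp (α * S.deficit α βbar χ (n + 1)) * S.θ (n + 1)) := by gcongr
    _ = (Real.exp (α * S.deficit α βbar χ (n + 1)) * Real.exp (-α * M (n + 1))) *
        S.θ (n + 1) := by field_simp
    _ ≤ S.θ (n + 1) := mul_le_of_le_one_left hθ0.le h3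

end LocalSystem
end EffHyp
end

/-! ### Choice of constants and proof of the theorem -/

theorem theoremD (L βbar α χu χhu χbu χhs χbs : ℝ)
    (hL : 0 < L) (hβbar : 0 < βbar) (hα : 0 < α) (hα1 : α ≤ 1)
    (hχbu : 0 < χbu) (hχhu : χbu < χhu) (hχu : χhu < χu)
    (hχhs : χhs < χbs) (hχbs : χbs < 0) :
    ∃ γ₁ > (0 : ℝ), ∃ r₁ > (0 : ℝ), ∃ θ₁ > (0 : ℝ), ∃ σ₁ > (0 : ℝ), ∃ τ₁ > (0 : ℝ),
    ∃ κ₁ > (0 : ℝ),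
    ∀ γ r θbar σ τ κ κh : ℝ, 0 < γ → γ ≤ γ₁ → 0 < r → r ≤ r₁ → 0 < θbar → θbar ≤ θ₁ →
      0 ≤ σ → σ ≤ σ₁ → 0 ≤ τ → τ ≤ τ₁ → κ₁ ≤ κ → κ ≤ κh →
      τ ≤ r → κh * τ ^ α ≤ σ → σ + κh * r ^ α ≤ γ →
    ∀ (d N : ℕ) (S : EffHyp.LocalSystem d),
      S.C1 N α → S.C2 N → S.C3 N α → S.C4 N L → S.C5 N α βbar χhu r τ γ → S.β 0 ≤ βbar →
    (∀ (M : ℕ → ℝ) (M0s : ℝ),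
      (∀ n ≤ N, S.UnstableBound α βbar χhu n (M n)) → S.StableBound N χhs M M0s →
        S.WellDefined (S.localBox α βbar χhu r τ γ) N α χbu χbs r θbar σ τ κ κh M M0s ∧
        S.Expansion (S.localBox α βbar χhu r τ γ) N α χbu r σ τ κh M M0s ∧
        S.Attraction (S.localBox α βbar χhu r τ γ) N α χbs r σ τ κh M M0s ∧
        S.Contraction (S.localBox α βbar χhu r τ γ) N α χbu χbs r σ τ κh M M0s) ∧
    (χu ≤ 1 / (N : ℝ) * ∑ k ∈ Finset.range N, S.lamE α βbar k →
      ∃ Γ ⊆ Finset.Icc 1 N,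
        (χu - χhu) / (L - χhu) * N ≤ (Γ.card : ℝ) ∧
        (∀ n ∈ Γ, ∀ m < n,
          χhu ≤ 1 / ((n : ℝ) - m) * ∑ k ∈ Finset.Ico m n, S.lamE α βbar k) ∧
        ∀ (M : ℕ → ℝ) (M0s : ℝ), (∀ n ∈ Γ, M n = 0) →
          (∀ n ≤ N, n ∉ Γ → S.UnstableBound α βbar χhu n (M n)) → S.StableBound N χhs M M0s →
            S.WellDefined (S.localBox α βbar χhu r τ γ) N α χbu χbs r θbar σ τ κ κh M M0s ∧
            S.Expansion (S.localBox α βbar χhu r τ γ) N α χbu r σ τ κh M M0s) := by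
  obtain ⟨δ, hδ, hδ1, hδχ, hδχbu, hδs⟩ : ∃ δ > (0 : ℝ), δ ≤ 1 / 2 ∧
      10 * δ ≤ α * (χhu - χbu) ∧ 10 * δ ≤ α * χbu ∧ χhs + δ ≤ χbs := by
    let g := min (min (χhu - χbu) (χbs - χhs)) (min χbu 1)
    have g0 : 0 < g := lt_min (lt_min (by linarith) (by linarith)) (lt_min hχbu one_pos)
    have g1 : g ≤ χhu - χbu := (min_le_left _ _).trans (min_le_left _ _)
    have g2 : g ≤ χbs - χhs := (min_le_left _ _).trans (min_le_right _ _)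
    have g3 : g ≤ χbu := (min_le_right _ _).trans (min_le_left _ _)
    have g4 : g ≤ 1 := (min_le_right _ _).trans (min_le_right _ _)
    have g5 : 0 < α * g := mul_pos hα g0
    have g6 : α * g ≤ g := mul_le_of_le_one_left g0.le hα1
    have g7 := mul_le_mul_of_nonneg_left g1 hα.le
    have g8 := mul_le_mul_of_nonneg_left g3 hα.le
    exact ⟨α * g / 20, by positivity, by linarith, by linarith, by linarith, by linarith⟩
  obtain ⟨η, hη, hηδ, hηα⟩ : ∃ η > (0 : ℝ), 100 * η ≤ δ ∧ (2 * η) ^ α ≤ δ / 10 := by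
    have h1 : 0 < (δ / 10) ^ (1 / α) := by positivity
    refine ⟨min (δ / 100) ((δ / 10) ^ (1 / α) / 2), lt_min (by positivity) (by positivity),
      by linarith [min_le_left (δ / 100) ((δ / 10) ^ (1 / α) / 2)], ?_⟩
    have h2 : 2 * min (δ / 100) ((δ / 10) ^ (1 / α) / 2) ≤ (δ / 10) ^ (1 / α) := by
      linarith [min_le_right (δ / 100) ((δ / 10) ^ (1 / α) / 2)]
    have h3 : 0 < min (δ / 100) ((δ / 10) ^ (1 / α) / 2) :=
      lt_min (by positivity) (by positivity)
    refine (Real.rpow_le_rpow (by positivity) h2 hα.le).trans (le_of_eq ?_)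
    rw [← Real.rpow_mul (by positivity), one_div_mul_cancel hα.ne', Real.rpow_one]
  have hC : 0 < 4 * (Real.exp L * βbar) := by positivity
  set C := 4 * (Real.exp L * βbar) with hCdef
  have hδe : 0 < 1 - Real.exp (-δ) := by
    have : Real.exp (-δ) < 1 := Real.exp_lt_one_iff.2 (by linarith)
    linarith
  have hE : 0 < Real.exp (-(α * χbu)) * (1 - Real.exp (-δ)) := mul_pos (Real.exp_pos _) hδe
  -- The radius solves `2 C r^α = η e^{-L}`, and `κ₁` is the larger of the two lower bounds for `κ`.
  -- The thresholds 1 for `σ` and `τ` are arbitrary: the coupling conditions with `r` and `γ`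
  -- already suffice.
  refine ⟨Real.exp (-(2 * L + 1)) * (δ / 10), by positivity,
    (η * Real.exp (-L) / (2 * C)) ^ (1 / α), by positivity, 1 / βbar, by positivity, 1, one_pos,
    1, one_pos, max (20 * C * Real.exp L / δ)
      (2 * Real.exp (2 * L + 2) * C / (Real.exp (-(α * χbu)) * (1 - Real.exp (-δ)))),
    lt_max_of_lt_left (by positivity), ?_⟩
  intro γ r θbar σ τ κ κh hγ hγ1 hr hr1 _ hθ hσ _ hτ _ hκ1 hκκ hτr hκτ hκr d N S c1 c2 c3 c4 c5
    hβ0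
  have hχhu0 : 0 < χhu := hχbu.trans hχhu
  have hγ' : Real.exp (2 * L + 1) * γ ≤ δ / 10 := by
    have := mul_le_mul_of_nonneg_left hγ1 (Real.exp_pos (2 * L + 1)).le
    rwa [← mul_assoc, ← Real.exp_add, add_neg_cancel, Real.exp_zero, one_mul] at this
  have hrη : 2 * C * r ^ α ≤ η * Real.exp (-L) := by
    have := Real.rpow_le_rpow hr.le hr1 hα.le
    rwa [← Real.rpow_mul (by positivity), one_div_mul_cancel hα.ne', Real.rpow_one,
      le_div_iff₀ (by positivity), mul_comm] at this
  have hκa : 20 * C * Real.exp L ≤ δ * κ := by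
    have := (le_max_left _ _).trans hκ1
    rwa [div_le_iff₀ hδ, mul_comm κ] at this
  have hκb : 2 * Real.exp (2 * L + 2) * C ≤
      Real.exp (-(α * χbu)) * (1 - Real.exp (-δ)) * κ := by
    have := (le_max_right _ _).trans hκ1
    rwa [div_le_iff₀ hE, mul_comm κ] at this
  have hκ : 0 < κ := by
    have : 0 < δ * κ := lt_of_lt_of_le (by positivity) hκa
    exact pos_of_mul_pos_right this hδ.le
  have main : ∀ (M : ℕ → ℝ) (M0s : ℝ),
      (∀ n ≤ N, S.UnstableBound α βbar χhu n (M n)) → S.StableBound N χhs M M0s →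
        S.WellDefined (S.localBox α βbar χhu r τ γ) N α χbu χbs r θbar σ τ κ κh M M0s ∧
        S.Expansion (S.localBox α βbar χhu r τ γ) N α χbu r σ τ κh M M0s ∧
        S.Attraction (S.localBox α βbar χhu r τ γ) N α χbs r σ τ κh M M0s ∧
        S.Contraction (S.localBox α βbar χhu r τ γ) N α χbu χbs r σ τ κh M M0s :=
    fun M M0s hM hst => EffHyp.LocalSystem.conclusions hL.le hβbar hα hα1 hχhu0 hχbs hδ hδ1 hδχ
      hδχbu hδs hη.le hηδ hηα hγ hγ' hr hrη hθ hτ hτr hσ hκ hκκ hκa hκb hκτ hκr c1 c2 c3 c4 c5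
      hβ0 hM hst
  refine ⟨main, fun havg => ?_⟩
  have hle : ∀ k < N, S.lamE α βbar k ≤ L := fun k hk =>
    (EffHyp.LocalSystem.lamE_le_lamU k).trans (abs_le.1 (c4.1 k hk).1).2
  -- For `N = 0` the average is 0 by convention, which contradicts `χu > 0`.
  have hN : 0 < (N : ℝ) := by
    rcases Nat.eq_zero_or_pos N with rfl | h
    · simp at havg
      linarith
    · exact Nat.cast_pos.2 h
  have hsum : (N : ℝ) * χu ≤ ∑ k ∈ Finset.range N, S.lamE α βbar k := by
    rwa [one_div, inv_mul_eq_div, le_div_iff₀ hN, mul_comm] at havg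
  -- An average of at least `χu` of terms at most `L` makes the denominator `L - χhu` positive.
  have hLχ : χhu < L := by
    have h1 : ∑ k ∈ Finset.range N, S.lamE α βbar k ≤ ∑ _k ∈ Finset.range N, L :=
      Finset.sum_le_sum fun k hk => hle k (Finset.mem_range.1 hk)
    rw [Finset.sum_const, Finset.card_range, nsmul_eq_mul] at h1
    exact hχu.trans_le (le_of_mul_le_mul_left (hsum.trans h1) hN)
  obtain ⟨Γ, hΓ, hcard, htimes⟩ := EffHyp.exists_hyperbolic_times hle hLχ.le hsum
  refine ⟨Γ, hΓ, ?_, fun n hn m hm => ?_, fun M M0s hM0 hM hst => ?_⟩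
  · rw [div_mul_eq_mul_div, div_le_iff₀ (by linarith)]
    linarith
  · have hpos : 0 < (n : ℝ) - m := sub_pos.2 (Nat.cast_lt.2 hm)
    rw [one_div, inv_mul_eq_div, le_div_iff₀ hpos, mul_comm]
    exact htimes n hn m hm
  · have h := main M M0s (fun n hn => ?_) hst
    · exact ⟨h.1, h.2.1⟩
    -- At a hyperbolic time the backward averages say that 0 is an admissible unstable bound.
    · by_cases hn' : n ∈ Γ
      · rw [hM0 n hn']
        refine ⟨le_rfl, fun m hm => ?_⟩
        rw [sub_zero]
        exact htimes n hn' m hm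
      · exact hM n hn hn'
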